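/- Let $K$ be a field of characteristic $0$; all gradings are by $\mathbb Z$, $(-)^{v}$ means $(-1)^{\deg v}$, and $\alpha(\sigma,\boldsymbol\xi)$ is the Koszul sign, $\xi_{\sigma(1)}\odot\cdots\odot \xi_{\sigma(n)}=\alpha(\sigma,\boldsymbol\xi)\,\xi_1\odot\cdots\odot \xi_n$. $S_{i,j}$ is the set of $(i,j)$-unshuffles. Let $A$ be an associative, graded commutative, unital $K$-algebra and $L$ a graded $A$-module. Elements $\xi_i\in L$, $a\in A$ below are homogeneous. An $LR_\infty[1]$ algebra structure on $(A,L)$ consists of graded symmetric, $K$-multilinear, degree $1$ brackets $X_k:L^{\times k}\to L$ ($k\ge 1$; $X_0=0$) and graded symmetric, $A$-multilinear, degree $1$ anchors $\sigma_k:L^{\times (k-1)}\to \mathrm{Der}A$ ($k\geq 1$) with $$X_k(\xi_1,\dots,\xi_{k-1},a\xi_k)=\sigma_k(\xi_1,\dots,\xi_{k-1}|a)\xi_k+(-)^{(1+\xi_1+\cdots+\xi_{k-1})a}a\,X_k(\xi_1,\dots,\xi_k),$$ such that for all $k\ge 1$ both components of the higher Jacobiator vanish: $$\sum_{i+j=k}\sum_{\sigma\in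 S_{i,j}}\alpha(\sigma,\boldsymbol\xi)X_{j+1}(X_i(\xi_{\sigma(1)},\dots,\xi_{\sigma(i)}),\xi_{\sigma(i+1)},\dots,\xi_{\sigma(k)})=0,$$ $$\sum_{i+j=k-1}\sum_{\sigma\in S_{i,j}}\alpha(\sigma,\boldsymbol\xi)\Big[(-)^{\xi_{\sigma(1)}+\cdots+\xi_{\sigma(i)}}\sigma_{i+1}(\xi_{\sigma(1)},\dots,\xi_{\sigma(i)}|\sigma_{j+1}(\xi_{\sigma(i+1)},\dots,\xi_{\sigma(k-1)}|a))+\sigma_{j+2}(X_i(\xi_{\sigma(1)},\dots,\xi_{\sigma(i)}),\xi_{\sigma(i+1)},\dots,\xi_{\sigma(k-1)}|a)\Big]=0.$$ A right $(A,L)$-connection in a graded $A$-module $Q$ is a family of graded symmetric, degree $1$ maps $\Delta_k:L^{\times(k-1)}\to \mathrm{End}_K Q$ ($k\ge1$), $A$-multilinear for the $A$-module structure $a\cdot Y=(-)^{aY}Y\circ a$ on operators, with $$\Delta_k(\xi_1,\dots,\xi_{k-1}|aq)=(-)^{(1+\xi_1+\cdots+\xi_{k-1})a}a\,\Delta_k(\xi_1,\dots,\xi_{k-1}|q)-\sigma_k(\xi_1,\dots,\xi_{k-1}|a)q.$$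 It is flat if for all $k\geq 1$ $$\sum_{i+j=k-1}\sum_{\sigma\in S_{i,j}}\alpha(\sigma,\boldsymbol\xi)\Big[\Delta_{j+2}(X_i(\xi_{\sigma(1)},\dots,\xi_{\sigma(i)}),\xi_{\sigma(i+1)},\dots,\xi_{\sigma(k-1)}|q)-(-)^{\xi_{\sigma(1)}+\cdots+\xi_{\sigma(i)}}\Delta_{i+1}(\xi_{\sigma(1)},\dots,\xi_{\sigma(i)}|\Delta_{j+1}(\xi_{\sigma(i+1)},\dots,\xi_{\sigma(k-1)}|q))\Big]=0.$$ Let $\mathscr B$ be an associative, graded commutative, unital algebra, and let $[f,g]=fg-(-)^{fg}gf$ and $\mu_u$ denote graded commutators and multiplication operators. A $K$-linear operator $\square$ on $\mathscr B$ is a differential operator of order $k$ if $[\cdots[\square,\mu_{b_1}]\cdots,\mu_{b_{k+1}}]=0$ for all $b_i\in \mathscr B$. A $BV_\infty$ algebra structure on $\mathscr B$ is a family of degree $1$ differential operators $\square_k$ of order $k$, $k\ge1$, with $\square_k1=0$ and $\sum_{i+j=k}[\square_i,\square_j]=0$ for all $k$. A $P_\infty[1]$ algebra structure on $\mathscr B$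 is a family of graded symmetric, degree $1$ brackets $\Lambda_k:\mathscr B^{\times k}\to\mathscr B$, $k\ge1$, that are derivations in each argument and satisfy the same Jacobi identities as the $X_k$ above. **Proposition.** Let $(A,L)$ be an $LR_\infty[1]$ algebra and $\Delta$ a flat right $(A,L)$-connection in $A$. Let $S_A^\bullet L$ be the graded symmetric algebra of $L$ over $A$. 1. There are unique $K$-linear operators $D_k^\Delta$ on $S_A^\bullet L\cong S_A^\bullet L\otimes_A A$ (the components of the Rinehart operator) such that, for all $\xi_1,\dots,\xi_\ell\in L$ and $q\in A$, $$D_k^\Delta(\xi_1\cdots\xi_\ell\, q)=\sum_{\tau\in S_{k,\ell-k}}\alpha(\tau,\boldsymbol\xi)X_k(\xi_{\tau(1)},\dots,\xi_{\tau(k)})\xi_{\tau(k+1)}\cdots\xi_{\tau(\ell)}\,q-\sum_{\sigma\in S_{\ell-k+1,k-1}}(-)^{\xi_{\sigma(1)}+\cdots+\xi_{\sigma(\ell-k+1)}}\alpha(\sigma,\boldsymbol\xi)\,\xi_{\sigma(1)}\cdots\xi_{\sigma(\ell-k+1)}\,\Delta_k(\xi_{\sigma(\ell-k+2)},\dots,\xi_{\sigma(\ell)}|q).$$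 2. There is a unique degree $1$ multiderivation $\{\cdot,\dots,\cdot\}$ of $S_A^\bullet L$ (with components $k\geq 1$) such that $\{\xi_1,\dots,\xi_k\}=X_k(\xi_1,\dots,\xi_k)$ and $\{\xi_1,\dots,\xi_{k-1},a\}=\sigma_k(\xi_1,\dots,\xi_{k-1}|a)$ for $\xi_i\in L$, $a\in A$, and which vanishes when two arguments are in $A$; it is a $P_\infty[1]$ algebra structure. 3. Each $D_k^\Delta$ is a degree $1$ differential operator of order $k$ on $S_A^\bullet L$, $\sum_{i+j=k}[D_i^\Delta,D_j^\Delta]=0$ for all $k$, $D_k^\Delta 1=0$ for all $k\neq1$, and $D_1^\Delta1=-\Delta_1(1)$. Hence the $D_k^\Delta$ form a $BV_\infty$ algebra structure on $S_A^\bullet L$ if and only if the element $\Delta_1(1)\in A$ of degree $1$ vanishes (for instance, whenever $A$ has no elements of degree $1$ other than $0$). 4. The operators $D_k^\Delta$ generate the $P_\infty[1]$ brackets: for all $k\ge 1$ and all $u_1,\dots,u_k\in S_A^\bullet L$, $$\{u_1,\dots,u_k\}=[\cdots[[D_k^\Delta,\mu_{u_1}],\mu_{u_2}]\cdots,\mu_{u_k}]1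 .$$ -/

import Mathlib

/-- The sign `(-1)^n` of an integer `n`. -/
def sgn (n : ℤ) : ℤ := (n.negOnePow : ℤ)

/-- The Koszul sign `α(σ, v)` of a permutation of homogeneous elements of degrees `d`:
`v_{σ 1} ⊙ ⋯ ⊙ v_{σ n} = α(σ, v) v_1 ⊙ ⋯ ⊙ v_n`. -/
def koszulSign {n : ℕ} (d : Fin n → ℤ) (σ : Equiv.Perm (Fin n)) : ℤ :=
  ∏ i, ∏ j, if i < j ∧ σ j < σ i then sgn (d (σ i) * d (σ j)) else 1

/-- An `(i, j)`-unshuffle `σ` of `{1, …, n}`, `n = i + j`, is the same as the subset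
`s = {σ 1, …, σ i}` with `i` elements. `restr s v` is `(v_{σ 1}, …, v_{σ i})`, the entries of `v`
with index in `s` in increasing order; `restr sᶜ v` is `(v_{σ (i+1)}, …, v_{σ (i+j)})`. -/
def restr {n : ℕ} {M : Type*} (s : Finset (Fin n)) (v : Fin n → M) : Fin s.card → M :=
  fun m => v (s.orderEmbOfFin rfl m)

/-- The Koszul sign of the unshuffle that corresponds to the subset `s`. -/
def unshuffleSign {n : ℕ} (d : Fin n → ℤ) (s : Finset (Fin n)) : ℤ :=
  ∏ b ∈ s, ∏ a ∈ sᶜ, if a < b then sgn (d a * d b) else 1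

section GradedNotions

variable {K : Type*} [Field K]

/-- Graded commutativity of a graded algebra. -/
def GradedCommutative {B : Type*} [Ring B] [Algebra K B] (ℬ : ℤ → Submodule K B) : Prop :=
  ∀ (i j : ℤ) (a b : B), a ∈ ℬ i → b ∈ ℬ j → a * b = sgn (i * j) • (b * a)

/-- A multilinear map is graded symmetric. -/
def GradedSymmetric {M N : Type*} [AddCommGroup M] [Module K M] [AddCommGroup N] [Module K N]
    (ℳ : ℤ → Submodule K M) {k : ℕ} (f : MultilinearMap K (fun _ : Fin k => M) N) : Prop :=
  ∀ (d : Fin k → ℤ) (v : Fin k → M), (∀ i, v i ∈ ℳ (d i)) →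
    ∀ σ : Equiv.Perm (Fin k), f (fun i => v (σ i)) = koszulSign d σ • f v

/-- The value at `v` of the Gerstenhaber square `X ∘ X`, for `X = X_0 + X_1 + ⋯` where `X_k` has
`k` entries:
`∑_{i+j=n} ∑_{σ ∈ S_{i,j}} α(σ,v) X_{j+1}(X_i(v_{σ 1},…,v_{σ i}), v_{σ (i+1)},…,v_{σ (i+j)})`.
For `X` of degree `1` this is `(1/2)[X, X]`. -/
def jacobiator {M : Type*} [AddCommGroup M] [Module K M]
    (X : ∀ k : ℕ, MultilinearMap K (fun _ : Fin k => M) M)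
    {n : ℕ} (d : Fin n → ℤ) (v : Fin n → M) : M :=
  ∑ s : Finset (Fin n), unshuffleSign d s •
    X (sᶜ.card + 1) (Fin.cons (X s.card (restr s v)) (restr sᶜ v))

end GradedNotions

section LR

variable {K A L : Type*} [Field K] [Ring A] [Algebra K A]
  [AddCommGroup L] [Module K L] [Module A L]

/-- An `LR_∞[1]` algebra structure on `(A, L)`: a degree `1` multiderivation
`𝕏 = 𝕏_0 + 𝕏_1 + ⋯` of the graded `A`-module `L` with `𝕏_0 = 0` and `(1/2)[𝕏, 𝕏] = 0`.
`bracket k` is the `k`-th bracket `X_k`, and `anchor k` is the anchor with `k` entries from `L`,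
i.e. the symbol of `𝕏_{k+1}`. -/
structure LRInfinity (𝒜 : ℤ → Submodule K A) (ℒ : ℤ → Submodule K L) where
  bracket : ∀ k : ℕ, MultilinearMap K (fun _ : Fin k => L) L
  anchor : ∀ k : ℕ, MultilinearMap K (fun _ : Fin k => L) (A →ₗ[K] A)
  bracket_zero : bracket 0 = 0
  bracket_mem : ∀ (k : ℕ) (d : Fin k → ℤ) (ξ : Fin k → L), (∀ i, ξ i ∈ ℒ (d i)) →
    bracket k ξ ∈ ℒ (1 + ∑ i, d i)
  bracket_symm : ∀ k : ℕ, GradedSymmetric ℒ (bracket k)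
  anchor_mem : ∀ (k : ℕ) (d : Fin k → ℤ) (ξ : Fin k → L), (∀ i, ξ i ∈ ℒ (d i)) →
    ∀ (e : ℤ) (a : A), a ∈ 𝒜 e → anchor k ξ a ∈ 𝒜 (1 + ∑ i, d i + e)
  anchor_symm : ∀ k : ℕ, GradedSymmetric ℒ (anchor k)
  /-- The anchors are (graded) `A`-multilinear. -/
  anchor_smul : ∀ (k : ℕ) (d : Fin k → ℤ) (ξ : Fin k → L), (∀ i, ξ i ∈ ℒ (d i)) →
    ∀ (i : Fin k) (e : ℤ) (a : A), a ∈ 𝒜 e → ∀ b : A,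
      anchor k (Function.update ξ i (a • ξ i)) b =
        sgn ((1 + ∑ j ∈ Finset.Iio i, d j) * e) • (a * anchor k ξ b)
  /-- The anchors take values in derivations of `A`. -/
  anchor_mul : ∀ (k : ℕ) (d : Fin k → ℤ) (ξ : Fin k → L), (∀ i, ξ i ∈ ℒ (d i)) →
    ∀ (e : ℤ) (a : A), a ∈ 𝒜 e → ∀ b : A,
      anchor k ξ (a * b) =
        anchor k ξ a * b + sgn ((1 + ∑ i, d i) * e) • (a * anchor k ξ b)
  bracket_smul : ∀ (k : ℕ) (d : Fin k → ℤ) (ξ : Fin k → L), (∀ i, ξ i ∈ ℒ (d i)) →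
    ∀ (e : ℤ) (a : A), a ∈ 𝒜 e → ∀ η : L,
      bracket (k + 1) (Fin.snoc ξ (a • η)) =
        anchor k ξ a • η + sgn ((1 + ∑ i, d i) * e) • (a • bracket (k + 1) (Fin.snoc ξ η))
  bracket_jacobi : ∀ (n : ℕ) (d : Fin n → ℤ) (ξ : Fin n → L), (∀ i, ξ i ∈ ℒ (d i)) →
    jacobiator bracket d ξ = 0
  /-- The symbol of the higher Jacobiator vanishes. -/
  anchor_jacobi : ∀ (n : ℕ) (d : Fin n → ℤ) (ξ : Fin n → L), (∀ i, ξ i ∈ ℒ (d i)) →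
    ∀ a : A,
      ∑ s : Finset (Fin n), (sgn (∑ i ∈ s, d i) * unshuffleSign d s) •
          anchor s.card (restr s ξ) (anchor sᶜ.card (restr sᶜ ξ) a) +
        ∑ s : Finset (Fin n), unshuffleSign d s •
          anchor (sᶜ.card + 1) (Fin.cons (bracket s.card (restr s ξ)) (restr sᶜ ξ)) a = 0

/-- A right `(A, L)`-connection in the graded `A`-module `Q`: a degree `1` form `Δ` on `L` with
values in `Der^R Q` whose symbol is minus the symbol of `𝕏`. `form k` is the component with `k`
entries from `L`, i.e. `Δ_{k+1}`. -/
structure RightConnection {𝒜 : ℤ → Submodule K A} {ℒ : ℤ → Submodule K L}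
    (X : LRInfinity 𝒜 ℒ) {Q : Type*} [AddCommGroup Q] [Module K Q] [Module A Q]
    (𝒬 : ℤ → Submodule K Q) where
  form : ∀ k : ℕ, MultilinearMap K (fun _ : Fin k => L) (Q →ₗ[K] Q)
  form_mem : ∀ (k : ℕ) (d : Fin k → ℤ) (ξ : Fin k → L), (∀ i, ξ i ∈ ℒ (d i)) →
    ∀ (e : ℤ) (q : Q), q ∈ 𝒬 e → form k ξ q ∈ 𝒬 (1 + ∑ i, d i + e)
  form_symm : ∀ k : ℕ, GradedSymmetric ℒ (form k)
  /-- `A`-multilinearity with respect to the `A`-module structure `a · Y = (-1)^{aY} Y ∘ a` of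
  `Der^R Q`; the two Koszul signs, of exponents `a (1 + ξ_1 + ⋯ + ξ_{i-1})` and
  `a (1 + ξ_1 + ⋯ + ξ_k)`, combine to the exponent `a (ξ_i + ⋯ + ξ_k)`. -/
  form_smul : ∀ (k : ℕ) (d : Fin k → ℤ) (ξ : Fin k → L), (∀ i, ξ i ∈ ℒ (d i)) →
    ∀ (i : Fin k) (e : ℤ) (a : A), a ∈ 𝒜 e → ∀ q : Q,
      form k (Function.update ξ i (a • ξ i)) q =
        sgn (e * ∑ j ∈ Finset.Ici i, d j) • form k ξ (a • q)
  form_leibniz : ∀ (k : ℕ) (d : Fin k → ℤ) (ξ : Fin k → L), (∀ i, ξ i ∈ ℒ (d i)) →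
    ∀ (e : ℤ) (a : A), a ∈ 𝒜 e → ∀ q : Q,
      form k ξ (a • q) =
        sgn ((1 + ∑ i, d i) * e) • (a • form k ξ q) - X.anchor k ξ a • q

/-- Flatness of a right connection: the curvature `J(Δ) = Δ ∘ X - (1/2)[Δ, Δ]` vanishes. -/
def RightConnection.IsFlat {𝒜 : ℤ → Submodule K A} {ℒ : ℤ → Submodule K L}
    {X : LRInfinity 𝒜 ℒ} {Q : Type*} [AddCommGroup Q] [Module K Q] [Module A Q]
    {𝒬 : ℤ → Submodule K Q} (Δ : RightConnection X 𝒬) : Prop :=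
  ∀ (n : ℕ) (d : Fin n → ℤ) (ξ : Fin n → L), (∀ i, ξ i ∈ ℒ (d i)) → ∀ q : Q,
    ∑ s : Finset (Fin n), unshuffleSign d s •
        Δ.form (sᶜ.card + 1) (Fin.cons (X.bracket s.card (restr s ξ)) (restr sᶜ ξ)) q -
      ∑ s : Finset (Fin n), (sgn (∑ i ∈ s, d i) * unshuffleSign d s) •
        Δ.form s.card (restr s ξ) (Δ.form sᶜ.card (restr sᶜ ξ) q) = 0

end LR

section SymmetricAlgebra

variable {K A L : Type*} [Field K] [Ring A] [Algebra K A]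
  [AddCommGroup L] [Module K L] [Module A L]

/-- The relations that present the graded symmetric algebra of `L` over `A` as a quotient of the
tensor algebra of `A × L` over `K`. -/
inductive GSymRel (𝒜 : ℤ → Submodule K A) (ℒ : ℤ → Submodule K L) :
    TensorAlgebra K (A × L) → TensorAlgebra K (A × L) → Prop
  | one : GSymRel 𝒜 ℒ (TensorAlgebra.ι K (1, 0)) 1
  | mul (a b : A) : GSymRel 𝒜 ℒ (TensorAlgebra.ι K (a * b, 0))
      (TensorAlgebra.ι K (a, 0) * TensorAlgebra.ι K (b, 0))
  | smul (a : A) (ξ : L) : GSymRel 𝒜 ℒ (TensorAlgebra.ι K (0, a • ξ))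
      (TensorAlgebra.ι K (a, 0) * TensorAlgebra.ι K (0, ξ))
  | comm_left (i j : ℤ) (a : A) (ξ : L) (ha : a ∈ 𝒜 i) (hξ : ξ ∈ ℒ j) :
      GSymRel 𝒜 ℒ (TensorAlgebra.ι K (a, 0) * TensorAlgebra.ι K (0, ξ))
        ((sgn (i * j) : K) • (TensorAlgebra.ι K (0, ξ) * TensorAlgebra.ι K (a, 0)))
  | comm (i j : ℤ) (ξ η : L) (hξ : ξ ∈ ℒ i) (hη : η ∈ ℒ j) :
      GSymRel 𝒜 ℒ (TensorAlgebra.ι K (0, ξ) * TensorAlgebra.ι K (0, η))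
        ((sgn (i * j) : K) • (TensorAlgebra.ι K (0, η) * TensorAlgebra.ι K (0, ξ)))

/-- The graded symmetric algebra `S_A^• L` of the graded module `L` over the graded commutative
algebra `A`. -/
def GSym (𝒜 : ℤ → Submodule K A) (ℒ : ℤ → Submodule K L) : Type _ :=
  RingQuot (GSymRel 𝒜 ℒ)

namespace GSym

instance (𝒜 : ℤ → Submodule K A) (ℒ : ℤ → Submodule K L) : Ring (GSym 𝒜 ℒ) :=
  inferInstanceAs (Ring (RingQuot (GSymRel 𝒜 ℒ)))

instance (𝒜 : ℤ → Submodule K A) (ℒ : ℤ → Submodule K L) : Algebra K (GSym 𝒜 ℒ) :=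
  inferInstanceAs (Algebra K (RingQuot (GSymRel 𝒜 ℒ)))

variable (𝒜 : ℤ → Submodule K A) (ℒ : ℤ → Submodule K L)

/-- The quotient map. -/
def mk : TensorAlgebra K (A × L) →ₐ[K] GSym 𝒜 ℒ :=
  RingQuot.mkAlgHom K (GSymRel 𝒜 ℒ)

theorem mk_rel {x y : TensorAlgebra K (A × L)} (h : GSymRel 𝒜 ℒ x y) : mk 𝒜 ℒ x = mk 𝒜 ℒ y :=
  RingQuot.mkAlgHom_rel K h

/-- The canonical linear map `L → S_A^• L`. -/
def ofL : L →ₗ[K] GSym 𝒜 ℒ :=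
  (mk 𝒜 ℒ).toLinearMap ∘ₗ TensorAlgebra.ι K ∘ₗ LinearMap.inr K A L

/-- The canonical algebra map `A → S_A^• L`. -/
def ofA : A →ₐ[K] GSym 𝒜 ℒ :=
  AlgHom.ofLinearMap
    ((mk 𝒜 ℒ).toLinearMap ∘ₗ TensorAlgebra.ι K ∘ₗ
      LinearMap.inl K A L)
    (by simpa using mk_rel 𝒜 ℒ GSymRel.one)
    (fun a b => by
      simpa using mk_rel 𝒜 ℒ (GSymRel.mul a b))

/-- `x` is a product of homogeneous elements of `A` and `L` whose degrees add up to `d`. -/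
inductive IsWord : ℤ → GSym 𝒜 ℒ → Prop
  | one : IsWord 0 1
  | mulA {i d : ℤ} {a : A} {x : GSym 𝒜 ℒ} (ha : a ∈ 𝒜 i) (hx : IsWord d x) :
      IsWord (i + d) (ofA 𝒜 ℒ a * x)
  | mulL {i d : ℤ} {ξ : L} {x : GSym 𝒜 ℒ} (hξ : ξ ∈ ℒ i) (hx : IsWord d x) :
      IsWord (i + d) (ofL 𝒜 ℒ ξ * x)

/-- The (total) grading of `S_A^• L`. -/
def grading (d : ℤ) : Submodule K (GSym 𝒜 ℒ) :=
  Submodule.span K {x | IsWord 𝒜 ℒ d x}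

variable {𝒜 ℒ}

theorem ofA_mem {i : ℤ} {a : A} (ha : a ∈ 𝒜 i) : ofA 𝒜 ℒ a ∈ grading 𝒜 ℒ i := by
  have h := IsWord.mulA (ℒ := ℒ) ha IsWord.one
  rw [add_zero, mul_one] at h
  exact Submodule.subset_span h

theorem ofL_mem {i : ℤ} {ξ : L} (hξ : ξ ∈ ℒ i) : ofL 𝒜 ℒ ξ ∈ grading 𝒜 ℒ i := by
  have h := IsWord.mulL (𝒜 := 𝒜) hξ IsWord.one
  rw [add_zero, mul_one] at h
  exact Submodule.subset_span h

theorem IsWord.mul {d e : ℤ} {x y : GSym 𝒜 ℒ} (hx : IsWord 𝒜 ℒ d x) (hy : IsWord 𝒜 ℒ e y) :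
    IsWord 𝒜 ℒ (d + e) (x * y) := by
  induction hx with
  | one => simpa using hy
  | mulA ha _ ih => rw [add_assoc, mul_assoc]; exact IsWord.mulA ha ih
  | mulL hξ _ ih => rw [add_assoc, mul_assoc]; exact IsWord.mulL hξ ih

instance gradedMonoid : SetLike.GradedMonoid (grading 𝒜 ℒ) where
  one_mem := Submodule.subset_span IsWord.one
  mul_mem := by
    intro d e x y hx hy
    induction hx using Submodule.span_induction with
    | zero => simp
    | add u v _ _ hu hv => rw [add_mul]; exact Submodule.add_mem _ hu hv
    | smul c u _ hu => rw [smul_mul_assoc]; exact Submodule.smul_mem _ c hu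
    | mem u hu =>
      induction hy using Submodule.span_induction with
      | zero => simp
      | add v w _ _ hv hw => rw [mul_add]; exact Submodule.add_mem _ hv hw
      | smul c v _ hv => rw [mul_smul_comm]; exact Submodule.smul_mem _ c hv
      | mem v hv => exact Submodule.subset_span (IsWord.mul hu hv)

section Relations

variable (𝒜 ℒ)

theorem of_eq_of {i j : ℤ} (h : i = j) {x y : GSym 𝒜 ℒ} (hx : x ∈ grading 𝒜 ℒ i)
    (hy : y ∈ grading 𝒜 ℒ j) (hxy : x = y) :
    DirectSum.of (fun i => grading 𝒜 ℒ i) i ⟨x, hx⟩ =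
      DirectSum.of (fun i => grading 𝒜 ℒ i) j ⟨y, hy⟩ := by
  subst h; subst hxy; rfl

theorem ofL_smul (a : A) (ξ : L) : ofL 𝒜 ℒ (a • ξ) = ofA 𝒜 ℒ a * ofL 𝒜 ℒ ξ := by
  simpa [ofL, ofA] using mk_rel 𝒜 ℒ (GSymRel.smul a ξ)

theorem ofA_mul_ofL {i j : ℤ} {a : A} {ξ : L} (ha : a ∈ 𝒜 i) (hξ : ξ ∈ ℒ j) :
    ofA 𝒜 ℒ a * ofL 𝒜 ℒ ξ = sgn (i * j) • (ofL 𝒜 ℒ ξ * ofA 𝒜 ℒ a) := by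
  simpa [ofL, ofA, Int.cast_smul_eq_zsmul] using mk_rel 𝒜 ℒ (GSymRel.comm_left i j a ξ ha hξ)

theorem ofL_mul_ofL {i j : ℤ} {ξ η : L} (hξ : ξ ∈ ℒ i) (hη : η ∈ ℒ j) :
    ofL 𝒜 ℒ ξ * ofL 𝒜 ℒ η = sgn (i * j) • (ofL 𝒜 ℒ η * ofL 𝒜 ℒ ξ) := by
  simpa [ofL, ofA, Int.cast_smul_eq_zsmul] using mk_rel 𝒜 ℒ (GSymRel.comm i j ξ η hξ hη)

theorem intCast_smul (n : ℤ) (x : DirectSum ℤ fun i => grading 𝒜 ℒ i) :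
    n • x = (n : K) • x := by
  let f : K →+ DirectSum ℤ fun i => grading 𝒜 ℒ i :=
    { toFun := fun c => c • x, map_zero' := zero_smul K x, map_add' := fun a b => add_smul a b x }
  have h : f (n • (1 : K)) = n • f 1 := map_zsmul f n 1
  have h1 : f 1 = x := one_smul K x
  rw [h1, zsmul_one] at h
  exact h.symm

theorem of_comm {i j : ℤ} {x y : GSym 𝒜 ℒ} (hx : x ∈ grading 𝒜 ℒ i) (hy : y ∈ grading 𝒜 ℒ j)
    (h : x * y = sgn (i * j) • (y * x)) :
    DirectSum.of (fun i => grading 𝒜 ℒ i) i ⟨x, hx⟩ *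
        DirectSum.of (fun i => grading 𝒜 ℒ i) j ⟨y, hy⟩ =
      sgn (i * j) • (DirectSum.of (fun i => grading 𝒜 ℒ i) j ⟨y, hy⟩ *
        DirectSum.of (fun i => grading 𝒜 ℒ i) i ⟨x, hx⟩) := by
  rw [DirectSum.of_mul_of, DirectSum.of_mul_of]
  refine Eq.trans ?_ (map_zsmul (DirectSum.of (fun i => grading 𝒜 ℒ i) (j + i)) (sgn (i * j)) _)
  exact of_eq_of 𝒜 ℒ (add_comm i j) _
    (zsmul_mem (SetLike.mul_mem_graded hy hx) (sgn (i * j))) h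

end Relations

section Decomposition

set_option linter.unusedSectionVars false

variable (𝒜 ℒ) [GradedAlgebra 𝒜] [DirectSum.Decomposition ℒ]

/-- `a ↦ ∑_i a_i`, with `a_i` in degree `i`. -/
def splitA : A →ₗ[K] DirectSum ℤ fun i => grading 𝒜 ℒ i :=
  (DirectSum.toModule K ℤ _ fun i =>
    (DirectSum.lof K ℤ (fun i => grading 𝒜 ℒ i) i) ∘ₗ
      ((ofA 𝒜 ℒ).toLinearMap.restrict (p := 𝒜 i) (q := grading 𝒜 ℒ i) fun _ h => ofA_mem h)) ∘ₗ
    (DirectSum.decomposeLinearEquiv 𝒜).toLinearMap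

/-- `ξ ↦ ∑_i ξ_i`, with `ξ_i` in degree `i`. -/
def splitL : L →ₗ[K] DirectSum ℤ fun i => grading 𝒜 ℒ i :=
  (DirectSum.toModule K ℤ _ fun i =>
    (DirectSum.lof K ℤ (fun i => grading 𝒜 ℒ i) i) ∘ₗ
      ((ofL 𝒜 ℒ).restrict (p := ℒ i) (q := grading 𝒜 ℒ i) fun _ h => ofL_mem h)) ∘ₗ
    (DirectSum.decomposeLinearEquiv ℒ).toLinearMap

theorem splitA_of_mem {i : ℤ} {a : A} (ha : a ∈ 𝒜 i) :
    splitA 𝒜 ℒ a = DirectSum.of (fun i => grading 𝒜 ℒ i) i ⟨ofA 𝒜 ℒ a, ofA_mem ha⟩ := by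
  simp only [splitA, LinearMap.comp_apply, LinearEquiv.coe_coe,
    DirectSum.decomposeLinearEquiv_apply, DirectSum.decompose_of_mem 𝒜 ha]
  erw [DirectSum.toModule_lof]
  rfl

theorem splitL_of_mem {i : ℤ} {ξ : L} (hξ : ξ ∈ ℒ i) :
    splitL 𝒜 ℒ ξ = DirectSum.of (fun i => grading 𝒜 ℒ i) i ⟨ofL 𝒜 ℒ ξ, ofL_mem hξ⟩ := by
  simp only [splitL, LinearMap.comp_apply, LinearEquiv.coe_coe,
    DirectSum.decomposeLinearEquiv_apply, DirectSum.decompose_of_mem ℒ hξ]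
  erw [DirectSum.toModule_lof]
  rfl

variable [SetLike.GradedSMul 𝒜 ℒ]

theorem splitA_mul (a b : A) : splitA 𝒜 ℒ (a * b) = splitA 𝒜 ℒ a * splitA 𝒜 ℒ b := by
  induction a using DirectSum.Decomposition.inductionOn 𝒜 with
  | zero => simp
  | add a a' ha ha' => rw [add_mul, map_add, map_add, ha, ha', add_mul]
  | homogeneous a =>
    induction b using DirectSum.Decomposition.inductionOn 𝒜 with
    | zero => simp
    | add b b' hb hb' => rw [mul_add, map_add, map_add, hb, hb', mul_add]
    | homogeneous b =>
      rw [splitA_of_mem 𝒜 ℒ a.2, splitA_of_mem 𝒜 ℒ b.2,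
        splitA_of_mem 𝒜 ℒ (SetLike.mul_mem_graded a.2 b.2), DirectSum.of_mul_of]
      exact of_eq_of 𝒜 ℒ rfl _ _ (map_mul _ _ _)

theorem splitL_smul (a : A) (ξ : L) : splitL 𝒜 ℒ (a • ξ) = splitA 𝒜 ℒ a * splitL 𝒜 ℒ ξ := by
  induction a using DirectSum.Decomposition.inductionOn 𝒜 with
  | zero => simp
  | add a a' ha ha' => rw [add_smul, map_add, map_add, ha, ha', add_mul]
  | homogeneous a =>
    induction ξ using DirectSum.Decomposition.inductionOn ℒ with
    | zero => simp
    | add b b' hb hb' => rw [smul_add, map_add, map_add, hb, hb', mul_add]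
    | homogeneous ξ =>
      rw [splitA_of_mem 𝒜 ℒ a.2, splitL_of_mem 𝒜 ℒ ξ.2,
        splitL_of_mem 𝒜 ℒ (SetLike.GradedSMul.smul_mem a.2 ξ.2), DirectSum.of_mul_of]
      exact of_eq_of 𝒜 ℒ rfl _ _ (ofL_smul 𝒜 ℒ _ _)

/-- The algebra map that splits an element of `S_A^• L` into homogeneous components. -/
def split : GSym 𝒜 ℒ →ₐ[K] DirectSum ℤ fun i => grading 𝒜 ℒ i :=
  RingQuot.liftAlgHom K ⟨TensorAlgebra.lift K ((splitA 𝒜 ℒ).coprod (splitL 𝒜 ℒ)), by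
    intro x y h
    induction h with
    | one =>
      simp only [TensorAlgebra.lift_ι_apply, LinearMap.coprod_apply, map_zero, add_zero, map_one]
      rw [splitA_of_mem 𝒜 ℒ SetLike.GradedOne.one_mem, DirectSum.one_def]
      exact of_eq_of 𝒜 ℒ rfl _ _ (map_one _)
    | mul a b => simpa using splitA_mul 𝒜 ℒ a b
    | smul a ξ => simpa using splitL_smul 𝒜 ℒ a ξ
    | comm_left i j a ξ ha hξ =>
      simp only [TensorAlgebra.lift_ι_apply, LinearMap.coprod_apply, map_zero, add_zero,
        zero_add, map_mul, map_smul]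
      rw [← intCast_smul]
      rw [splitA_of_mem 𝒜 ℒ ha, splitL_of_mem 𝒜 ℒ hξ]
      exact of_comm 𝒜 ℒ _ _ (ofA_mul_ofL 𝒜 ℒ ha hξ)
    | comm i j ξ η hξ hη =>
      simp only [TensorAlgebra.lift_ι_apply, LinearMap.coprod_apply, map_zero,
        zero_add, map_mul, map_smul]
      rw [← intCast_smul]
      rw [splitL_of_mem 𝒜 ℒ hη, splitL_of_mem 𝒜 ℒ hξ]
      exact of_comm 𝒜 ℒ _ _ (ofL_mul_ofL 𝒜 ℒ hξ hη)⟩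

theorem split_ofA (a : A) : split 𝒜 ℒ (ofA 𝒜 ℒ a) = splitA 𝒜 ℒ a := by
  exact (RingQuot.liftAlgHom_mkAlgHom_apply K _ _ _).trans (by simp)

theorem split_ofL (ξ : L) : split 𝒜 ℒ (ofL 𝒜 ℒ ξ) = splitL 𝒜 ℒ ξ := by
  exact (RingQuot.liftAlgHom_mkAlgHom_apply K _ _ _).trans (by simp)

theorem split_isWord {d : ℤ} {x : GSym 𝒜 ℒ} (h : IsWord 𝒜 ℒ d x) :
    split 𝒜 ℒ x = DirectSum.of (fun i => grading 𝒜 ℒ i) d ⟨x, Submodule.subset_span h⟩ := by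
  induction h with
  | one => rw [map_one]; rfl
  | mulA ha hx ih =>
    rw [map_mul, ih, split_ofA, splitA_of_mem 𝒜 ℒ ha, DirectSum.of_mul_of]; rfl
  | mulL hξ hx ih =>
    rw [map_mul, ih, split_ofL, splitL_of_mem 𝒜 ℒ hξ, DirectSum.of_mul_of]; rfl

theorem split_of_mem {d : ℤ} (x : grading 𝒜 ℒ d) :
    split 𝒜 ℒ x = DirectSum.of (fun i => grading 𝒜 ℒ i) d x := by
  obtain ⟨x, hx⟩ := x
  induction hx using Submodule.span_induction with
  | mem x hx => exact split_isWord 𝒜 ℒ hx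
  | zero => exact (map_zero _).trans (map_zero (DirectSum.of (fun i => grading 𝒜 ℒ i) d)).symm
  | add x y hx hy ihx ihy =>
    have h : split 𝒜 ℒ (x + y) = split 𝒜 ℒ x + split 𝒜 ℒ y := map_add _ _ _
    exact h.trans ((congrArg₂ (· + ·) ihx ihy).trans
      (map_add (DirectSum.of (fun i => grading 𝒜 ℒ i) d) ⟨x, hx⟩ ⟨y, hy⟩).symm)
  | smul c x hx ih =>
    have h : split 𝒜 ℒ (c • x) = c • split 𝒜 ℒ x := map_smul _ _ _
    exact h.trans ((congrArg (c • ·) ih).trans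
      (map_smul (DirectSum.lof K ℤ (fun i => grading 𝒜 ℒ i) d) c ⟨x, hx⟩).symm)

theorem coe_splitA (a : A) :
    DirectSum.coeAlgHom (grading 𝒜 ℒ) (splitA 𝒜 ℒ a) = ofA 𝒜 ℒ a := by
  induction a using DirectSum.Decomposition.inductionOn 𝒜 with
  | zero => simp
  | add a a' ha ha' => rw [map_add, map_add, ha, ha', map_add]
  | homogeneous a => rw [splitA_of_mem 𝒜 ℒ a.2, DirectSum.coeAlgHom_of]

theorem coe_splitL (ξ : L) :
    DirectSum.coeAlgHom (grading 𝒜 ℒ) (splitL 𝒜 ℒ ξ) = ofL 𝒜 ℒ ξ := by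
  induction ξ using DirectSum.Decomposition.inductionOn ℒ with
  | zero => simp
  | add a a' ha ha' => rw [map_add, map_add, ha, ha', map_add]
  | homogeneous a => rw [splitL_of_mem 𝒜 ℒ a.2, DirectSum.coeAlgHom_of]

/-- `S_A^• L` is a graded algebra. -/
instance gradedAlgebra : GradedAlgebra (grading 𝒜 ℒ) :=
  GradedAlgebra.ofAlgHom _ (split 𝒜 ℒ)
    (by
      apply RingQuot.ringQuot_ext'
      apply TensorAlgebra.hom_ext
      apply LinearMap.prod_ext
      · ext a
        exact (congrArg _ (split_ofA 𝒜 ℒ a)).trans (coe_splitA 𝒜 ℒ a)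
      · ext ξ
        exact (congrArg _ (split_ofL 𝒜 ℒ ξ)).trans (coe_splitL 𝒜 ℒ ξ))
    (fun _ x => split_of_mem 𝒜 ℒ x)

end Decomposition

end GSym

end SymmetricAlgebra

section HomotopyAlgebras

variable {K B : Type*} [Field K] [Ring B] [Algebra K B]

/-- The graded commutator `[f, g] = f ∘ g - (-1)^{pq} g ∘ f` of operators of degrees `p`, `q`. -/
def gradedComm (p q : ℤ) (f g : B →ₗ[K] B) : B →ₗ[K] B :=
  f ∘ₗ g - sgn (p * q) • (g ∘ₗ f)

/-- The iterated commutator `[⋯[[f, μ_{u_1}], μ_{u_2}]⋯, μ_{u_k}]`, for an operator `f` of degree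
`p` and multiplication operators `μ_{u_i}` by elements `u_i` of degrees `d_i`. -/
def iterComm (p : ℤ) (f : B →ₗ[K] B) : ∀ k : ℕ, (Fin k → ℤ) → (Fin k → B) → (B →ₗ[K] B)
  | 0, _, _ => f
  | k + 1, d, u =>
      gradedComm (p + ∑ i : Fin k, d i.castSucc) (d (Fin.last k))
        (iterComm p f k (fun i => d i.castSucc) (fun i => u i.castSucc))
        (LinearMap.mulLeft K (u (Fin.last k)))

/-- `f`, of degree `p`, is a differential operator of order `k` in the graded algebra `B`. -/
def IsDiffOp (ℬ : ℤ → Submodule K B) (p : ℤ) (k : ℕ) (f : B →ₗ[K] B) : Prop :=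
  ∀ (d : Fin (k + 1) → ℤ) (u : Fin (k + 1) → B), (∀ i, u i ∈ ℬ (d i)) →
    iterComm p f (k + 1) d u = 0

/-- `Λ = Λ_1 + Λ_2 + ⋯` is a degree `1` multiderivation of the graded algebra `B`; `Λ_0 = 0`. -/
structure IsMultiderivation (ℬ : ℤ → Submodule K B)
    (Λ : ∀ k : ℕ, MultilinearMap K (fun _ : Fin k => B) B) : Prop where
  zero : Λ 0 = 0
  mem : ∀ (k : ℕ) (d : Fin k → ℤ) (u : Fin k → B), (∀ i, u i ∈ ℬ (d i)) →
    Λ k u ∈ ℬ (1 + ∑ i, d i)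
  symm : ∀ k : ℕ, GradedSymmetric ℬ (Λ k)
  leibniz : ∀ (k : ℕ) (d : Fin k → ℤ) (u : Fin k → B), (∀ i, u i ∈ ℬ (d i)) →
    ∀ (e : ℤ) (a : B), a ∈ ℬ e → ∀ b : B,
      Λ (k + 1) (Fin.snoc u (a * b)) =
        sgn ((1 + ∑ i, d i) * e) • (a * Λ (k + 1) (Fin.snoc u b)) + Λ (k + 1) (Fin.snoc u a) * b

/-- `Λ` is a `P_∞[1]` algebra structure on `B`. -/
structure IsPInfinity (ℬ : ℤ → Submodule K B)
    (Λ : ∀ k : ℕ, MultilinearMap K (fun _ : Fin k => B) B) : Prop where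
  comm : GradedCommutative ℬ
  multiderivation : IsMultiderivation ℬ Λ
  jacobi : ∀ (n : ℕ) (d : Fin n → ℤ) (u : Fin n → B), (∀ i, u i ∈ ℬ (d i)) →
    jacobiator Λ d u = 0

/-- `D_1, D_2, …` is a `BV_∞` algebra structure on `B` (with the convention `D_0 = 0`). -/
structure IsBVInfinity (ℬ : ℤ → Submodule K B) (D : ℕ → B →ₗ[K] B) : Prop where
  comm : GradedCommutative ℬ
  zero : D 0 = 0
  mem : ∀ (k : ℕ) (d : ℤ) (u : B), u ∈ ℬ d → D k u ∈ ℬ (d + 1)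
  order : ∀ k : ℕ, IsDiffOp ℬ 1 k (D k)
  one : ∀ k : ℕ, D k 1 = 0
  square : ∀ k : ℕ, ∑ p ∈ Finset.HasAntidiagonal.antidiagonal k, gradedComm 1 1 (D p.1) (D p.2) = 0

end HomotopyAlgebras

section LROperators

variable {K A L : Type*} [Field K] [Ring A] [Algebra K A]
  [AddCommGroup L] [Module K L] [Module A L]
  {𝒜 : ℤ → Submodule K A} {ℒ : ℤ → Submodule K L}

/-- `Λ` extends the brackets and anchors of `(A, L)` to a multiderivation of `S_A^• L`. -/
structure IsBracketExtension (X : LRInfinity 𝒜 ℒ)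
    (Λ : ∀ k : ℕ, MultilinearMap K (fun _ : Fin k => GSym 𝒜 ℒ) (GSym 𝒜 ℒ)) : Prop where
  multiderivation : IsMultiderivation (GSym.grading 𝒜 ℒ) Λ
  bracket : ∀ (k : ℕ) (ξ : Fin k → L),
    Λ k (fun i => GSym.ofL 𝒜 ℒ (ξ i)) = GSym.ofL 𝒜 ℒ (X.bracket k ξ)
  anchor : ∀ (k : ℕ) (ξ : Fin k → L) (a : A),
    Λ (k + 1) (Fin.snoc (fun i => GSym.ofL 𝒜 ℒ (ξ i)) (GSym.ofA 𝒜 ℒ a)) =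
      GSym.ofA 𝒜 ℒ (X.anchor k ξ a)
  scalar : ∀ (k : ℕ) (u : Fin k → GSym 𝒜 ℒ) (a b : A),
    Λ (k + 2) (Fin.snoc (Fin.snoc u (GSym.ofA 𝒜 ℒ a) : Fin (k + 1) → GSym 𝒜 ℒ)
      (GSym.ofA 𝒜 ℒ b)) = 0

/-- The product `ξ_1 ⋯ ξ_n` in `S_A^• L`. -/
def GSym.prodL (𝒜 : ℤ → Submodule K A) (ℒ : ℤ → Submodule K L) {n : ℕ} (ξ : Fin n → L) :
    GSym 𝒜 ℒ :=
  (List.ofFn fun i => GSym.ofL 𝒜 ℒ (ξ i)).prod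

/-- The operators `D_k` on `S_A^• L` are the components of the Rinehart operator `D^Δ` of the right
connection `Δ` in `A` (with `D_0 = 0`), under the identification `S_A^• L ⊗_A A = S_A^• L`,
`ξ_1 ⋯ ξ_ℓ ⊗ q = ξ_1 ⋯ ξ_ℓ q`. -/
def IsRinehartOperator {X : LRInfinity 𝒜 ℒ} (Δ : RightConnection X 𝒜)
    (D : ℕ → GSym 𝒜 ℒ →ₗ[K] GSym 𝒜 ℒ) : Prop :=
  ∀ (k n : ℕ) (d : Fin n → ℤ) (ξ : Fin n → L), (∀ i, ξ i ∈ ℒ (d i)) → ∀ q : A,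
    D k (GSym.prodL 𝒜 ℒ ξ * GSym.ofA 𝒜 ℒ q) =
      ∑ s : Finset (Fin n) with s.card = k, unshuffleSign d s •
          (GSym.ofL 𝒜 ℒ (X.bracket s.card (restr s ξ)) * GSym.prodL 𝒜 ℒ (restr sᶜ ξ) *
            GSym.ofA 𝒜 ℒ q) -
        ∑ s : Finset (Fin n) with sᶜ.card + 1 = k,
          (sgn (∑ i ∈ s, d i) * unshuffleSign d s) •
            (GSym.prodL 𝒜 ℒ (restr s ξ) *
              GSym.ofA 𝒜 ℒ (Δ.form sᶜ.card (restr sᶜ ξ) q))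

end LROperators

/-! The difficulty in existence is that `GSym` is a quotient of a tensor algebra, so the formula for
`D_k` would have to be shown independent of how a product is written. It is obtained instead from a
representation. If `F` is an operator of degree `1` whose commutators with two elements of `A`
vanish, attach to `v` in `S_A L` the values `f w = [⋯[F, ξ_1]⋯, ξ_n] v` and `g w a = [[⋯[F, ξ_1]⋯,
ξ_n], a] v`. Since `F (x v) = [F, x] v ± x F v`, the pair at `x v`, for a generator `x`, is an
explicit linear expression in the pair at `v`. These expressions make sense for formal pairs, those
subject to the identities `IsSymbol`. They preserve the identities and satisfy the relations of `S_A
L`, so `S_A L` acts on the space of formal pairs (`symbolTensor_rel`, `symbolAct`). Given a pair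
`S`, taken as the symbol at `1`, the operator `v ↦ (v · S).1 []` has exactly the prescribed
commutators at `1` (`wordComm_symbolOp`, `wordComm_symbolOp_cons`).

For `D_k` the prescribed pair is built from `X_k`, `-Δ_k(⋯|1)` and `σ_k`. The Leibniz and linearity
rules of the brackets, anchors and connection are what `IsSymbol` asks (`rinehart_isSymbol`). An
operator is recovered from its commutators with elements of `L` by `apply_wordProd_mul`, which gives
the formula for `D_k`. Products of elements of `L` with one element of `A` span `S_A L`, whence
uniqueness. The order of an operator may be tested on generators because `[F, xy] = [F, x] y ± x [F,
y]`.

For the square, the iterated commutators of `∑ D_i D_j` at `1` are a signed sum over unshuffles of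
nested commutators. The additional product terms are antisymmetric under exchange of the two halves,
hence vanish in characteristic `0` (`wordComm_square`). On elements of `L`, the part with values in
`L` is the Jacobi identity of the brackets, and the part with values in `A` is the curvature of `Δ`
up to another antisymmetric term. With one more element from `A` the anchor identity appears. All
these vanish, so the square is zero.

The brackets on `S_A L` are constructed as the derived brackets `[⋯[D_k, u_1]⋯, u_k] 1`. Order `k`
makes them derivations, graded commutativity of `S_A L` makes them symmetric, and the vanishing
square gives the Jacobi identities (`derivedBracket_jacobi`). On generators they are `X_k` and
`σ_k`, and a symmetric multiderivation is determined there (`wordSymmetric_derivation_eq_zero`).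

For the bookkeeping, sums over subsets become the recursive `shuffleSum` over lists. Lists are read
backwards, so that adjoining a head means adjoining a last argument, or an outermost commutator. -/

set_option linter.unusedSectionVars false
set_option linter.unusedSimpArgs false

/-! ### Signs modulo two -/

section Signs

theorem sgn_add (m n : ℤ) : sgn (m + n) = sgn m * sgn n := by
  simp [sgn, Int.negOnePow_add]

theorem sgn_zero : sgn 0 = 1 := by simp [sgn]

theorem sgn_mul_self (n : ℤ) : sgn n * sgn n = 1 := by
  rw [← sgn_add]; simp [sgn, Int.negOnePow_even _ (Even.add_self n)]

theorem sgn_eq_ite (n : ℤ) : sgn n = if Even n then 1 else -1 := by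
  split_ifs with h
  · simp [sgn, Int.negOnePow_even _ h]
  · simp [sgn, Int.negOnePow_odd _ (Int.not_even_iff_odd.1 h)]

/-- Signs depend only on the class modulo `2`. -/
theorem sgn_congr {m n : ℤ} (h : (m : ZMod 2) = n) : sgn m = sgn n := by
  have h' : Even m ↔ Even n := by
    rw [even_iff_two_dvd, even_iff_two_dvd]
    have hm := ZMod.intCast_zmod_eq_zero_iff_dvd m 2
    have hn := ZMod.intCast_zmod_eq_zero_iff_dvd n 2
    norm_cast at hm hn
    rw [← hm, ← hn, h]
  simp only [sgn_eq_ite, h']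

theorem sgn_smul_sgn_smul {N : Type*} [AddCommGroup N] (m n : ℤ) (x : N) :
    sgn m • sgn n • x = sgn (m + n) • x := by
  rw [smul_smul, sgn_add]

theorem sgn_smul_self {N : Type*} [AddCommGroup N] (m : ℤ) (x : N) :
    sgn m • sgn m • x = x := by
  rw [smul_smul, sgn_mul_self, one_smul]

theorem sgn_add_one (n : ℤ) : sgn (n + 1) = -sgn n := by
  rw [sgn_add]; simp [sgn]

end Signs

/-! ### Koszul signs of permutations -/

section Koszul

open Equiv.Perm in
theorem koszulSign_eq_prod {n : ℕ} (d : Fin n → ℤ) (σ : Equiv.Perm (Fin n)) :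
    koszulSign d σ =
      ∏ x ∈ finPairsLT n, if σ x.1 < σ x.2 then sgn (d (σ x.1) * d (σ x.2)) else 1 := by
  rw [koszulSign, Finset.prod_comm, ← Finset.prod_product', ← Finset.prod_filter_mul_prod_filter_not _
    (fun x : Fin n × Fin n => x.2 < x.1)]
  rw [Finset.prod_eq_one (s := Finset.filter (fun x : Fin n × Fin n => ¬ x.2 < x.1) _), mul_one]
  · refine Finset.prod_nbij' (fun x => ⟨x.1, x.2⟩) (fun x => (x.1, x.2)) ?_ ?_ ?_ ?_ ?_
    · simp [mem_finPairsLT]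
    · simp [mem_finPairsLT]
    · simp
    · simp
    · intro x hx
      simp only [Finset.mem_filter] at hx
      simp [hx.2, mul_comm]
  · intro x hx
    simp only [Finset.mem_filter] at hx
    simp [hx.2]

open Equiv.Perm in
/-- The Koszul sign is a cocycle. -/
theorem koszulSign_mul {n : ℕ} (d : Fin n → ℤ) (σ τ : Equiv.Perm (Fin n)) :
    koszulSign d (σ * τ) = koszulSign (fun i => d (σ i)) τ * koszulSign d σ := by
  -- Reindexing by the pairs `{τ a, τ b}`, put in order, makes the identity hold factor by factor. A
  -- pair inverted by both `τ` and `σ` contributes a sign squared.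
  have key : koszulSign d σ = ∏ x ∈ finPairsLT n,
      if σ (signBijAux τ x).1 < σ (signBijAux τ x).2 then
        sgn (d (σ (signBijAux τ x).1) * d (σ (signBijAux τ x).2)) else 1 := by
    rw [koszulSign_eq_prod]
    exact (Finset.prod_nbij (signBijAux τ) signBijAux_mem signBijAux_injOn signBijAux_surj
      (fun _ _ => rfl)).symm
  rw [key, koszulSign_eq_prod, koszulSign_eq_prod, ← Finset.prod_mul_distrib]
  refine Finset.prod_congr rfl ?_
  rintro ⟨a, b⟩ hab
  have hab' : b < a := mem_finPairsLT.1 hab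
  have hne : τ a ≠ τ b := fun h => hab'.ne' (τ.injective h)
  have hne' : σ (τ a) ≠ σ (τ b) := fun h => hne (σ.injective h)
  have hs := sgn_mul_self (d (σ (τ a)) * d (σ (τ b)))
  rcases lt_or_gt_of_ne hne with h | h <;> rcases lt_or_gt_of_ne hne' with h' | h' <;>
    simp [signBijAux, h, h', h'.not_gt, h.not_gt, hs, mul_comm (d (σ (τ b)))]

theorem koszulSign_one {n : ℕ} (d : Fin n → ℤ) : koszulSign d 1 = 1 := by
  unfold koszulSign
  refine Finset.prod_eq_one fun i _ => Finset.prod_eq_one fun j _ => ?_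
  rw [if_neg]
  simp only [Equiv.Perm.coe_one, id, not_and, not_lt]
  exact fun h => h.le

/-- Needed to see that the Koszul sign of an adjacent transposition has a single nontrivial factor.
-/
theorem swap_castSucc_succ_lt_iff {n : ℕ} (k : Fin n) {a b : Fin (n + 1)} (hab : b < a) :
    Equiv.swap k.castSucc k.succ a < Equiv.swap k.castSucc k.succ b ↔
      a = k.succ ∧ b = k.castSucc := by
  simp only [Equiv.swap_apply_def]
  simp only [Fin.ext_iff, Fin.lt_def, Fin.val_castSucc, Fin.val_succ] at *
  split_ifs <;> simp <;> omega

open Equiv.Perm in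
theorem koszulSign_swap {n : ℕ} (d : Fin (n + 1) → ℤ) (k : Fin n) :
    koszulSign d (Equiv.swap k.castSucc k.succ) = sgn (d k.castSucc * d k.succ) := by
  rw [koszulSign_eq_prod, Finset.prod_eq_single ⟨k.succ, k.castSucc⟩]
  · simp
  · rintro ⟨a, b⟩ hab hne
    rw [if_neg]
    rw [swap_castSucc_succ_lt_iff k (mem_finPairsLT.1 hab)]
    rintro ⟨rfl, rfl⟩
    exact hne rfl
  · intro h
    exact absurd (mem_finPairsLT.2 (by simp)) h

/-- Symmetry under adjacent transpositions implies graded symmetry. -/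
theorem koszul_of_adjacent {α N : Type*} [AddCommGroup N] (deg : α → ℤ) {n : ℕ}
    (f : (Fin n → α) → N)
    (h : ∀ (v : Fin n → α) (i : ℕ) (hi : i + 1 < n),
      f (fun j => v (Equiv.swap ⟨i, by omega⟩ ⟨i + 1, hi⟩ j)) =
        sgn (deg (v ⟨i, by omega⟩) * deg (v ⟨i + 1, hi⟩)) • f v)
    (v : Fin n → α) (σ : Equiv.Perm (Fin n)) :
    f (fun i => v (σ i)) = koszulSign (fun i => deg (v i)) σ • f v := by
  cases n with
  | zero => rw [Subsingleton.elim σ 1, koszulSign_one, one_smul]; rfl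
  | succ n =>
    have hσ : σ ∈ Submonoid.closure
        (Set.range fun i : Fin n => Equiv.swap i.castSucc i.succ) := by
      rw [Equiv.Perm.mclosure_swap_castSucc_succ]; trivial
    induction hσ using Submonoid.closure_induction generalizing v with
    | mem σ hσ =>
      obtain ⟨k, rfl⟩ := hσ
      rw [koszulSign_swap]
      exact h v k (by omega)
    | one => rw [koszulSign_one, one_smul]; rfl
    | mul σ τ _ _ ihσ ihτ =>
      have := ihτ (fun i => v (σ i))
      rw [koszulSign_mul, mul_smul, ← ihσ v, ← this]
      rfl

end Koszul

/-! ### Signed sums over unshuffles, by recursion on words -/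

section Shuffles

variable {α N : Type*} [AddCommGroup N]

/-- The degree of a word. -/
def wordDeg (deg : α → ℤ) (w : List α) : ℤ := (w.map deg).sum

theorem wordDeg_nil (deg : α → ℤ) : wordDeg deg [] = 0 := rfl

theorem wordDeg_cons (deg : α → ℤ) (x : α) (w : List α) :
    wordDeg deg (x :: w) = deg x + wordDeg deg w := by simp [wordDeg]

theorem wordDeg_append (deg : α → ℤ) (v w : List α) :
    wordDeg deg (v ++ w) = wordDeg deg v + wordDeg deg w := by simp [wordDeg]

/-- One step of the signed sum over all unshuffles: the new letter goes to the left or to the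
right word. -/
def shuffleStep (deg : α → ℤ) (x : α) :
    (List α → List α → N) →+ (List α → List α → N) where
  toFun F p q := sgn (deg x * wordDeg deg q) • F (x :: p) q + F p (x :: q)
  map_zero' := by ext; simp
  map_add' F G := by ext p q; simp only [Pi.add_apply, smul_add]; abel

/-- The signed sum of `F p q` over all unshuffles `(p, q)` of a word, where words are written
backwards: the head of the list is the last letter. -/
def shuffleSum (deg : α → ℤ) : List α → (List α → List α → N) →+ N
  | [] => { toFun := fun F => F [] [], map_zero' := rfl, map_add' := fun _ _ => rfl }
  | x :: w => (shuffleSum deg w).comp (shuffleStep deg x)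

variable (deg : α → ℤ)

theorem shuffleSum_nil (F : List α → List α → N) : shuffleSum deg [] F = F [] [] := rfl

theorem shuffleSum_cons (x : α) (w : List α) (F : List α → List α → N) :
    shuffleSum deg (x :: w) F = shuffleSum deg w (fun p q =>
      sgn (deg x * wordDeg deg q) • F (x :: p) q + F p (x :: q)) := rfl

theorem shuffleSum_congr {w : List α} {F G : List α → List α → N}
    (h : ∀ p q, p.length + q.length = w.length → F p q = G p q) :
    shuffleSum deg w F = shuffleSum deg w G := by
  induction w generalizing F G with
  | nil => exact h [] [] rfl
  | cons x w ih =>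
    rw [shuffleSum_cons, shuffleSum_cons]
    refine ih fun p q hpq => ?_
    rw [h (x :: p) q (by simp only [List.length_cons]; omega),
      h p (x :: q) (by simp only [List.length_cons]; omega)]

theorem shuffleSum_congr_deg {w : List α} {F G : List α → List α → N}
    (h : ∀ p q, wordDeg deg p + wordDeg deg q = wordDeg deg w → F p q = G p q) :
    shuffleSum deg w F = shuffleSum deg w G := by
  induction w generalizing F G with
  | nil => exact h [] [] rfl
  | cons x w ih =>
    rw [shuffleSum_cons, shuffleSum_cons]
    refine ih fun p q hpq => ?_
    rw [h (x :: p) q (by simp only [wordDeg_cons]; omega),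
      h p (x :: q) (by simp only [wordDeg_cons]; omega)]

theorem map_shuffleSum {N' F : Type*} [AddCommGroup N'] [FunLike F N N'] [AddMonoidHomClass F N N']
    (φ : F) (w : List α) (G : List α → List α → N) :
    φ (shuffleSum deg w G) = shuffleSum deg w (fun p q => φ (G p q)) := by
  induction w generalizing G with
  | nil => rfl
  | cons x w ih =>
    rw [shuffleSum_cons, shuffleSum_cons, ih]
    refine shuffleSum_congr deg fun p q _ => ?_
    rw [map_add, map_zsmul]

theorem shuffleSum_add (w : List α) (F G : List α → List α → N) :
    shuffleSum deg w (fun p q => F p q + G p q) = shuffleSum deg w F + shuffleSum deg w G :=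
  map_add (shuffleSum deg w) F G

theorem shuffleSum_sub (w : List α) (F G : List α → List α → N) :
    shuffleSum deg w (fun p q => F p q - G p q) = shuffleSum deg w F - shuffleSum deg w G :=
  map_sub (shuffleSum deg w) F G

theorem shuffleSum_neg (w : List α) (F : List α → List α → N) :
    shuffleSum deg w (fun p q => -F p q) = -shuffleSum deg w F :=
  map_neg (shuffleSum deg w) F

theorem shuffleSum_sum {ι : Type*} (t : Finset ι) (w : List α) (F : ι → List α → List α → N) :
    ∑ i ∈ t, shuffleSum deg w (F i) = shuffleSum deg w (fun p q => ∑ i ∈ t, F i p q) := by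
  rw [← map_sum]
  congr 1
  ext p q
  simp

theorem shuffleSum_zero (w : List α) :
    shuffleSum deg w (fun _ _ => (0 : N)) = 0 := map_zero (shuffleSum deg w)

/-- Exchanging the two words of an unshuffle. -/
theorem shuffleSum_swap (w : List α) (F : List α → List α → N) :
    shuffleSum deg w F =
      shuffleSum deg w (fun p q => sgn (wordDeg deg p * wordDeg deg q) • F q p) := by
  induction w generalizing F with
  | nil => simp [shuffleSum_nil, wordDeg, sgn_zero]
  | cons x w ih =>
    rw [shuffleSum_cons, shuffleSum_cons, ih]
    refine shuffleSum_congr deg fun p q _ => ?_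
    rw [smul_add, add_comm, wordDeg_cons, wordDeg_cons, sgn_smul_sgn_smul, sgn_smul_sgn_smul]
    congr 2
    · apply sgn_congr
      push_cast
      -- Exponents of signs matter only modulo two, so the identity is decided over all residues.
      -- The same device settles the later comparisons of signs.
      generalize (deg x : ZMod 2) = a
      generalize (wordDeg deg p : ZMod 2) = b
      generalize (wordDeg deg q : ZMod 2) = c
      decide +revert
    · apply sgn_congr
      push_cast
      ring

/-- An antisymmetric signed sum over unshuffles vanishes. -/
theorem shuffleSum_eq_zero_of_antisymm [IsAddTorsionFree N] {w : List α}
    {F : List α → List α → N}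
    (h : ∀ p q, sgn (wordDeg deg p * wordDeg deg q) • F q p = - F p q) :
    shuffleSum deg w F = 0 := by
  have h1 := shuffleSum_swap deg w F
  simp only [h, shuffleSum_neg] at h1
  -- The sum equals its own negative, and there is no torsion.
  exact self_eq_neg.1 h1

end Shuffles

/-! ### Finite families as words -/

section Words

variable {α N : Type*}

/-- The word of a family, written backwards. -/
def word {n : ℕ} (v : Fin n → α) : List α := (List.ofFn v).reverse

theorem word_zero (v : Fin 0 → α) : word v = [] := by simp [word]

theorem word_snoc {n : ℕ} (v : Fin n → α) (x : α) :
    word (Fin.snoc v x : Fin (n + 1) → α) = x :: word v := by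
  rw [word, List.ofFn_succ']
  simp [word]

theorem word_succ {n : ℕ} (v : Fin (n + 1) → α) :
    word v = v (Fin.last n) :: word (fun i => v i.castSucc) := by
  rw [word, List.ofFn_succ']
  simp [word]

theorem word_cons {n : ℕ} (v : Fin n → α) (x : α) :
    word (Fin.cons x v : Fin (n + 1) → α) = word v ++ [x] := by
  rw [word, List.ofFn_succ]
  simp [word]

theorem length_word {n : ℕ} (v : Fin n → α) : (word v).length = n := by simp [word]

theorem wordDeg_word (deg : α → ℤ) {n : ℕ} (v : Fin n → α) :
    wordDeg deg (word v) = ∑ i, deg (v i) := by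
  simp [wordDeg, word, List.sum_ofFn, Function.comp_def]

/-- The family of the letters of a word. -/
def letters : ∀ w : List α, Fin w.length → α
  | [] => Fin.elim0
  | x :: w => Fin.snoc (letters w) x

theorem word_letters (w : List α) : word (letters w) = w := by
  induction w with
  | nil => exact word_zero _
  | cons x w ih => exact (word_snoc _ _).trans (by rw [ih])

/-- The value on a word of a family of maps of several variables. -/
def evalWord (Y : ∀ k : ℕ, (Fin k → α) → N) (w : List α) : N := Y w.length (letters w)

theorem evalWord_nil (Y : ∀ k : ℕ, (Fin k → α) → N) : evalWord Y [] = Y 0 Fin.elim0 := rfl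

theorem evalWord_cons (Y : ∀ k : ℕ, (Fin k → α) → N) (x : α) (w : List α) :
    evalWord Y (x :: w) = evalWord (fun k v => Y (k + 1) (Fin.snoc v x)) w := rfl

theorem evalWord_word (Y : ∀ k : ℕ, (Fin k → α) → N) {n : ℕ} (v : Fin n → α) :
    evalWord Y (word v) = Y n v := by
  induction n generalizing Y with
  | zero => rw [word_zero, evalWord_nil, Subsingleton.elim v Fin.elim0]
  | succ n ih =>
    rw [word_succ, evalWord_cons, ih]
    congr 1
    exact Fin.snoc_init_self v

/-- Both enumerations of `s` are strictly increasing with the same members, hence equal. The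
description by filtering is the one compatible with induction on `n`. -/
theorem word_restr {n : ℕ} (s : Finset (Fin n)) (v : Fin n → α) :
    word (restr s v) = (((List.finRange n).filter (· ∈ s)).map v).reverse := by
  have h : List.ofFn (fun m => s.orderEmbOfFin rfl m) = (List.finRange n).filter (· ∈ s) := by
    refine List.Perm.eq_of_pairwise' (r := (· < ·)) ?_ ?_ ?_
    · rw [List.pairwise_ofFn]
      exact fun i j hij => (s.orderEmbOfFin rfl).strictMono hij
    · exact (List.pairwise_lt_finRange n).filter _
    · refine (List.perm_ext_iff_of_nodup ?_ ?_).2 fun a => ?_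
      · exact List.nodup_ofFn.2 (s.orderEmbOfFin rfl).injective
      · exact (List.nodup_finRange n).filter _
      · have hr := Finset.range_orderEmbOfFin s rfl
        rw [List.mem_ofFn, ← Set.mem_range, hr]
        simp
  rw [word, ← h, List.map_ofFn]
  rfl

theorem wordDeg_word_restr (deg : α → ℤ) {n : ℕ} (s : Finset (Fin n)) (v : Fin n → α) :
    wordDeg deg (word (restr s v)) = ∑ i ∈ s, deg (v i) := by
  rw [wordDeg_word, ← Finset.sum_coe_sort s (fun i => deg (v i)),
    ← (s.orderIsoOfFin rfl).toEquiv.sum_comp]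
  rfl

end Words

/-! ### Sums over subsets as shuffle sums -/

section Subsets

variable {α N : Type*}

/-- Subsets are sorted by whether they contain the last index. This is the choice between the left
and the right word in `shuffleStep`. -/
theorem sum_finset_fin_succ [AddCommMonoid N] {n : ℕ} (f : Finset (Fin (n + 1)) → N) :
    ∑ s, f s = ∑ t : Finset (Fin n), f (insert (Fin.last n) (t.map Fin.castSuccEmb)) +
      ∑ t : Finset (Fin n), f (t.map Fin.castSuccEmb) := by
  have key : ∀ g : Finset (Fin (n + 1)) → N,
      ∑ t ∈ ((Finset.univ : Finset (Fin n)).map Fin.castSuccEmb).powerset, g t =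
        ∑ t : Finset (Fin n), g (t.map Fin.castSuccEmb) := by
    intro g
    symm
    refine Finset.sum_bij (fun t _ => t.map Fin.castSuccEmb) ?_ ?_ ?_ ?_
    · intro t _
      rw [Finset.mem_powerset]
      exact Finset.map_subset_map.2 (Finset.subset_univ t)
    · intro a _ b _ hab
      exact Finset.map_injective _ hab
    · intro b hb
      rw [Finset.mem_powerset, Finset.subset_map_iff] at hb
      obtain ⟨t, _, rfl⟩ := hb
      exact ⟨t, Finset.mem_univ _, rfl⟩
    · intro _ _; rfl
  have hu : (Finset.univ : Finset (Finset (Fin (n + 1)))) =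
      (insert (Fin.last n) ((Finset.univ : Finset (Fin n)).map Fin.castSuccEmb)).powerset := by
    rw [← Finset.cons_eq_insert _ _ (by simp), ← Fin.univ_castSuccEmb, Finset.powerset_univ]
  rw [hu, Finset.sum_powerset_insert (by simp), key, key, add_comm]

theorem castSucc_mem_map {n : ℕ} (t : Finset (Fin n)) (j : Fin n) :
    j.castSucc ∈ t.map Fin.castSuccEmb ↔ j ∈ t :=
  Finset.mem_map' Fin.castSuccEmb

theorem last_notMem_map {n : ℕ} (t : Finset (Fin n)) :
    Fin.last n ∉ t.map Fin.castSuccEmb := by simp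

theorem compl_map_castSucc {n : ℕ} (t : Finset (Fin n)) :
    (t.map Fin.castSuccEmb)ᶜ = insert (Fin.last n) (tᶜ.map Fin.castSuccEmb) := by
  ext i
  refine Fin.lastCases ?_ (fun j => ?_) i
  · simp
  · simp only [Finset.mem_compl, Finset.mem_insert, castSucc_mem_map, (Fin.castSucc_lt_last j).ne,
      false_or]

theorem compl_insert_last_map_castSucc {n : ℕ} (t : Finset (Fin n)) :
    (insert (Fin.last n) (t.map Fin.castSuccEmb))ᶜ = tᶜ.map Fin.castSuccEmb := by
  rw [← compl_compl t, ← compl_map_castSucc, compl_compl, compl_compl]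

theorem word_restr_map_castSucc {n : ℕ} (t : Finset (Fin n)) (v : Fin (n + 1) → α) :
    word (restr (t.map Fin.castSuccEmb) v) = word (restr t (fun i => v i.castSucc)) := by
  rw [word_restr, word_restr, List.finRange_succ_last, List.filter_append, List.filter_map,
    List.filter_singleton]
  simp only [last_notMem_map, decide_false, Function.comp_def, castSucc_mem_map,
    cond_false, List.append_nil, List.map_map]

theorem word_restr_insert_last {n : ℕ} (t : Finset (Fin n)) (v : Fin (n + 1) → α) :
    word (restr (insert (Fin.last n) (t.map Fin.castSuccEmb)) v) =
      v (Fin.last n) :: word (restr t (fun i => v i.castSucc)) := by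
  rw [word_restr, word_restr, List.finRange_succ_last, List.filter_append, List.filter_map,
    List.filter_singleton]
  simp [Function.comp_def, (Fin.castSucc_lt_last _).ne]

theorem unshuffleSign_map_castSucc {n : ℕ} (d : Fin (n + 1) → ℤ) (t : Finset (Fin n)) :
    unshuffleSign d (t.map Fin.castSuccEmb) = unshuffleSign (fun i => d i.castSucc) t := by
  rw [unshuffleSign, unshuffleSign, compl_map_castSucc, Finset.prod_map]
  refine Finset.prod_congr rfl fun b _ => ?_
  rw [Finset.prod_insert (by simp), Finset.prod_map, if_neg (by simp [Fin.le_last]), one_mul]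
  rfl

theorem sgn_sum {ι : Type*} (s : Finset ι) (f : ι → ℤ) : sgn (∑ i ∈ s, f i) = ∏ i ∈ s, sgn (f i) := by
  classical
  induction s using Finset.induction_on with
  | empty => simp [sgn_zero]
  | insert i s hi ih => rw [Finset.sum_insert hi, Finset.prod_insert hi, sgn_add, ih]

/-- The last index is larger than every index of the complement, so putting it into the left part
creates one inversion with each of them. The resulting factor is the sign in `shuffleStep`. -/
theorem unshuffleSign_insert_last {n : ℕ} (d : Fin (n + 1) → ℤ) (t : Finset (Fin n)) :
    unshuffleSign d (insert (Fin.last n) (t.map Fin.castSuccEmb)) =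
      sgn (d (Fin.last n) * ∑ i ∈ tᶜ, d i.castSucc) * unshuffleSign (fun i => d i.castSucc) t := by
  rw [unshuffleSign, unshuffleSign, compl_insert_last_map_castSucc,
    Finset.prod_insert (by simp), Finset.prod_map]
  congr 1
  · rw [Finset.mul_sum, sgn_sum]
    refine Finset.prod_congr rfl fun a _ => ?_
    simp [Fin.castSucc_lt_last, mul_comm]
  · rw [Finset.prod_map]
    refine Finset.prod_congr rfl fun b _ => ?_
    rw [Finset.prod_map]
    rfl

variable [AddCommGroup N]

/-- The passage from the sums over subsets, in which the axioms are phrased, to the recursive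
shuffle sums used in all computations. -/
theorem sum_unshuffleSign_smul (deg : α → ℤ) {n : ℕ} (v : Fin n → α)
    (F : List α → List α → N) :
    ∑ s : Finset (Fin n), unshuffleSign (fun i => deg (v i)) s •
      F (word (restr s v)) (word (restr sᶜ v)) = shuffleSum deg (word v) F := by
  induction n generalizing F with
  | zero =>
    rw [word_zero, shuffleSum_nil, Fintype.sum_subsingleton _ ∅]
    have h : ∀ s : Finset (Fin 0), word (restr s v) = [] := fun s => by
      rw [word_restr]; rfl
    rw [h, h]
    simp [unshuffleSign]
  | succ n ih =>
    rw [sum_finset_fin_succ, word_succ, shuffleSum_cons, ← ih, ← Finset.sum_add_distrib]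
    refine Finset.sum_congr rfl fun t _ => ?_
    rw [compl_map_castSucc, compl_insert_last_map_castSucc, word_restr_map_castSucc,
      word_restr_map_castSucc, word_restr_insert_last, word_restr_insert_last,
      unshuffleSign_map_castSucc, unshuffleSign_insert_last, smul_add, wordDeg_word_restr,
      smul_smul, mul_comm (sgn _)]

end Subsets

/-! ### Graded symmetric functions of words -/

section WordSymmetry

variable {α N : Type*} [AddCommGroup N]

/-- A function of words is graded symmetric. -/
def WordSymmetric (deg : α → ℤ) (f : List α → N) : Prop :=
  ∀ (p : List α) (x y : α) (w : List α),
    f (p ++ x :: y :: w) = sgn (deg x * deg y) • f (p ++ y :: x :: w)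

variable {deg : α → ℤ}

theorem WordSymmetric.cons {f : List α → N} (hf : WordSymmetric deg f) (z : α) :
    WordSymmetric deg (fun w => f (z :: w)) :=
  fun p x y w => hf (z :: p) x y w

theorem WordSymmetric.swap {f : List α → N} (hf : WordSymmetric deg f) (x y : α) (w : List α) :
    f (x :: y :: w) = sgn (deg x * deg y) • f (y :: x :: w) := hf [] x y w

/-- A letter may be moved to the head of the word. -/
theorem WordSymmetric.move {f : List α → N} (hf : WordSymmetric deg f) (p : List α) (x : α)
    (w : List α) :
    f (p ++ x :: w) = sgn (deg x * wordDeg deg p) • f (x :: (p ++ w)) := by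
  induction p generalizing f with
  | nil => simp [wordDeg_nil, sgn_zero]
  | cons z p ih =>
    rw [List.cons_append, ih (hf.cons z), hf.swap z x, sgn_smul_sgn_smul, wordDeg_cons]
    congr 2
    ring

theorem wordSymmetric_evalWord (Y : ∀ k : ℕ, (Fin k → α) → N)
    (hY : ∀ (k : ℕ) (v : Fin (k + 1) → α) (i : Fin k),
      Y (k + 1) (fun j => v (Equiv.swap i.castSucc i.succ j)) =
        sgn (deg (v i.castSucc) * deg (v i.succ)) • Y (k + 1) v) :
    WordSymmetric deg (evalWord Y) := by
  intro p
  induction p generalizing Y with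
  | nil =>
    intro x y w
    simp only [List.nil_append, evalWord_cons]
    change Y _ _ = _ • Y _ _
    have h := hY (w.length + 1)
      (Fin.snoc (Fin.snoc (letters w) x : Fin (w.length + 1) → α) y) (Fin.last _)
    rw [Fin.snoc_castSucc, Fin.snoc_last, Fin.succ_last, Fin.snoc_last] at h
    rw [← h]
    congr 1
    ext j
    refine Fin.lastCases ?_ (fun j => Fin.lastCases ?_ (fun j => ?_) j) j
    · rw [Fin.snoc_last, Equiv.swap_apply_right, Fin.snoc_castSucc, Fin.snoc_last]
    · rw [Equiv.swap_apply_left, Fin.snoc_last, Fin.snoc_castSucc, Fin.snoc_last]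
    · rw [Equiv.swap_apply_of_ne_of_ne (by simp [Fin.ext_iff, j.2.ne])
        (by simp [Fin.ext_iff]; omega)]
      simp only [Fin.snoc_castSucc]
  | cons z p ih =>
    -- The head letter is the last argument. Fixing it leaves a family with one argument fewer,
    -- still symmetric under adjacent transpositions.
    refine ih (fun k v => Y (k + 1) (Fin.snoc v z)) fun k v i => ?_
    have h := hY (k + 1) (Fin.snoc v z) i.castSucc
    rw [← Fin.castSucc_succ, Fin.snoc_castSucc, Fin.snoc_castSucc] at h
    rw [← h]
    congr 1
    ext j
    refine Fin.lastCases ?_ (fun j => ?_) j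
    · rw [Equiv.swap_apply_of_ne_of_ne (by simp [Fin.ext_iff]; omega)
        (by simp [Fin.ext_iff]; omega), Fin.snoc_last, Fin.snoc_last]
    · rw [← (Fin.castSucc_injective _).map_swap, Fin.snoc_castSucc, Fin.snoc_castSucc]

theorem exists_word_swap {n : ℕ} (v : Fin n → α) (i : ℕ) (hi : i + 1 < n) :
    ∃ p w, word v = p ++ v ⟨i + 1, hi⟩ :: v ⟨i, by omega⟩ :: w ∧
      word (fun j => v (Equiv.swap ⟨i, by omega⟩ ⟨i + 1, hi⟩ j)) =
        p ++ v ⟨i, by omega⟩ :: v ⟨i + 1, hi⟩ :: w := by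
  induction n with
  | zero => omega
  | succ n ih =>
    by_cases h : i + 1 < n
    · obtain ⟨p, w, h1, h2⟩ := ih (fun j => v j.castSucc) h
      refine ⟨v (Fin.last n) :: p, w, ?_, ?_⟩
      · rw [word_succ, h1]; rfl
      · rw [word_succ, Equiv.swap_apply_of_ne_of_ne (by simp [Fin.ext_iff]; omega)
          (by simp [Fin.ext_iff]; omega)]
        refine congrArg (List.cons _) (Eq.trans (congrArg word ?_) h2)
        ext j
        exact congrArg v ((Fin.castSucc_injective n).map_swap
          ⟨i, by omega⟩ ⟨i + 1, h⟩ j).symm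
    · obtain rfl : n = i + 1 := by omega
      refine ⟨[], word (fun j : Fin i => v j.castSucc.castSucc), ?_, ?_⟩
      · rw [word_succ, word_succ]; rfl
      · rw [word_succ, word_succ]
        have e1 : Equiv.swap (⟨i, by omega⟩ : Fin (i + 1 + 1)) ⟨i + 1, hi⟩ (Fin.last (i + 1)) =
            ⟨i, by omega⟩ := Equiv.swap_apply_right _ _
        have e2 : Equiv.swap (⟨i, by omega⟩ : Fin (i + 1 + 1)) ⟨i + 1, hi⟩ (Fin.last i).castSucc =
            ⟨i + 1, hi⟩ := Equiv.swap_apply_left _ _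
        rw [e1, e2]
        refine congrArg (fun w => v ⟨i, by omega⟩ :: v ⟨i + 1, hi⟩ :: w) (congrArg word ?_)
        ext j
        rw [Equiv.swap_apply_of_ne_of_ne (by simp [Fin.ext_iff, j.2.ne])
          (by simp [Fin.ext_iff]; omega)]

theorem WordSymmetric.perm {f : List α → N} (hf : WordSymmetric deg f) {n : ℕ} (v : Fin n → α)
    (σ : Equiv.Perm (Fin n)) :
    f (word fun i => v (σ i)) = koszulSign (fun i => deg (v i)) σ • f (word v) := by
  refine koszul_of_adjacent deg (fun v => f (word v)) (fun v i hi => ?_) v σ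
  obtain ⟨p, w, h1, h2⟩ := exists_word_swap v i hi
  rw [h1, h2, hf]

end WordSymmetry

/-! ### Brackets evaluated on words of homogeneous elements -/

section Homogeneous

variable {K M N : Type*} [Field K] [AddCommGroup M] [Module K M] [AddCommGroup N] [Module K N]

/-- A homogeneous element of a graded module, with its degree. -/
structure Homog (ℳ : ℤ → Submodule K M) where
  deg : ℤ
  val : M
  mem : val ∈ ℳ deg

variable {ℳ : ℤ → Submodule K M}

/-- The value on a word of homogeneous elements of a family of multilinear maps. -/
def evalMulti (X : ∀ k : ℕ, MultilinearMap K (fun _ : Fin k => M) N) (w : List (Homog ℳ)) : N :=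
  evalWord (fun k (v : Fin k → Homog ℳ) => X k (fun i => (v i).val)) w

theorem evalMulti_word (X : ∀ k : ℕ, MultilinearMap K (fun _ : Fin k => M) N) {n : ℕ}
    (v : Fin n → Homog ℳ) : evalMulti X (word v) = X n (fun i => (v i).val) :=
  evalWord_word _ v

theorem evalMulti_symm {X : ∀ k : ℕ, MultilinearMap K (fun _ : Fin k => M) N}
    (hX : ∀ k, GradedSymmetric ℳ (X k)) : WordSymmetric Homog.deg (evalMulti (ℳ := ℳ) X) := by
  refine wordSymmetric_evalWord _ fun k v i => ?_
  rw [hX (k + 1) (fun i => (v i).deg) (fun i => (v i).val) (fun i => (v i).mem), koszulSign_swap]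

theorem evalMulti_cons (X : ∀ k : ℕ, MultilinearMap K (fun _ : Fin k => M) N) (x : Homog ℳ)
    (w : List (Homog ℳ)) :
    evalMulti X (x :: w) =
      X (w.length + 1) (Fin.snoc (fun i => (letters w i).val) x.val) := by
  change X (w.length + 1) _ = _
  congr 1
  exact Fin.comp_snoc (fun y : Homog ℳ => y.val) (letters w) x

theorem sum_letters (w : List (Homog ℳ)) : ∑ i, (letters w i).deg = wordDeg Homog.deg w := by
  rw [← wordDeg_word Homog.deg (letters w), word_letters]

theorem evalMulti_mem {𝒩 : ℤ → Submodule K N} {c : ℤ}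
    {X : ∀ k : ℕ, MultilinearMap K (fun _ : Fin k => M) N}
    (hX : ∀ (k : ℕ) (d : Fin k → ℤ) (v : Fin k → M), (∀ i, v i ∈ ℳ (d i)) →
      X k v ∈ 𝒩 (c + ∑ i, d i)) (w : List (Homog ℳ)) :
    evalMulti X w ∈ 𝒩 (c + wordDeg Homog.deg w) := by
  have h := hX w.length _ _ (fun i => (letters w i).mem)
  rwa [sum_letters] at h

/-- The value of a bracket on a word, as a homogeneous element. -/
def bracketWord (X : ∀ k : ℕ, MultilinearMap K (fun _ : Fin k => M) M)
    (hX : ∀ (k : ℕ) (d : Fin k → ℤ) (v : Fin k → M), (∀ i, v i ∈ ℳ (d i)) →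
      X k v ∈ ℳ (1 + ∑ i, d i)) (w : List (Homog ℳ)) : Homog ℳ :=
  ⟨1 + wordDeg Homog.deg w, evalMulti X w, evalMulti_mem hX w⟩

/-- The inner bracket is the first argument, hence the end of the backward word. Exchanging the
halves costs `|p||q|` and moving the bracket to the head costs `(1+|q|)|p|`. Together only the sign
`(-1)^|p|` remains, so all three structure equations take the same shape. -/
theorem sum_cons_eq_shuffleSum {X : ∀ k : ℕ, MultilinearMap K (fun _ : Fin k => M) M}
    (hX : ∀ (k : ℕ) (d : Fin k → ℤ) (v : Fin k → M), (∀ i, v i ∈ ℳ (d i)) →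
      X k v ∈ ℳ (1 + ∑ i, d i))
    {Y : ∀ k : ℕ, MultilinearMap K (fun _ : Fin k => M) N} (hY : ∀ k, GradedSymmetric ℳ (Y k))
    {n : ℕ} (v : Fin n → Homog ℳ) :
    ∑ s : Finset (Fin n), unshuffleSign (fun i => (v i).deg) s •
        Y (sᶜ.card + 1) (Fin.cons (X s.card (restr s fun i => (v i).val))
          (restr sᶜ fun i => (v i).val)) =
      shuffleSum Homog.deg (word v) (fun p q =>
        sgn (wordDeg Homog.deg p) • evalMulti Y (bracketWord X hX q :: p)) := by
  have h1 : ∀ s : Finset (Fin n),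
      Y (sᶜ.card + 1) (Fin.cons (X s.card (restr s fun i => (v i).val))
          (restr sᶜ fun i => (v i).val)) =
        evalMulti Y (word (restr sᶜ v) ++ [bracketWord X hX (word (restr s v))]) := by
    intro s
    rw [← word_cons, evalMulti_word]
    congr 1
    refine Eq.trans ?_ (Fin.comp_cons (fun y : Homog ℳ => y.val) (bracketWord X hX _) _).symm
    congr 1
    exact (evalMulti_word X (restr s v)).symm
  simp only [h1]
  rw [sum_unshuffleSign_smul Homog.deg v (fun p q => evalMulti Y (q ++ [bracketWord X hX p])),
    shuffleSum_swap]
  refine shuffleSum_congr _ fun p q _ => ?_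
  rw [(evalMulti_symm hY).move, List.append_nil, sgn_smul_sgn_smul]
  congr 1
  apply sgn_congr
  change ((_ + (1 + _) * _ : ℤ) : ZMod 2) = _
  push_cast
  generalize (wordDeg Homog.deg p : ZMod 2) = b
  generalize (wordDeg Homog.deg q : ZMod 2) = c
  decide +revert

theorem sum_sgn_eq_shuffleSum {N : Type*} [AddCommGroup N] {n : ℕ} (v : Fin n → Homog ℳ)
    (F : List (Homog ℳ) → List (Homog ℳ) → N) :
    ∑ s : Finset (Fin n), (sgn (∑ i ∈ s, (v i).deg) * unshuffleSign (fun i => (v i).deg) s) •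
        F (word (restr s v)) (word (restr sᶜ v)) =
      shuffleSum Homog.deg (word v) (fun p q => sgn (wordDeg Homog.deg p) • F p q) := by
  rw [← sum_unshuffleSign_smul]
  refine Finset.sum_congr rfl fun s _ => ?_
  rw [wordDeg_word_restr, smul_smul, mul_comm]

end Homogeneous

/-! ### Torsion-freeness, sign twists and reduction to homogeneous elements -/

section SignTwist

variable {K M : Type*} [Field K] [AddCommGroup M] [Module K M]

theorem isAddTorsionFree_of_charZero (K M : Type*) [Field K] [CharZero K] [AddCommGroup M]
    [Module K M] : IsAddTorsionFree M := by
  let _ : Algebra ℚ K := DivisionRing.toRatAlgebra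
  let _ : Module ℚ M := Module.compHom M (algebraMap ℚ K)
  exact .of_module_rat M

/-- The operator that multiplies elements of degree `i` by `(-1)^(n i)`. -/
def signTwist (ℳ : ℤ → Submodule K M) [DirectSum.Decomposition ℳ] (n : ℤ) : M →ₗ[K] M :=
  (DirectSum.toModule K ℤ M fun i => sgn (n * i) • (ℳ i).subtype) ∘ₗ
    (DirectSum.decomposeLinearEquiv ℳ).toLinearMap

theorem signTwist_of_mem (ℳ : ℤ → Submodule K M) [DirectSum.Decomposition ℳ] (n : ℤ) {i : ℤ}
    {x : M} (hx : x ∈ ℳ i) : signTwist ℳ n x = sgn (n * i) • x := by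
  simp only [signTwist, LinearMap.comp_apply, LinearEquiv.coe_coe,
    DirectSum.decomposeLinearEquiv_apply, DirectSum.decompose_of_mem ℳ hx]
  erw [DirectSum.toModule_lof]
  rfl

/-- A linear map is determined by its values on homogeneous elements. -/
theorem linearMap_ext_of_homogeneous {N : Type*} [AddCommGroup N] [Module K N]
    (ℳ : ℤ → Submodule K M) [DirectSum.Decomposition ℳ] {f g : M →ₗ[K] N}
    (h : ∀ (i : ℤ) (x : M), x ∈ ℳ i → f x = g x) : f = g := by
  ext x
  induction x using DirectSum.Decomposition.inductionOn ℳ with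
  | zero => simp
  | add x y hx hy => rw [map_add, map_add, hx, hy]
  | homogeneous x => exact h _ _ x.2

end SignTwist

/-! ### Iterated graded commutators with multiplication operators -/

section Commutators

variable {K B : Type*} [Field K] [Ring B] [Algebra K B] {ℬ : ℤ → Submodule K B}

/-- An operator is homogeneous of degree `p`. -/
def HasDegree (ℬ : ℤ → Submodule K B) (p : ℤ) (F : B →ₗ[K] B) : Prop :=
  ∀ (d : ℤ) (u : B), u ∈ ℬ d → F u ∈ ℬ (p + d)

/-- The iterated commutator of an operator of degree `p` with the multiplications by the letters
of a word. -/
def wordComm (p : ℤ) (F : B →ₗ[K] B) : List (Homog ℬ) → (B →ₗ[K] B)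
  | [] => F
  | x :: w => gradedComm (p + wordDeg Homog.deg w) x.deg (wordComm p F w)
      (LinearMap.mulLeft K x.val)

theorem wordComm_nil (p : ℤ) (F : B →ₗ[K] B) : wordComm (ℬ := ℬ) p F [] = F := rfl

theorem wordComm_cons (p : ℤ) (F : B →ₗ[K] B) (x : Homog ℬ) (w : List (Homog ℬ)) :
    wordComm p F (x :: w) = gradedComm (p + wordDeg Homog.deg w) x.deg (wordComm p F w)
      (LinearMap.mulLeft K x.val) := rfl

theorem gradedComm_mulLeft_apply (p d : ℤ) (F : B →ₗ[K] B) (x v : B) :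
    gradedComm p d F (LinearMap.mulLeft K x) v = F (x * v) - sgn (p * d) • (x * F v) := rfl

theorem wordComm_cons_apply (p : ℤ) (F : B →ₗ[K] B) (x : Homog ℬ) (w : List (Homog ℬ)) (v : B) :
    wordComm p F (x :: w) v = wordComm p F w (x.val * v) -
      sgn ((p + wordDeg Homog.deg w) * x.deg) • (x.val * wordComm p F w v) := rfl

theorem iterComm_eq_wordComm (p : ℤ) (F : B →ₗ[K] B) {k : ℕ} (v : Fin k → Homog ℬ) :
    iterComm p F k (fun i => (v i).deg) (fun i => (v i).val) = wordComm p F (word v) := by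
  induction k with
  | zero => rw [word_zero]; rfl
  | succ k ih =>
    rw [word_succ, wordComm_cons, ← ih, wordDeg_word]
    rfl

/-- The graded commutator is additive in the first entry. -/
def gradedCommHom (p d : ℤ) (G : B →ₗ[K] B) : (B →ₗ[K] B) →+ (B →ₗ[K] B) where
  toFun F := gradedComm p d F G
  map_zero' := by simp [gradedComm]
  map_add' F F' := by
    simp only [gradedComm, LinearMap.add_comp, LinearMap.comp_add, smul_add]
    abel

theorem gradedComm_zero_left (p d : ℤ) (G : B →ₗ[K] B) : gradedComm p d 0 G = 0 :=
  map_zero (gradedCommHom p d G)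

theorem gradedComm_add_left (p d : ℤ) (F F' G : B →ₗ[K] B) :
    gradedComm p d (F + F') G = gradedComm p d F G + gradedComm p d F' G :=
  map_add (gradedCommHom p d G) F F'

theorem gradedComm_zsmul_left (p d m : ℤ) (F G : B →ₗ[K] B) :
    gradedComm p d (m • F) G = m • gradedComm p d F G :=
  map_zsmul (gradedCommHom p d G) m F

/-- The graded commutator with `H` is a graded derivation of composition. Iterating this rule
produces the sum over unshuffles in `wordComm_comp`. -/
theorem gradedComm_comp_left (p q d : ℤ) (F G H : B →ₗ[K] B) :
    gradedComm (p + q) d (F ∘ₗ G) H =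
      F ∘ₗ gradedComm q d G H + sgn (q * d) • (gradedComm p d F H ∘ₗ G) := by
  ext v
  simp only [gradedComm, LinearMap.add_apply, LinearMap.sub_apply, LinearMap.comp_apply,
    LinearMap.smul_apply, map_sub, map_zsmul, smul_sub, sgn_smul_sgn_smul]
  rw [show (p + q) * d = q * d + p * d by ring]
  abel

theorem wordComm_zero (p : ℤ) (w : List (Homog ℬ)) : wordComm p (0 : B →ₗ[K] B) w = 0 := by
  induction w with
  | nil => rfl
  | cons x w ih => rw [wordComm_cons, ih, gradedComm_zero_left]

theorem wordComm_add (p : ℤ) (F G : B →ₗ[K] B) (w : List (Homog ℬ)) :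
    wordComm p (F + G) w = wordComm p F w + wordComm p G w := by
  induction w with
  | nil => rfl
  | cons x w ih => rw [wordComm_cons, ih, gradedComm_add_left]; rfl

theorem wordComm_sum {ι : Type*} (s : Finset ι) (p : ℤ) (F : ι → B →ₗ[K] B)
    (w : List (Homog ℬ)) : wordComm p (∑ i ∈ s, F i) w = ∑ i ∈ s, wordComm p (F i) w :=
  map_sum (⟨⟨fun F => wordComm p F w, wordComm_zero p w⟩, fun F G => wordComm_add p F G w⟩ :
    (B →ₗ[K] B) →+ (B →ₗ[K] B)) F s

theorem wordComm_eq_zero_of_suffix {p : ℤ} {F : B →ₗ[K] B} {w : List (Homog ℬ)}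
    (h : wordComm p F w = 0) (v : List (Homog ℬ)) : wordComm p F (v ++ w) = 0 := by
  induction v with
  | nil => exact h
  | cons x v ih => rw [List.cons_append, wordComm_cons, ih, gradedComm_zero_left]

theorem wordComm_cons_zero {p : ℤ} {F : B →ₗ[K] B} {x : Homog ℬ} (hx : x.val = 0)
    (w : List (Homog ℬ)) : wordComm p F (x :: w) = 0 := by
  ext v; simp [wordComm_cons_apply, hx]

/-- The commutators of a composition. -/
theorem wordComm_comp (p c : ℤ) (F G : B →ₗ[K] B) (w : List (Homog ℬ)) :
    wordComm (p + c) (F ∘ₗ G) w = shuffleSum Homog.deg w (fun u v =>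
      sgn (wordDeg Homog.deg u * c) • (wordComm p F u ∘ₗ wordComm c G v)) := by
  induction w with
  | nil => simp [shuffleSum_nil, wordDeg_nil, sgn_zero, wordComm_nil]
  | cons x w ih =>
    rw [wordComm_cons, ih]
    refine (map_shuffleSum Homog.deg (gradedCommHom _ _ _) w _).trans ?_
    rw [shuffleSum_cons]
    refine shuffleSum_congr_deg _ fun u v huv => ?_
    change gradedComm _ _ (_ • _) _ = _
    rw [gradedComm_zsmul_left, ← huv,
      show p + c + (wordDeg Homog.deg u + wordDeg Homog.deg v) =
        p + wordDeg Homog.deg u + (c + wordDeg Homog.deg v) by ring, gradedComm_comp_left,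
      ← wordComm_cons, ← wordComm_cons, smul_add, sgn_smul_sgn_smul, sgn_smul_sgn_smul, add_comm,
      wordDeg_cons]
    congr 3
    ring

end Commutators

/-! ### Commutators in a graded commutative algebra and the square of an operator -/

section GradedCommutativeAlgebra

variable {K B : Type*} [Field K] [Ring B] [Algebra K B] {ℬ : ℤ → Submodule K B}

theorem Homog.mul_comm (hB : GradedCommutative ℬ) (x y : Homog ℬ) :
    x.val * y.val = sgn (x.deg * y.deg) • (y.val * x.val) := hB _ _ _ _ x.mem y.mem

theorem Homog.mul_left_comm (hB : GradedCommutative ℬ) (x y : Homog ℬ) (v : B) :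
    x.val * (y.val * v) = sgn (x.deg * y.deg) • (y.val * (x.val * v)) := by
  rw [← mul_assoc, x.mul_comm hB y, smul_mul_assoc, mul_assoc]

/-- Iterated commutators with multiplication operators are graded symmetric. -/
theorem wordComm_symm (hB : GradedCommutative ℬ) (p : ℤ) (F : B →ₗ[K] B) :
    WordSymmetric Homog.deg (wordComm (ℬ := ℬ) p F) := by
  intro u x y w
  induction u with
  | nil =>
    ext v
    simp only [List.nil_append, wordComm_cons_apply, LinearMap.smul_apply, wordDeg_cons]
    have e1 := x.mul_left_comm hB y v
    have e2 := x.mul_left_comm hB y (wordComm p F w v)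
    by_cases hp : Even p <;> by_cases hx : Even x.deg <;> by_cases hy : Even y.deg <;>
      by_cases hw : Even (wordDeg Homog.deg w) <;>
      simp only [sgn_eq_ite, Int.even_add, Int.even_mul, hp, hx, hy, hw, if_true, if_false,
        one_smul, neg_smul, or_true, or_false, iff_true,
        iff_false, not_true] at e1 e2 ⊢ <;>
      rw [e1, mul_sub, mul_sub] <;> simp only [mul_neg, e2, map_neg] <;> abel
  | cons z u ih =>
    rw [List.cons_append, wordComm_cons, ih, gradedComm_zsmul_left, List.cons_append,
      wordComm_cons]
    congr 3
    simp only [wordDeg_append, wordDeg_cons]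
    ring

theorem gradedComm_hasDegree [SetLike.GradedMonoid ℬ] {p : ℤ} {F : B →ₗ[K] B}
    (hF : HasDegree ℬ p F) (x : Homog ℬ) :
    HasDegree ℬ (p + x.deg) (gradedComm p x.deg F (LinearMap.mulLeft K x.val)) := by
  intro d u hu
  rw [gradedComm_mulLeft_apply]
  have h1 := hF _ _ (SetLike.mul_mem_graded x.mem hu)
  have h2 := SetLike.mul_mem_graded x.mem (hF _ _ hu)
  rw [← add_assoc] at h1
  rw [← add_assoc, add_comm x.deg] at h2
  exact sub_mem h1 (zsmul_mem h2 _)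

theorem wordComm_hasDegree [SetLike.GradedMonoid ℬ] {p : ℤ} {F : B →ₗ[K] B}
    (hF : HasDegree ℬ p F) (w : List (Homog ℬ)) :
    HasDegree ℬ (p + wordDeg Homog.deg w) (wordComm p F w) := by
  induction w with
  | nil => rw [wordDeg_nil, add_zero]; exact hF
  | cons x w ih =>
    rw [wordDeg_cons, add_comm x.deg, ← add_assoc]
    exact gradedComm_hasDegree ih x

/-- The value at `1` of an iterated commutator. -/
def commVal [SetLike.GradedMonoid ℬ] {p : ℤ} {F : B →ₗ[K] B} (hF : HasDegree ℬ p F)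
    (w : List (Homog ℬ)) : Homog ℬ :=
  ⟨p + wordDeg Homog.deg w, wordComm p F w 1, by
    have h := wordComm_hasDegree hF w 0 1 SetLike.GradedOne.one_mem
    rwa [add_zero] at h⟩

/-- An operator at `y` is its commutator with `y` at `1` plus a product. This separates the nested
brackets from the products in the square of an operator. -/
theorem wordComm_apply_eq [SetLike.GradedMonoid ℬ] {p : ℤ} {F : B →ₗ[K] B}
    (hF : HasDegree ℬ p F) (w : List (Homog ℬ)) (y : Homog ℬ) :
    wordComm p F w y.val = wordComm p F (y :: w) 1 +
      sgn ((p + wordDeg Homog.deg w) * y.deg) • (y.val * (commVal hF w).val) := by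
  rw [wordComm_cons_apply, mul_one]
  exact (sub_add_cancel _ _).symm

/-- Higher derived brackets: iterated commutators of `D ∘ D`, evaluated at `1`. -/
theorem wordComm_square [CharZero K] [SetLike.GradedMonoid ℬ] (hB : GradedCommutative ℬ)
    {D : ℕ → B →ₗ[K] B} (hD : ∀ k, HasDegree ℬ 1 (D k)) (m : ℕ) (w : List (Homog ℬ)) :
    wordComm 2 (∑ ij ∈ Finset.HasAntidiagonal.antidiagonal m, D ij.1 ∘ₗ D ij.2) w 1 =
      shuffleSum Homog.deg w (fun p q => sgn (wordDeg Homog.deg p) •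
        ∑ ij ∈ Finset.HasAntidiagonal.antidiagonal m,
          wordComm 1 (D ij.1) (commVal (hD ij.2) q :: p) 1) := by
  have := isAddTorsionFree_of_charZero K B
  have h : ∀ i j, wordComm 2 (D i ∘ₗ D j) w 1 = shuffleSum Homog.deg w (fun p q =>
      sgn (wordDeg Homog.deg p) • wordComm 1 (D i) (commVal (hD j) q :: p) 1 +
        sgn (wordDeg Homog.deg p + (1 + wordDeg Homog.deg p) * (1 + wordDeg Homog.deg q)) •
          ((commVal (hD j) q).val * (commVal (hD i) p).val)) := by
    intro i j
    rw [show (2 : ℤ) = 1 + 1 by norm_num, wordComm_comp]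
    refine (map_shuffleSum _ (LinearMap.applyₗ (R := K) (1 : B) :
      (B →ₗ[K] B) →ₗ[K] B) w _).trans ?_
    congr 1
    ext p q
    rw [mul_one, map_zsmul, ← sgn_smul_sgn_smul, ← smul_add]
    exact congrArg (_ • ·) (wordComm_apply_eq (hD i) p (commVal (hD j) q))
  rw [wordComm_sum, LinearMap.sum_apply, Finset.sum_congr rfl fun ij _ => h ij.1 ij.2]
  rw [shuffleSum_sum]
  simp only [Finset.sum_add_distrib, shuffleSum_add, ← Finset.smul_sum]
  -- It remains to kill the products of two commutator values. Exchanging `p` with `q` together with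
  -- `i` and `j` returns the same products by graded commutativity, with opposite sign because both
  -- factors carry the extra degree `1`.
  rw [add_eq_left]
  refine shuffleSum_eq_zero_of_antisymm _ fun p q => ?_
  rw [← Finset.Nat.sum_antidiagonal_swap, sgn_smul_sgn_smul, ← smul_neg, ← Finset.sum_neg_distrib]
  rw [Finset.smul_sum, Finset.smul_sum]
  refine Finset.sum_congr rfl fun ij _ => ?_
  rw [Homog.mul_comm hB (commVal (hD ij.2) q), ← smul_neg]
  rw [smul_neg, smul_neg, sgn_smul_sgn_smul, ← neg_smul, ← sgn_add_one]
  congr 1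
  apply sgn_congr
  change _ = ((_ + (1 + _) * (1 + _) + 1 : ℤ) : ZMod 2)
  push_cast
  generalize (wordDeg Homog.deg p : ZMod 2) = b
  generalize (wordDeg Homog.deg q : ZMod 2) = c
  decide +revert

end GradedCommutativeAlgebra

/-! ### Order of differential operators -/

section Order

variable {K B : Type*} [Field K] [Ring B] [Algebra K B] {ℬ : ℤ → Submodule K B}

/-- `F`, of degree `p`, is a differential operator of order less than `n`. -/
def OrderLT (ℬ : ℤ → Submodule K B) : ℕ → ℤ → (B →ₗ[K] B) → Prop
  | 0, _, F => F = 0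
  | n + 1, p, F => ∀ x : Homog ℬ,
      OrderLT ℬ n (p + x.deg) (gradedComm p x.deg F (LinearMap.mulLeft K x.val))

theorem OrderLT.zero (n : ℕ) (p : ℤ) : OrderLT ℬ n p 0 := by
  induction n generalizing p with
  | zero => rfl
  | succ n ih => intro x; rw [gradedComm_zero_left]; exact ih _

theorem OrderLT.add {n : ℕ} {p : ℤ} {F G : B →ₗ[K] B} (hF : OrderLT ℬ n p F)
    (hG : OrderLT ℬ n p G) : OrderLT ℬ n p (F + G) := by
  induction n generalizing p F G with
  | zero => rw [show F = 0 from hF, show G = 0 from hG, add_zero]; rfl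
  | succ n ih => intro x; rw [gradedComm_add_left]; exact ih (hF x) (hG x)

theorem OrderLT.zsmul {n : ℕ} {p : ℤ} {F : B →ₗ[K] B} (hF : OrderLT ℬ n p F) (m : ℤ) :
    OrderLT ℬ n p (m • F) := by
  induction n generalizing p F with
  | zero => rw [show F = 0 from hF, smul_zero]; rfl
  | succ n ih => intro x; rw [gradedComm_zsmul_left]; exact ih (hF x)

theorem OrderLT.smul {n : ℕ} {p : ℤ} {F : B →ₗ[K] B} (hF : OrderLT ℬ n p F) (c : K) :
    OrderLT ℬ n p (c • F) := by
  induction n generalizing p F with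
  | zero => rw [show F = 0 from hF, smul_zero]; rfl
  | succ n ih =>
    intro x
    have h : gradedComm p x.deg (c • F) (LinearMap.mulLeft K x.val) =
        c • gradedComm p x.deg F (LinearMap.mulLeft K x.val) := by
      ext v
      simp only [gradedComm_mulLeft_apply, LinearMap.smul_apply, smul_sub, mul_smul_comm]
      rw [smul_comm]
    rw [h]
    exact ih (hF x)

theorem OrderLT.comp_mulLeft (hB : GradedCommutative ℬ) {n : ℕ} {p : ℤ} {F : B →ₗ[K] B}
    (hF : OrderLT ℬ n p F) (y : Homog ℬ) :
    OrderLT ℬ n (p + y.deg) (F ∘ₗ LinearMap.mulLeft K y.val) := by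
  induction n generalizing p F with
  | zero => rw [show F = 0 from hF, LinearMap.zero_comp]; rfl
  | succ n ih =>
    intro x
    have h : gradedComm (p + y.deg) x.deg (F ∘ₗ LinearMap.mulLeft K y.val)
        (LinearMap.mulLeft K x.val) = sgn (x.deg * y.deg) •
          (gradedComm p x.deg F (LinearMap.mulLeft K x.val) ∘ₗ LinearMap.mulLeft K y.val) := by
      ext v
      simp only [gradedComm_mulLeft_apply, LinearMap.smul_apply, LinearMap.comp_apply,
        LinearMap.mulLeft_apply, smul_sub, sgn_smul_sgn_smul]
      rw [y.mul_left_comm hB x, map_zsmul, _root_.mul_comm y.deg]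
      congr 3
      ring
    rw [h, add_right_comm]
    exact (ih (hF x)).zsmul _

theorem OrderLT.mulLeft_comp (hB : GradedCommutative ℬ) {n : ℕ} {p : ℤ} {F : B →ₗ[K] B}
    (hF : OrderLT ℬ n p F) (y : Homog ℬ) :
    OrderLT ℬ n (p + y.deg) (LinearMap.mulLeft K y.val ∘ₗ F) := by
  induction n generalizing p F with
  | zero => rw [show F = 0 from hF, LinearMap.comp_zero]; rfl
  | succ n ih =>
    intro x
    have h : gradedComm (p + y.deg) x.deg (LinearMap.mulLeft K y.val ∘ₗ F)
        (LinearMap.mulLeft K x.val) =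
          LinearMap.mulLeft K y.val ∘ₗ gradedComm p x.deg F (LinearMap.mulLeft K x.val) := by
      ext v
      simp only [gradedComm_mulLeft_apply, LinearMap.comp_apply, LinearMap.mulLeft_apply, mul_sub,
        mul_smul_comm]
      rw [y.mul_left_comm hB x, sgn_smul_sgn_smul]
      congr 3
      ring
    rw [h, add_right_comm]
    exact ih (hF x)

/-- The Leibniz rule for the commutator in the multiplied element. It is behind both the reduction
of the order to generators and the derivation property of derived brackets. -/
theorem gradedComm_mulLeft_mul (p d e : ℤ) (F : B →ₗ[K] B) (x y : B) :
    gradedComm p (d + e) F (LinearMap.mulLeft K (x * y)) =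
      gradedComm p d F (LinearMap.mulLeft K x) ∘ₗ LinearMap.mulLeft K y +
        sgn (p * d) • (LinearMap.mulLeft K x ∘ₗ gradedComm p e F (LinearMap.mulLeft K y)) := by
  ext v
  simp only [gradedComm_mulLeft_apply, LinearMap.comp_apply, LinearMap.mulLeft_apply, mul_sub,
    mul_smul_comm, LinearMap.add_apply, LinearMap.smul_apply, smul_sub, sgn_smul_sgn_smul, mul_assoc]
  rw [mul_add]
  abel

/-- The commutator with a product has the order of the commutators with the factors. -/
theorem OrderLT.gradedComm_mul (hB : GradedCommutative ℬ) {n : ℕ} {p : ℤ} {F : B →ₗ[K] B}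
    {x y : Homog ℬ}
    (hx : OrderLT ℬ n (p + x.deg) (gradedComm p x.deg F (LinearMap.mulLeft K x.val)))
    (hy : OrderLT ℬ n (p + y.deg) (gradedComm p y.deg F (LinearMap.mulLeft K y.val))) :
    OrderLT ℬ n (p + (x.deg + y.deg))
      (gradedComm p (x.deg + y.deg) F (LinearMap.mulLeft K (x.val * y.val))) := by
  rw [gradedComm_mulLeft_mul]
  refine OrderLT.add ?_ (OrderLT.zsmul ?_ _)
  · rw [← add_assoc]; exact hx.comp_mulLeft hB y
  · rw [add_comm x.deg, ← add_assoc]; exact hy.mulLeft_comp hB x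

/-- `OrderLT` peels off the innermost commutator and `wordComm` the outermost one. The innermost
letter is the end of the word, which reconciles the two recursions. -/
theorem wordComm_append_singleton (p : ℤ) (F : B →ₗ[K] B) (w : List (Homog ℬ)) (x : Homog ℬ) :
    wordComm p F (w ++ [x]) =
      wordComm (p + x.deg) (gradedComm p x.deg F (LinearMap.mulLeft K x.val)) w := by
  induction w with
  | nil => simp [wordComm_cons, wordComm_nil, wordDeg_nil]
  | cons y w ih =>
    rw [List.cons_append, wordComm_cons, ih, wordComm_cons]
    congr 1
    simp only [wordDeg_append, wordDeg_cons, wordDeg_nil]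
    ring

theorem OrderLT.wordComm_eq_zero {n : ℕ} {p : ℤ} {F : B →ₗ[K] B} (hF : OrderLT ℬ n p F)
    {w : List (Homog ℬ)} (hw : n ≤ w.length) : wordComm p F w = 0 := by
  induction n generalizing p F w with
  | zero => rw [show F = 0 from hF, wordComm_zero]
  | succ n ih =>
    rcases List.eq_nil_or_concat w with rfl | ⟨w, x, rfl⟩
    · simp at hw
    · rw [List.concat_eq_append, wordComm_append_singleton]
      refine ih (hF x) ?_
      simpa using hw

end Order

/-! ### Derived brackets as multilinear maps -/

section DerivedBrackets

variable {K B : Type*} [Field K] [Ring B] [Algebra K B] (ℬ : ℤ → Submodule K B) [GradedAlgebra ℬ]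

/-- The graded commutator with multiplication operators, extended to elements and operators that
need not be homogeneous. -/
def mulComm : B →ₗ[K] (B →ₗ[K] B) →ₗ[K] (B →ₗ[K] B) :=
  (DirectSum.toModule K ℤ _ fun d => LinearMap.mk₂ K
    -- Conjugation by the sign twist multiplies an operator of degree `p` by `(-1)^(pd)`. The
    -- commutator thus becomes linear in `F` with no reference to its degree.
    (fun (u : ℬ d) (F : B →ₗ[K] B) => F ∘ₗ LinearMap.mulLeft K (u : B) -
      LinearMap.mulLeft K (u : B) ∘ₗ signTwist ℬ d ∘ₗ F ∘ₗ signTwist ℬ d)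
    (by intros; ext; simp [add_mul]; abel)
    (by intros; ext; simp [smul_sub])
    (by intros; ext; simp [mul_add]; abel)
    (by intros; ext; simp [smul_sub])) ∘ₗ (DirectSum.decomposeLinearEquiv ℬ).toLinearMap

theorem mulComm_apply {p : ℤ} {F : B →ₗ[K] B} (hF : HasDegree ℬ p F) (x : Homog ℬ) :
    mulComm ℬ x.val F = gradedComm p x.deg F (LinearMap.mulLeft K x.val) := by
  have h1 : mulComm ℬ x.val F = F ∘ₗ LinearMap.mulLeft K x.val -
      LinearMap.mulLeft K x.val ∘ₗ signTwist ℬ x.deg ∘ₗ F ∘ₗ signTwist ℬ x.deg := by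
    simp only [mulComm, LinearMap.comp_apply, LinearEquiv.coe_coe,
      DirectSum.decomposeLinearEquiv_apply, DirectSum.decompose_of_mem ℬ x.mem]
    erw [DirectSum.toModule_lof]
    rfl
  rw [h1]
  refine linearMap_ext_of_homogeneous ℬ fun i v hv => ?_
  rw [gradedComm_mulLeft_apply]
  simp only [LinearMap.sub_apply, LinearMap.comp_apply, LinearMap.mulLeft_apply,
    signTwist_of_mem ℬ _ hv, map_zsmul, signTwist_of_mem ℬ _ (hF i v hv),
    sgn_smul_sgn_smul]
  congr 2
  apply sgn_congr
  push_cast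
  generalize (p : ZMod 2) = a
  generalize (x.deg : ZMod 2) = b
  generalize (i : ZMod 2) = c
  decide +revert

/-- The iterated commutators of an operator as a multilinear map. -/
def commMulti (F : B →ₗ[K] B) : ∀ k : ℕ, MultilinearMap K (fun _ : Fin k => B) (B →ₗ[K] B)
  | 0 => MultilinearMap.constOfIsEmpty K _ F
  | k + 1 => MultilinearMap.uncurryRight
      ((mulComm ℬ).flip.compMultilinearMap (commMulti F k))

theorem commMulti_apply {p : ℤ} {F : B →ₗ[K] B} (hF : HasDegree ℬ p F) {k : ℕ}
    (v : Fin k → Homog ℬ) :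
    commMulti ℬ F k (fun i => (v i).val) = wordComm p F (word v) := by
  induction k with
  | zero => rw [word_zero]; rfl
  | succ k ih =>
    rw [word_succ, wordComm_cons, ← mulComm_apply ℬ (wordComm_hasDegree hF _), ← ih]
    rfl

/-- The higher derived brackets of a family of operators. -/
def derivedBracket (D : ℕ → B →ₗ[K] B) (k : ℕ) : MultilinearMap K (fun _ : Fin k => B) B :=
  (LinearMap.applyₗ (R := K) (1 : B) : (B →ₗ[K] B) →ₗ[K] B).compMultilinearMap
    (commMulti ℬ (D k) k)

end DerivedBrackets

/-! ### Symmetry, Leibniz rule and Jacobi identities of derived brackets -/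

section DerivedBracketTheorem

variable {K B : Type*} [Field K] [Ring B] [Algebra K B] {ℬ : ℤ → Submodule K B} [GradedAlgebra ℬ]
  {D : ℕ → B →ₗ[K] B}

theorem derivedBracket_apply (hD : ∀ k, HasDegree ℬ 1 (D k)) {k : ℕ} (v : Fin k → Homog ℬ) :
    derivedBracket ℬ D k (fun i => (v i).val) = wordComm 1 (D k) (word v) 1 := by
  rw [derivedBracket, LinearMap.compMultilinearMap_apply, commMulti_apply ℬ (hD k)]
  rfl

theorem evalMulti_derivedBracket (hD : ∀ k, HasDegree ℬ 1 (D k)) (w : List (Homog ℬ)) :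
    evalMulti (derivedBracket ℬ D) w = wordComm 1 (D w.length) w 1 := by
  have h := derivedBracket_apply hD (letters w)
  rw [word_letters] at h
  exact h

theorem derivedBracket_mem (hD : ∀ k, HasDegree ℬ 1 (D k)) (k : ℕ) (d : Fin k → ℤ)
    (u : Fin k → B) (hu : ∀ i, u i ∈ ℬ (d i)) : derivedBracket ℬ D k u ∈ ℬ (1 + ∑ i, d i) := by
  have h := (commVal (hD k) (word fun i => (⟨d i, u i, hu i⟩ : Homog ℬ))).mem
  change wordComm _ _ _ _ ∈ ℬ (_ + _) at h
  rw [wordDeg_word, ← derivedBracket_apply hD] at h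
  exact h

theorem derivedBracket_symm (hB : GradedCommutative ℬ) (hD : ∀ k, HasDegree ℬ 1 (D k)) (k : ℕ) :
    GradedSymmetric ℬ (derivedBracket ℬ D k) := by
  intro d u hu σ
  have h := (wordComm_symm hB 1 (D k)).perm (fun i => (⟨d i, u i, hu i⟩ : Homog ℬ)) σ
  have h1 := derivedBracket_apply hD (fun i => (⟨d i, u i, hu i⟩ : Homog ℬ))
  have h2 := derivedBracket_apply hD (fun i => (⟨d (σ i), u (σ i), hu (σ i)⟩ : Homog ℬ))
  rw [h1, h2, h]
  rfl

theorem derivedBracket_snoc (hD : ∀ k, HasDegree ℬ 1 (D k)) {k : ℕ} (v : Fin k → Homog ℬ)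
    (x : Homog ℬ) :
    derivedBracket ℬ D (k + 1) (Fin.snoc (fun i => (v i).val) x.val) =
      wordComm 1 (D (k + 1)) (x :: word v) 1 := by
  rw [← word_snoc, ← derivedBracket_apply hD]
  congr 1
  exact (Fin.comp_snoc (fun y : Homog ℬ => y.val) v x).symm

/-- The product of homogeneous elements. -/
def Homog.mul (x y : Homog ℬ) : Homog ℬ :=
  ⟨x.deg + y.deg, x.val * y.val, SetLike.mul_mem_graded x.mem y.mem⟩

theorem wordComm_mul (p : ℤ) (F : B →ₗ[K] B) (x y : Homog ℬ) (w : List (Homog ℬ)) (v : B) :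
    wordComm p F (x.mul y :: w) v = wordComm p F (x :: w) (y.val * v) +
      sgn ((p + wordDeg Homog.deg w) * x.deg) • (x.val * wordComm p F (y :: w) v) :=
  LinearMap.congr_fun (gradedComm_mulLeft_mul _ x.deg y.deg (wordComm p F w) x.val y.val) v

/-- Since `D (k + 1)` has order `k + 1`, its commutator with `k + 1` elements is multiplication by
the value at `1`. The Leibniz rule for commutators with a product then turns into the derivation
property at `1`. -/
theorem derivedBracket_isMultiderivation (hB : GradedCommutative ℬ)
    (hD : ∀ k, HasDegree ℬ 1 (D k)) (h0 : D 0 = 0)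
    (hord : ∀ k (w : List (Homog ℬ)), k < w.length → wordComm 1 (D k) w = 0) :
    IsMultiderivation ℬ (derivedBracket ℬ D) where
  zero := by
    ext u
    change D 0 1 = 0
    rw [h0, LinearMap.zero_apply]
  mem := derivedBracket_mem hD
  symm := derivedBracket_symm hB hD
  leibniz k d u hu e a ha b := by
    have key : (derivedBracket ℬ D (k + 1)).curryRight u ∘ₗ LinearMap.mulLeft K a =
        sgn ((1 + ∑ i, d i) * e) •
          (LinearMap.mulLeft K a ∘ₗ (derivedBracket ℬ D (k + 1)).curryRight u) +
        LinearMap.mulLeft K ((derivedBracket ℬ D (k + 1)).curryRight u a) := by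
      refine linearMap_ext_of_homogeneous ℬ fun i b hb => ?_
      simp only [LinearMap.comp_apply, LinearMap.add_apply, LinearMap.smul_apply,
        LinearMap.mulLeft_apply, MultilinearMap.curryRight_apply]
      let v : Fin k → Homog ℬ := fun i => ⟨d i, u i, hu i⟩
      let x : Homog ℬ := ⟨e, a, ha⟩
      let y : Homog ℬ := ⟨i, b, hb⟩
      have hx := derivedBracket_snoc hD v x
      have hy := derivedBracket_snoc hD v y
      have hxy := derivedBracket_snoc hD v (x.mul y)
      have hw : wordDeg Homog.deg (word v) = ∑ i, d i := wordDeg_word _ _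
      have hval : wordComm 1 (D (k + 1)) (x :: word v) (y.val * 1) =
          wordComm 1 (D (k + 1)) (x :: word v) 1 * y.val := by
        -- One commutator more than the order allows: it vanishes, so `y` can be pulled out of the
        -- argument.
        have h1 := LinearMap.congr_fun (hord (k + 1) (y :: x :: word v)
          (by simp [length_word])) 1
        rw [wordComm_cons_apply, LinearMap.zero_apply, sub_eq_zero] at h1
        rw [h1, _root_.mul_comm (1 + _)]
        have h2 := Homog.mul_comm hB y (commVal (hD (k + 1)) (x :: word v))
        change y.val * wordComm 1 (D (k + 1)) (x :: word v) 1 = sgn (_ * (1 + _)) •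
          (wordComm 1 (D (k + 1)) (x :: word v) 1 * y.val) at h2
        rw [h2, sgn_smul_self]
      rw [wordComm_mul, hval, ← hx, ← hy, hw] at hxy
      exact hxy.trans (add_comm _ _)
    exact LinearMap.congr_fun key b

theorem Homog.ext_val_deg {M : Type*} [AddCommGroup M] [Module K M] {ℳ : ℤ → Submodule K M}
    {x y : Homog ℳ} (hd : x.deg = y.deg) (hv : x.val = y.val) : x = y := by
  cases x; cases y; simp only at hd hv; subst hd hv; rfl

/-- The Jacobiator on `n` entries is the `n`-fold commutator at `1` of the component of the square
with `i + j = n + 1`. By the order bounds only one pair `(i, j)` survives for each unshuffle. -/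
theorem derivedBracket_jacobi [CharZero K] (hB : GradedCommutative ℬ)
    (hD : ∀ k, HasDegree ℬ 1 (D k))
    (hord : ∀ k (w : List (Homog ℬ)), k < w.length → wordComm 1 (D k) w = 0)
    (hsq : ∀ m, ∑ ij ∈ Finset.HasAntidiagonal.antidiagonal m, D ij.1 ∘ₗ D ij.2 = 0)
    (n : ℕ) (d : Fin n → ℤ) (u : Fin n → B) (hu : ∀ i, u i ∈ ℬ (d i)) :
    jacobiator (derivedBracket ℬ D) d u = 0 := by
  have h := sum_cons_eq_shuffleSum (derivedBracket_mem hD) (derivedBracket_symm hB hD)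
    (fun i => (⟨d i, u i, hu i⟩ : Homog ℬ))
  refine h.trans ?_
  have h2 := wordComm_square hB hD (n + 1) (word fun i => (⟨d i, u i, hu i⟩ : Homog ℬ))
  rw [hsq, wordComm_zero, LinearMap.zero_apply] at h2
  refine Eq.trans (shuffleSum_congr _ fun p q hpq => ?_) h2.symm
  rw [length_word] at hpq
  -- A smaller `i` makes the outer commutator exceed the order of `D i`. A larger `i` forces `j <
  -- q.length`, and then the inner value is already zero.
  rw [Finset.sum_eq_single (p.length + 1, q.length)]
  · rw [evalMulti_derivedBracket hD]
    congr 4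
    exact Homog.ext_val_deg rfl (evalMulti_derivedBracket hD q)
  · rintro ⟨i, j⟩ hij hne
    rw [Finset.HasAntidiagonal.mem_antidiagonal] at hij
    simp only at hij
    by_cases hi : i < p.length + 1
    · rw [hord _ _ (by simpa using hi), LinearMap.zero_apply]
    · have hj : j < q.length := by
        rcases Nat.lt_or_ge j q.length with h | h
        · exact h
        · exact absurd (Prod.ext (by simp only; omega) (by simp only; omega)) hne
      rw [wordComm_cons_zero, LinearMap.zero_apply]
      change wordComm 1 (D j) q 1 = 0
      rw [hord _ _ hj, LinearMap.zero_apply]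
  · intro h
    exact absurd (Finset.HasAntidiagonal.mem_antidiagonal.2 (by simp only; omega)) h

end DerivedBracketTheorem

/-! ### Graded commutativity of the symmetric algebra and the embedding of `A` -/

section GSymBasic

variable {K A L : Type*} [Field K] [Ring A] [Algebra K A]
  [AddCommGroup L] [Module K L] [Module A L]
  {𝒜 : ℤ → Submodule K A} {ℒ : ℤ → Submodule K L}

namespace GSym

/-- Signs add up along a word, so commutation with generators suffices. `grading_comm` uses this
twice: with `x` a generator, and then with `x` a word. -/
theorem commute_words {d i : ℤ} {x y : GSym 𝒜 ℒ} (hy : IsWord 𝒜 ℒ d y)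
    (hxA : ∀ (j : ℤ) (a : A), a ∈ 𝒜 j → x * ofA 𝒜 ℒ a = sgn (i * j) • (ofA 𝒜 ℒ a * x))
    (hxL : ∀ (j : ℤ) (ξ : L), ξ ∈ ℒ j → x * ofL 𝒜 ℒ ξ = sgn (i * j) • (ofL 𝒜 ℒ ξ * x)) :
    x * y = sgn (i * d) • (y * x) := by
  induction hy with
  | one => simp [sgn_zero]
  | mulA ha hy ih =>
    rw [← mul_assoc, hxA _ _ ha, smul_mul_assoc, mul_assoc, ih, mul_smul_comm, sgn_smul_sgn_smul,
      mul_assoc, mul_add]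
  | mulL hξ hy ih =>
    rw [← mul_assoc, hxL _ _ hξ, smul_mul_assoc, mul_assoc, ih, mul_smul_comm, sgn_smul_sgn_smul,
      mul_assoc, mul_add]

theorem sgn_smul_comm_of {N : Type*} [Ring N] {m n : ℤ} {x y : N}
    (h : x * y = sgn (m * n) • (y * x)) : y * x = sgn (n * m) • (x * y) := by
  rw [h, mul_comm n m, sgn_smul_self]

theorem grading_comm (hA : GradedCommutative 𝒜) : GradedCommutative (grading 𝒜 ℒ) := by
  have hwA : ∀ {d e : ℤ} {x : GSym 𝒜 ℒ} {a : A}, IsWord 𝒜 ℒ d x → a ∈ 𝒜 e →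
      x * ofA 𝒜 ℒ a = sgn (d * e) • (ofA 𝒜 ℒ a * x) := fun hx ha =>
    sgn_smul_comm_of (commute_words hx
      (fun j b hb => by rw [← map_mul, hA _ _ _ _ ha hb, map_zsmul, map_mul])
      (fun j ξ hξ => ofA_mul_ofL 𝒜 ℒ ha hξ))
  have hwL : ∀ {d e : ℤ} {x : GSym 𝒜 ℒ} {ξ : L}, IsWord 𝒜 ℒ d x → ξ ∈ ℒ e →
      x * ofL 𝒜 ℒ ξ = sgn (d * e) • (ofL 𝒜 ℒ ξ * x) := fun hx hξ =>
    sgn_smul_comm_of (commute_words hx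
      (fun j b hb => sgn_smul_comm_of (ofA_mul_ofL 𝒜 ℒ hb hξ))
      (fun j η hη => ofL_mul_ofL 𝒜 ℒ hξ hη))
  intro i j x y hx hy
  induction hx using Submodule.span_induction with
  | zero => simp
  | add u v _ _ hu hv => rw [add_mul, mul_add, hu, hv, smul_add]
  | smul c u _ hu => rw [smul_mul_assoc, mul_smul_comm, hu, smul_comm]
  | mem u hu =>
    induction hy using Submodule.span_induction with
    | zero => simp
    | add v w _ _ hv hw => rw [add_mul, mul_add, hv, hw, smul_add]
    | smul c v _ hv => rw [smul_mul_assoc, mul_smul_comm, hv, smul_comm]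
    | mem v hv => exact commute_words hv (fun _ _ ha => hwA hu ha) (fun _ _ hξ => hwL hu hξ)

variable (𝒜 ℒ) in
-- Sending `L` to zero respects the defining relations and yields a retraction of the symmetric
-- algebra onto `A`.
theorem ofA_injective : Function.Injective (ofA 𝒜 ℒ) := by
  let r : GSym 𝒜 ℒ →ₐ[K] A := RingQuot.liftAlgHom K ⟨TensorAlgebra.lift K (LinearMap.fst K A L), by
    intro x y h
    induction h <;> simp⟩
  refine Function.LeftInverse.injective (g := r) fun a => ?_
  exact (RingQuot.liftAlgHom_mkAlgHom_apply K _ _ _).trans (by simp)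

end GSym

/-- A homogeneous element of `A`, in `S_A^• L`. -/
def Homog.toGSymA (ℒ : ℤ → Submodule K L) (a : Homog 𝒜) : Homog (GSym.grading 𝒜 ℒ) :=
  ⟨a.deg, GSym.ofA 𝒜 ℒ a.val, GSym.ofA_mem a.mem⟩

/-- A homogeneous element of `L`, in `S_A^• L`. -/
def Homog.toGSymL (𝒜 : ℤ → Submodule K A) (x : Homog ℒ) : Homog (GSym.grading 𝒜 ℒ) :=
  ⟨x.deg, GSym.ofL 𝒜 ℒ x.val, GSym.ofL_mem x.mem⟩

/-- A word in `L`, as a word in `S_A^• L`. -/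
def wordToGSym (𝒜 : ℤ → Submodule K A) (w : List (Homog ℒ)) : List (Homog (GSym.grading 𝒜 ℒ)) :=
  w.map (Homog.toGSymL 𝒜)

theorem wordDeg_wordToGSym (w : List (Homog ℒ)) :
    wordDeg Homog.deg (wordToGSym 𝒜 w) = wordDeg Homog.deg w := by
  simp [wordDeg, wordToGSym, Function.comp_def, Homog.toGSymL]

/-- The action of homogeneous elements of `A` on homogeneous elements of `L`. -/
def Homog.smul [SetLike.GradedSMul 𝒜 ℒ] (a : Homog 𝒜) (x : Homog ℒ) : Homog ℒ :=
  ⟨a.deg + x.deg, a.val • x.val, SetLike.GradedSMul.smul_mem a.mem x.mem⟩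

/-- An element of a homogeneous component, as a homogeneous element. -/
def Homog.of {M : Type*} [AddCommGroup M] [Module K M] {ℳ : ℤ → Submodule K M} {d : ℤ}
    (x : ℳ d) : Homog ℳ := ⟨d, x, x.2⟩

end GSymBasic

/-! ### Formal symbols of operators on the symmetric algebra -/

section Symbols

variable {K A L : Type*} [Field K] [Ring A] [Algebra K A]
  [AddCommGroup L] [Module K L] [Module A L]
  {𝒜 : ℤ → Submodule K A} {ℒ : ℤ → Submodule K L} [SetLike.GradedSMul 𝒜 ℒ]

/-- The identities satisfied by the values at a fixed element of the iterated commutators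
`f w = [⋯[D, ξ_1]⋯, ξ_n]` and `g w a = [[⋯[D, ξ_1]⋯, ξ_n], a]` of an operator `D` of degree `1`
whose commutators with two elements of `A` vanish, where `w = ξ_n, …, ξ_1`. -/
structure IsSymbol (f : List (Homog ℒ) → GSym 𝒜 ℒ) (g : List (Homog ℒ) → A →ₗ[K] GSym 𝒜 ℒ) :
    Prop where
  symm_left : WordSymmetric Homog.deg f
  symm_right : WordSymmetric Homog.deg g
  lin_left : ∀ (d : ℤ) (c : K) (x y : ℒ d) (w : List (Homog ℒ)),
    f (.of (c • x + y) :: w) = c • f (.of x :: w) + f (.of y :: w)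
  lin_right : ∀ (d : ℤ) (c : K) (x y : ℒ d) (w : List (Homog ℒ)),
    g (.of (c • x + y) :: w) = c • g (.of x :: w) + g (.of y :: w)
  -- For an operator `F`, this comes from `[F, aξ] = [F, a] ξ ± a [F, ξ]` on expanding `[F, a] ξ v`
  -- once more. In `smul_right` the corresponding extra terms are double commutators with elements
  -- of `A` and drop out.
  smul_left : ∀ (a : Homog 𝒜) (x : Homog ℒ) (w : List (Homog ℒ)),
    f (a.smul x :: w) =
      sgn (a.deg * (1 + wordDeg Homog.deg w)) • (GSym.ofA 𝒜 ℒ a.val * f (x :: w)) +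
      sgn (x.deg * (1 + wordDeg Homog.deg w + a.deg)) • (GSym.ofL 𝒜 ℒ x.val * g w a.val) +
      sgn (a.deg * x.deg) • g (x :: w) a.val
  smul_right : ∀ (a : Homog 𝒜) (x : Homog ℒ) (w : List (Homog ℒ)) (b : A),
    g (a.smul x :: w) b =
      sgn (a.deg * (1 + wordDeg Homog.deg w)) • (GSym.ofA 𝒜 ℒ a.val * g (x :: w) b)
  mul_right : ∀ (a b : Homog 𝒜) (w : List (Homog ℒ)),
    g w (a.val * b.val) =
      sgn (b.deg * (1 + wordDeg Homog.deg w + a.deg)) • (GSym.ofA 𝒜 ℒ b.val * g w a.val) +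
      sgn (a.deg * (1 + wordDeg Homog.deg w)) • (GSym.ofA 𝒜 ℒ a.val * g w b.val)

/-- A derivation kills the unit: `1 = 1 * 1` makes the value equal to twice itself. -/
theorem IsSymbol.one_right [SetLike.GradedOne 𝒜] {f : List (Homog ℒ) → GSym 𝒜 ℒ}
    {g : List (Homog ℒ) → A →ₗ[K] GSym 𝒜 ℒ} (h : IsSymbol f g) (w : List (Homog ℒ)) :
    g w 1 = 0 := by
  have h1 := h.mul_right ⟨0, 1, SetLike.GradedOne.one_mem⟩ ⟨0, 1, SetLike.GradedOne.one_mem⟩ w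
  simpa [sgn_zero] using h1

variable (𝒜 ℒ) in
/-- The space of all symbols. -/
def symbolSpace : Submodule K
    ((List (Homog ℒ) → GSym 𝒜 ℒ) × (List (Homog ℒ) → A →ₗ[K] GSym 𝒜 ℒ)) where
  carrier := {P | IsSymbol P.1 P.2}
  zero_mem' := by
    constructor
    · intro p x y w; simp
    · intro p x y w; simp
    all_goals intros; simp
  add_mem' := by
    rintro ⟨f, g⟩ ⟨f', g'⟩ h h'
    replace h : IsSymbol f g := h
    replace h' : IsSymbol f' g' := h'
    constructor
    · intro p x y w
      simp only [Prod.mk_add_mk, Pi.add_apply, h.symm_left p x y w, h'.symm_left p x y w, smul_add]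
    · intro p x y w
      simp only [Prod.mk_add_mk, Pi.add_apply, h.symm_right p x y w, h'.symm_right p x y w, smul_add]
    · intro d c x y w
      simp only [Prod.mk_add_mk, Pi.add_apply, h.lin_left, h'.lin_left, smul_add]
      abel
    · intro d c x y w
      simp only [Prod.mk_add_mk, Pi.add_apply, h.lin_right, h'.lin_right, smul_add]
      abel
    · intro a x w
      simp only [Prod.mk_add_mk, Pi.add_apply, h.smul_left, h'.smul_left, smul_add, mul_add,
        LinearMap.add_apply]
      abel
    · intro a x w b
      simp only [Prod.mk_add_mk, Pi.add_apply, h.smul_right, h'.smul_right, smul_add, mul_add,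
        LinearMap.add_apply]
    · intro a b w
      simp only [Prod.mk_add_mk, Pi.add_apply, h.mul_right, h'.mul_right, smul_add, mul_add,
        LinearMap.add_apply]
      abel
  smul_mem' := by
    rintro r ⟨f, g⟩ h
    replace h : IsSymbol f g := h
    constructor
    · intro p x y w
      simp only [Prod.smul_mk, Pi.smul_apply, h.symm_left p x y w]
      rw [smul_comm]
    · intro p x y w
      simp only [Prod.smul_mk, Pi.smul_apply, h.symm_right p x y w]
      rw [smul_comm]
    · intro d c x y w
      simp only [Prod.smul_mk, Pi.smul_apply, h.lin_left, smul_add]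
      rw [smul_comm r c]
    · intro d c x y w
      simp only [Prod.smul_mk, Pi.smul_apply, h.lin_right, smul_add]
      rw [smul_comm r c]
    · intro a x w
      simp only [Prod.smul_mk, Pi.smul_apply, h.smul_left, smul_add, mul_smul_comm,
        LinearMap.smul_apply, smul_comm r (sgn _)]
    · intro a x w b
      simp only [Prod.smul_mk, Pi.smul_apply, h.smul_right, mul_smul_comm,
        LinearMap.smul_apply, smul_comm r (sgn _)]
    · intro a b w
      simp only [Prod.smul_mk, Pi.smul_apply, h.mul_right, smul_add, mul_smul_comm,
        LinearMap.smul_apply, smul_comm r (sgn _)]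

variable [GradedAlgebra 𝒜]

/-- The symbol at `a v`, in terms of the symbol at `v`, for `a` in `A`. -/
def symbolMulA (a : Homog 𝒜)
    (P : (List (Homog ℒ) → GSym 𝒜 ℒ) × (List (Homog ℒ) → A →ₗ[K] GSym 𝒜 ℒ)) :
    (List (Homog ℒ) → GSym 𝒜 ℒ) × (List (Homog ℒ) → A →ₗ[K] GSym 𝒜 ℒ) :=
  (fun w => sgn (a.deg * (1 + wordDeg Homog.deg w)) • (GSym.ofA 𝒜 ℒ a.val * P.1 w) + P.2 w a.val,
    -- The commutator with `b` and the letters of `w` has degree `1 + |w| + |b|`, and the twist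
    -- supplies the part `|a||b|` of the sign. There is no second term because double commutators
    -- with elements of `A` vanish.
    fun w => sgn (a.deg * (1 + wordDeg Homog.deg w)) •
      (LinearMap.mulLeft K (GSym.ofA 𝒜 ℒ a.val) ∘ₗ P.2 w ∘ₗ signTwist 𝒜 a.deg))

/-- The symbol at `ξ v`, in terms of the symbol at `v`, for `ξ` in `L`. -/
def symbolMulL (x : Homog ℒ)
    (P : (List (Homog ℒ) → GSym 𝒜 ℒ) × (List (Homog ℒ) → A →ₗ[K] GSym 𝒜 ℒ)) :
    (List (Homog ℒ) → GSym 𝒜 ℒ) × (List (Homog ℒ) → A →ₗ[K] GSym 𝒜 ℒ) :=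
  (fun w => sgn (x.deg * (1 + wordDeg Homog.deg w)) • (GSym.ofL 𝒜 ℒ x.val * P.1 w) + P.1 (x :: w),
    -- The twist serves both terms. It completes the sign for passing `ξ` in the product, and it
    -- exchanges `ξ` with the element of `A` in the double commutator.
    fun w => (sgn (x.deg * (1 + wordDeg Homog.deg w)) •
      (LinearMap.mulLeft K (GSym.ofL 𝒜 ℒ x.val) ∘ₗ P.2 w) + P.2 (x :: w)) ∘ₗ signTwist 𝒜 x.deg)

theorem symbolMulA_fst (a : Homog 𝒜)
    (P : (List (Homog ℒ) → GSym 𝒜 ℒ) × (List (Homog ℒ) → A →ₗ[K] GSym 𝒜 ℒ))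
    (w : List (Homog ℒ)) : (symbolMulA a P).1 w =
      sgn (a.deg * (1 + wordDeg Homog.deg w)) • (GSym.ofA 𝒜 ℒ a.val * P.1 w) + P.2 w a.val := rfl

theorem symbolMulA_snd (a : Homog 𝒜)
    (P : (List (Homog ℒ) → GSym 𝒜 ℒ) × (List (Homog ℒ) → A →ₗ[K] GSym 𝒜 ℒ))
    (w : List (Homog ℒ)) (b : A) : (symbolMulA a P).2 w b =
      sgn (a.deg * (1 + wordDeg Homog.deg w)) •
        (GSym.ofA 𝒜 ℒ a.val * P.2 w (signTwist 𝒜 a.deg b)) := rfl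

theorem symbolMulL_fst (x : Homog ℒ)
    (P : (List (Homog ℒ) → GSym 𝒜 ℒ) × (List (Homog ℒ) → A →ₗ[K] GSym 𝒜 ℒ))
    (w : List (Homog ℒ)) : (symbolMulL x P).1 w =
      sgn (x.deg * (1 + wordDeg Homog.deg w)) • (GSym.ofL 𝒜 ℒ x.val * P.1 w) +
        P.1 (x :: w) := rfl

theorem symbolMulL_snd (x : Homog ℒ)
    (P : (List (Homog ℒ) → GSym 𝒜 ℒ) × (List (Homog ℒ) → A →ₗ[K] GSym 𝒜 ℒ))
    (w : List (Homog ℒ)) (b : A) : (symbolMulL x P).2 w b =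
      sgn (x.deg * (1 + wordDeg Homog.deg w)) •
        (GSym.ofL 𝒜 ℒ x.val * P.2 w (signTwist 𝒜 x.deg b)) +
        P.2 (x :: w) (signTwist 𝒜 x.deg b) := rfl

theorem signTwist_homog (n : ℤ) (b : Homog 𝒜) :
    signTwist 𝒜 n b.val = sgn (n * b.deg) • b.val := signTwist_of_mem 𝒜 n b.mem

theorem wordDeg_swap {α : Type*} (deg : α → ℤ) (p : List α) (x y : α) (w : List α) :
    wordDeg deg (p ++ x :: y :: w) = wordDeg deg (p ++ y :: x :: w) := by
  simp only [wordDeg_append, wordDeg_cons]; ring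

theorem ofA_mul_ofA_mul (hA : GradedCommutative 𝒜) (a b : Homog 𝒜) (v : GSym 𝒜 ℒ) :
    GSym.ofA 𝒜 ℒ a.val * (GSym.ofA 𝒜 ℒ b.val * v) =
      sgn (a.deg * b.deg) • (GSym.ofA 𝒜 ℒ b.val * (GSym.ofA 𝒜 ℒ a.val * v)) :=
  (a.toGSymA ℒ).mul_left_comm (GSym.grading_comm hA) (b.toGSymA ℒ) v

theorem ofA_mul_ofL_mul (a : Homog 𝒜) (x : Homog ℒ) (v : GSym 𝒜 ℒ) :
    GSym.ofA 𝒜 ℒ a.val * (GSym.ofL 𝒜 ℒ x.val * v) =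
      sgn (a.deg * x.deg) • (GSym.ofL 𝒜 ℒ x.val * (GSym.ofA 𝒜 ℒ a.val * v)) := by
  rw [← mul_assoc, GSym.ofA_mul_ofL 𝒜 ℒ a.mem x.mem, smul_mul_assoc, mul_assoc]

theorem ofL_mul_ofL_mul (x y : Homog ℒ) (v : GSym 𝒜 ℒ) :
    GSym.ofL 𝒜 ℒ x.val * (GSym.ofL 𝒜 ℒ y.val * v) =
      sgn (x.deg * y.deg) • (GSym.ofL 𝒜 ℒ y.val * (GSym.ofL 𝒜 ℒ x.val * v)) := by
  rw [← mul_assoc, GSym.ofL_mul_ofL 𝒜 ℒ x.mem y.mem, smul_mul_assoc, mul_assoc]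

/-- For the pair of an actual operator there would be nothing to prove. The pairs here are only
formal, so each identity is expanded, the factors are commuted into a common order, and the signs
are compared for all parities of the degrees. -/
theorem symbolMulA_isSymbol (hA : GradedCommutative 𝒜) (a : Homog 𝒜)
    {P : (List (Homog ℒ) → GSym 𝒜 ℒ) × (List (Homog ℒ) → A →ₗ[K] GSym 𝒜 ℒ)}
    (h : IsSymbol P.1 P.2) : IsSymbol (symbolMulA a P).1 (symbolMulA a P).2 where
  symm_left p x y w := by
    simp only [symbolMulA_fst, h.symm_left p x y w, h.symm_right p x y w, wordDeg_swap _ p x y w,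
      mul_smul_comm, smul_add, LinearMap.smul_apply]
    rw [smul_comm]
  symm_right p x y w := by
    ext b
    simp only [symbolMulA_snd, h.symm_right p x y w, wordDeg_swap _ p x y w,
      mul_smul_comm, LinearMap.smul_apply]
    rw [smul_comm]
  lin_left d c x y w := by
    simp only [symbolMulA_fst, h.lin_left, h.lin_right, wordDeg_cons, mul_smul_comm, smul_add,
      LinearMap.smul_apply, LinearMap.add_apply, mul_add, smul_comm c (sgn _)]
    simp only [Homog.of]
    abel
  lin_right d c x y w := by
    ext b
    simp only [symbolMulA_snd, h.lin_right, wordDeg_cons, mul_smul_comm, smul_add,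
      LinearMap.smul_apply, LinearMap.add_apply, mul_add, smul_comm c (sgn _)]
    simp only [Homog.of]
  smul_left b x w := by
    simp only [symbolMulA_fst, symbolMulA_snd, h.smul_left, h.smul_right, signTwist_homog,
      map_zsmul]
    have e1 := ofA_mul_ofA_mul hA a b (P.1 (x :: w))
    have e2 := ofA_mul_ofL_mul a x (P.2 w b.val)
    simp only [wordDeg_cons]
    change sgn (_ * (1 + (b.deg + x.deg + _))) • _ + _ = _
    by_cases ha : Even a.deg <;> by_cases hb : Even b.deg <;> by_cases hx : Even x.deg <;>
      by_cases hw : Even (wordDeg Homog.deg w) <;>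
      simp only [sgn_eq_ite, Int.even_add, Int.even_mul, ha, hb, hx, hw, if_true, if_false,
        one_smul, neg_smul, true_or, or_true, or_false, iff_true, Int.not_even_one, false_iff,
        iff_false, not_true, not_false_iff, mul_add, mul_neg, smul_neg] at e1 e2 ⊢ <;>
      simp only [e1, e2, neg_add_rev, neg_neg] <;> abel
  smul_right b x w c := by
    simp only [symbolMulA_snd, h.smul_right]
    have e1 := ofA_mul_ofA_mul hA a b (P.2 (x :: w) (signTwist 𝒜 a.deg c))
    simp only [mul_smul_comm, e1, sgn_smul_sgn_smul, wordDeg_cons]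
    congr 1
    apply sgn_congr
    change ((_ * (1 + (b.deg + x.deg + _)) + _ : ℤ) : ZMod 2) = _
    push_cast
    generalize (a.deg : ZMod 2) = a
    generalize (b.deg : ZMod 2) = b
    generalize (x.deg : ZMod 2) = c
    generalize (wordDeg Homog.deg w : ZMod 2) = d
    decide +revert
  mul_right b c w := by
    have hbc : signTwist 𝒜 a.deg (b.val * c.val) =
        sgn (a.deg * (b.deg + c.deg)) • (b.val * c.val) :=
      signTwist_of_mem 𝒜 _ (SetLike.mul_mem_graded b.mem c.mem)
    simp only [symbolMulA_snd, signTwist_homog, hbc, map_zsmul, h.mul_right]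
    have e1 := ofA_mul_ofA_mul hA a b (P.2 w c.val)
    have e2 := ofA_mul_ofA_mul hA a c (P.2 w b.val)
    by_cases ha : Even a.deg <;> by_cases hb : Even b.deg <;> by_cases hx : Even c.deg <;>
      by_cases hw : Even (wordDeg Homog.deg w) <;>
      simp only [sgn_eq_ite, Int.even_add, Int.even_mul, ha, hb, hx, hw, if_true, if_false,
        one_smul, neg_smul, true_or, or_true, or_false, iff_true, Int.not_even_one, false_iff,
        iff_false, not_true, not_false_iff, mul_add, mul_neg, smul_neg] at e1 e2 ⊢ <;>
      simp only [e1, e2, neg_add_rev, neg_neg] <;> abel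

theorem symbolMulL_isSymbol (x : Homog ℒ)
    {P : (List (Homog ℒ) → GSym 𝒜 ℒ) × (List (Homog ℒ) → A →ₗ[K] GSym 𝒜 ℒ)}
    (h : IsSymbol P.1 P.2) : IsSymbol (symbolMulL x P).1 (symbolMulL x P).2 where
  symm_left p y z w := by
    have h1 := h.symm_left (x :: p) y z w
    rw [List.cons_append, List.cons_append] at h1
    simp only [symbolMulL_fst, h.symm_left p y z w, h1, wordDeg_swap _ p y z w,
      mul_smul_comm, smul_add]
    rw [smul_comm]
  symm_right p y z w := by
    ext b
    have h1 := h.symm_right (x :: p) y z w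
    rw [List.cons_append, List.cons_append] at h1
    simp only [symbolMulL_snd, h.symm_right p y z w, h1, wordDeg_swap _ p y z w,
      mul_smul_comm, LinearMap.smul_apply, smul_add]
    rw [smul_comm]
  lin_left d c y z w := by
    simp only [symbolMulL_fst, h.lin_left, h.symm_left.swap x, wordDeg_cons, mul_smul_comm,
      smul_add, mul_add, smul_comm c (sgn _)]
    simp only [Homog.of]
    abel
  lin_right d c y z w := by
    ext b
    simp only [symbolMulL_snd, h.lin_right, h.symm_right.swap x, wordDeg_cons, mul_smul_comm,
      smul_add, LinearMap.smul_apply, LinearMap.add_apply, mul_add, smul_comm c (sgn _)]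
    simp only [Homog.of]
    abel
  smul_left b y w := by
    simp only [symbolMulL_fst, symbolMulL_snd, h.smul_left, h.smul_right, signTwist_homog,
      map_zsmul, h.symm_left.swap x, h.symm_right.swap x, LinearMap.smul_apply]
    have e1 := ofA_mul_ofL_mul b x (P.1 (y :: w))
    have e2 := ofL_mul_ofL_mul x y (P.2 w b.val)
    simp only [wordDeg_cons]
    change sgn (_ * (1 + (b.deg + y.deg + _))) • _ + sgn (x.deg * (b.deg + y.deg)) • _ = _
    by_cases ha : Even x.deg <;> by_cases hb : Even b.deg <;> by_cases hx : Even y.deg <;>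
      by_cases hw : Even (wordDeg Homog.deg w) <;>
      simp only [sgn_eq_ite, Int.even_add, Int.even_mul, ha, hb, hx, hw, if_true, if_false,
        one_smul, neg_smul, true_or, or_true, or_false, iff_true, Int.not_even_one, false_iff,
        iff_false, not_true, not_false_iff, mul_add, mul_neg, smul_neg] at e1 e2 ⊢ <;>
      simp only [e1, e2, neg_add_rev, neg_neg] <;> abel
  smul_right b y w c := by
    simp only [symbolMulL_snd, h.smul_right, h.symm_right.swap x, LinearMap.smul_apply]
    have e1 := ofA_mul_ofL_mul b x (P.2 (y :: w) (signTwist 𝒜 x.deg c))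
    simp only [wordDeg_cons]
    change sgn (_ * (1 + (b.deg + y.deg + _))) • _ + sgn (x.deg * (b.deg + y.deg)) • _ = _
    by_cases ha : Even x.deg <;> by_cases hb : Even b.deg <;> by_cases hx : Even y.deg <;>
      by_cases hw : Even (wordDeg Homog.deg w) <;>
      simp only [sgn_eq_ite, Int.even_add, Int.even_mul, ha, hb, hx, hw, if_true, if_false,
        one_smul, neg_smul, true_or, or_true, or_false, iff_true, Int.not_even_one, false_iff,
        iff_false, not_true, not_false_iff, mul_add, mul_neg, smul_neg] at e1 ⊢ <;>
      simp only [e1, neg_add_rev, neg_neg] <;> abel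
  mul_right b c w := by
    have hbc : signTwist 𝒜 x.deg (b.val * c.val) =
        sgn (x.deg * (b.deg + c.deg)) • (b.val * c.val) :=
      signTwist_of_mem 𝒜 _ (SetLike.mul_mem_graded b.mem c.mem)
    simp only [symbolMulL_snd, signTwist_homog, hbc, map_zsmul, h.mul_right]
    have e1 := ofA_mul_ofL_mul b x (P.2 w c.val)
    have e2 := ofA_mul_ofL_mul c x (P.2 w b.val)
    simp only [wordDeg_cons]
    by_cases ha : Even x.deg <;> by_cases hb : Even b.deg <;> by_cases hx : Even c.deg <;>
      by_cases hw : Even (wordDeg Homog.deg w) <;>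
      simp only [sgn_eq_ite, Int.even_add, Int.even_mul, ha, hb, hx, hw, if_true, if_false,
        one_smul, neg_smul, true_or, or_true, or_false, iff_true, Int.not_even_one, false_iff,
        iff_false, not_true, not_false_iff, mul_add, mul_neg, smul_neg] at e1 e2 ⊢ <;>
      simp only [e1, e2, neg_add_rev, neg_neg] <;> abel

end Symbols

/-! ### The action of the symmetric algebra on symbols -/

section SymbolAction

variable {K A L : Type*} [Field K] [Ring A] [Algebra K A]
  [AddCommGroup L] [Module K L] [Module A L]
  {𝒜 : ℤ → Submodule K A} {ℒ : ℤ → Submodule K L} [SetLike.GradedSMul 𝒜 ℒ] [GradedAlgebra 𝒜]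

theorem symbol_ext {P Q : symbolSpace 𝒜 ℒ} (h1 : ∀ w, P.1.1 w = Q.1.1 w)
    (h2 : ∀ w (b : Homog 𝒜), P.1.2 w b.val = Q.1.2 w b.val) : P = Q := by
  refine Subtype.ext (Prod.ext (funext h1) (funext fun w => ?_))
  exact linearMap_ext_of_homogeneous 𝒜 fun i x hx => h2 w ⟨i, x, hx⟩

/-- The action of a homogeneous element of `A` on symbols. -/
def symbolActA (hA : GradedCommutative 𝒜) (a : Homog 𝒜) :
    Module.End K (symbolSpace 𝒜 ℒ) where
  toFun P := ⟨symbolMulA a P.1, symbolMulA_isSymbol hA a P.2⟩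
  map_add' P Q := by
    refine symbol_ext (fun w => ?_) (fun w b => ?_)
    · change (symbolMulA a (P.1 + Q.1)).1 w = (symbolMulA a P.1).1 w + (symbolMulA a Q.1).1 w
      simp only [symbolMulA_fst, Prod.fst_add, Prod.snd_add, Pi.add_apply, LinearMap.add_apply,
        mul_add, smul_add]
      abel
    · change (symbolMulA a (P.1 + Q.1)).2 w b.val =
        (symbolMulA a P.1).2 w b.val + (symbolMulA a Q.1).2 w b.val
      simp only [symbolMulA_snd, Prod.fst_add, Prod.snd_add, Pi.add_apply, LinearMap.add_apply,
        mul_add, smul_add]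
  map_smul' c P := by
    refine symbol_ext (fun w => ?_) (fun w b => ?_)
    · change (symbolMulA a (c • P.1)).1 w = c • (symbolMulA a P.1).1 w
      simp only [symbolMulA_fst, Prod.smul_fst, Prod.smul_snd, Pi.smul_apply,
        LinearMap.smul_apply, mul_smul_comm, smul_add, smul_comm c (sgn _)]
    · change (symbolMulA a (c • P.1)).2 w b.val = c • (symbolMulA a P.1).2 w b.val
      simp only [symbolMulA_snd, Prod.smul_fst, Prod.smul_snd, Pi.smul_apply,
        LinearMap.smul_apply, mul_smul_comm, smul_comm c (sgn _)]

/-- The action of a homogeneous element of `L` on symbols. -/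
def symbolActL (x : Homog ℒ) : Module.End K (symbolSpace 𝒜 ℒ) where
  toFun P := ⟨symbolMulL x P.1, symbolMulL_isSymbol x P.2⟩
  map_add' P Q := by
    refine symbol_ext (fun w => ?_) (fun w b => ?_)
    · change (symbolMulL x (P.1 + Q.1)).1 w = (symbolMulL x P.1).1 w + (symbolMulL x Q.1).1 w
      simp only [symbolMulL_fst, Prod.fst_add, Prod.snd_add, Pi.add_apply, LinearMap.add_apply,
        mul_add, smul_add]
      abel
    · change (symbolMulL x (P.1 + Q.1)).2 w b.val =
        (symbolMulL x P.1).2 w b.val + (symbolMulL x Q.1).2 w b.val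
      simp only [symbolMulL_snd, Prod.fst_add, Prod.snd_add, Pi.add_apply, LinearMap.add_apply,
        mul_add, smul_add]
      abel
  map_smul' c P := by
    refine symbol_ext (fun w => ?_) (fun w b => ?_)
    · change (symbolMulL x (c • P.1)).1 w = c • (symbolMulL x P.1).1 w
      simp only [symbolMulL_fst, Prod.smul_fst, Prod.smul_snd, Pi.smul_apply,
        LinearMap.smul_apply, mul_smul_comm, smul_add, smul_comm c (sgn _)]
    · change (symbolMulL x (c • P.1)).2 w b.val = c • (symbolMulL x P.1).2 w b.val
      simp only [symbolMulL_snd, Prod.smul_fst, Prod.smul_snd, Pi.smul_apply,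
        LinearMap.smul_apply, mul_smul_comm, smul_add, smul_comm c (sgn _)]

/-- The action of `A` on symbols. -/
def symbolLinA (hA : GradedCommutative 𝒜) : A →ₗ[K] Module.End K (symbolSpace 𝒜 ℒ) :=
  (DirectSum.toModule K ℤ _ fun d =>
    { toFun := fun a : 𝒜 d => symbolActA hA (.of a)
      map_add' := fun a b => by
        refine LinearMap.ext fun P => symbol_ext (fun w => ?_) (fun w c => ?_)
        · change (symbolMulA _ P.1).1 w = (symbolMulA _ P.1).1 w + (symbolMulA _ P.1).1 w
          simp only [symbolMulA_fst, Homog.of, Submodule.coe_add, map_add, add_mul, smul_add]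
          abel
        · change (symbolMulA _ P.1).2 w c.val =
            (symbolMulA _ P.1).2 w c.val + (symbolMulA _ P.1).2 w c.val
          simp only [symbolMulA_snd, Homog.of, Submodule.coe_add, map_add, add_mul, smul_add]
      map_smul' := fun r a => by
        refine LinearMap.ext fun P => symbol_ext (fun w => ?_) (fun w c => ?_)
        · change (symbolMulA _ P.1).1 w = r • (symbolMulA _ P.1).1 w
          simp only [symbolMulA_fst, Homog.of, Submodule.coe_smul, map_smul, smul_mul_assoc,
            smul_add, smul_comm r (sgn _)]
        · change (symbolMulA _ P.1).2 w c.val = r • (symbolMulA _ P.1).2 w c.val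
          simp only [symbolMulA_snd, Homog.of, Submodule.coe_smul, map_smul, smul_mul_assoc,
            smul_comm r (sgn _)] }) ∘ₗ
    (DirectSum.decomposeLinearEquiv 𝒜).toLinearMap

theorem symbolLinA_apply (hA : GradedCommutative 𝒜) (a : Homog 𝒜) :
    symbolLinA (ℒ := ℒ) hA a.val = symbolActA hA a := by
  simp only [symbolLinA, LinearMap.comp_apply, LinearEquiv.coe_coe,
    DirectSum.decomposeLinearEquiv_apply, DirectSum.decompose_of_mem 𝒜 a.mem]
  erw [DirectSum.toModule_lof]
  rfl

variable [DirectSum.Decomposition ℒ]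

variable (𝒜 ℒ) in
/-- The action of `L` on symbols. -/
def symbolLinL : L →ₗ[K] Module.End K (symbolSpace 𝒜 ℒ) :=
  (DirectSum.toModule K ℤ _ fun d =>
    { toFun := fun x : ℒ d => symbolActL (.of x)
      map_add' := fun x y => by
        refine LinearMap.ext fun P => symbol_ext (fun w => ?_) (fun w c => ?_)
        · change (symbolMulL _ P.1).1 w = (symbolMulL _ P.1).1 w + (symbolMulL _ P.1).1 w
          -- The symbol at `ξ v` has a term in which `ξ` is a letter of the word. Linearity of the
          -- action in `ξ` therefore rests on the linearity fields of `IsSymbol`.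
          have h := P.2.lin_left d 1 x y w
          rw [one_smul, one_smul] at h
          simp only [symbolMulL_fst, h]
          simp only [Homog.of, Submodule.coe_add, map_add, add_mul, smul_add]
          abel
        · change (symbolMulL _ P.1).2 w c.val =
            (symbolMulL _ P.1).2 w c.val + (symbolMulL _ P.1).2 w c.val
          have h := P.2.lin_right d 1 x y w
          rw [one_smul, one_smul] at h
          simp only [symbolMulL_snd, h, LinearMap.add_apply]
          simp only [Homog.of, Submodule.coe_add, map_add, add_mul, smul_add]
          abel
      map_smul' := fun r x => by
        refine LinearMap.ext fun P => symbol_ext (fun w => ?_) (fun w c => ?_)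
        · change (symbolMulL _ P.1).1 w = r • (symbolMulL _ P.1).1 w
          -- The zero letter gives zero, as its value is twice itself. This isolates homogeneity
          -- from the combined linearity rule.
          have h0 := P.2.lin_left d 1 (0 : ℒ d) 0 w
          have h := P.2.lin_left d r x 0 w
          rw [one_smul, one_smul, add_zero, left_eq_add] at h0
          rw [add_zero, h0, add_zero] at h
          simp only [symbolMulL_fst, h]
          simp only [Homog.of, Submodule.coe_smul, map_smul, smul_mul_assoc,
            smul_add, smul_comm r (sgn _)]
        · change (symbolMulL _ P.1).2 w c.val = r • (symbolMulL _ P.1).2 w c.val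
          have h0 := P.2.lin_right d 1 (0 : ℒ d) 0 w
          have h := P.2.lin_right d r x 0 w
          rw [one_smul, one_smul, add_zero, left_eq_add] at h0
          rw [add_zero, h0, add_zero] at h
          simp only [symbolMulL_snd, h, LinearMap.smul_apply]
          simp only [Homog.of, Submodule.coe_smul, map_smul, smul_mul_assoc, smul_add,
            smul_comm r (sgn _)] }) ∘ₗ
    (DirectSum.decomposeLinearEquiv ℒ).toLinearMap

theorem symbolLinL_apply (x : Homog ℒ) : symbolLinL 𝒜 ℒ x.val = symbolActL x := by
  simp only [symbolLinL, LinearMap.comp_apply, LinearEquiv.coe_coe,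
    DirectSum.decomposeLinearEquiv_apply, DirectSum.decompose_of_mem ℒ x.mem]
  erw [DirectSum.toModule_lof]
  rfl

theorem symbolLinA_one (hA : GradedCommutative 𝒜) : symbolLinA (ℒ := ℒ) hA 1 = 1 := by
  have h := symbolLinA_apply (ℒ := ℒ) hA ⟨0, 1, SetLike.GradedOne.one_mem⟩
  refine h.trans (LinearMap.ext fun P => symbol_ext (fun w => ?_) (fun w c => ?_))
  · change (symbolMulA _ P.1).1 w = P.1.1 w
    simp only [symbolMulA_fst, zero_mul, sgn_zero, one_smul, map_one, one_mul, P.2.one_right,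
      add_zero]
  · change (symbolMulA _ P.1).2 w c.val = P.1.2 w c.val
    simp only [symbolMulA_snd, zero_mul, sgn_zero, one_smul, map_one, one_mul, signTwist_homog]

theorem symbolLinA_mul (hA : GradedCommutative 𝒜) (a b : A) :
    symbolLinA (ℒ := ℒ) hA (a * b) = symbolLinA hA a * symbolLinA hA b := by
  induction a using DirectSum.Decomposition.inductionOn 𝒜 with
  | zero => simp
  | add a a' ha ha' => rw [add_mul, map_add, map_add, ha, ha', add_mul]
  | homogeneous a =>
    induction b using DirectSum.Decomposition.inductionOn 𝒜 with
    | zero => simp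
    | add b b' hb hb' => rw [mul_add, map_add, map_add, hb, hb', mul_add]
    | homogeneous b =>
      let a' : Homog 𝒜 := .of a
      let b' : Homog 𝒜 := .of b
      change symbolLinA hA (a'.mul b').val = symbolLinA hA a'.val * symbolLinA hA b'.val
      rw [symbolLinA_apply, symbolLinA_apply, symbolLinA_apply]
      generalize a' = a
      generalize b' = b
      refine LinearMap.ext fun P => symbol_ext (fun w => ?_) (fun w c => ?_)
      · change (symbolMulA _ P.1).1 w = (symbolMulA a (symbolMulA b P.1)).1 w
        simp only [symbolMulA_fst, symbolMulA_snd]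
        change sgn ((a.deg + b.deg) * _) • (GSym.ofA 𝒜 ℒ (a.val * b.val) * _) +
          P.1.2 w (a.val * b.val) = _
        rw [P.2.mul_right, map_mul, mul_assoc, signTwist_homog]
        by_cases ha : Even a.deg <;> by_cases hb : Even b.deg <;>
          by_cases hw : Even (wordDeg Homog.deg w) <;>
          simp only [sgn_eq_ite, Int.even_add, Int.even_mul, ha, hb, hw, if_true, if_false,
            one_smul, neg_smul, true_or, or_true, or_false, iff_true, Int.not_even_one, false_iff,
            iff_false, not_true, not_false_iff, mul_add, mul_neg, smul_neg, map_neg] <;> abel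
      · change (symbolMulA _ P.1).2 w c.val = (symbolMulA a (symbolMulA b P.1)).2 w c.val
        simp only [symbolMulA_snd, signTwist_homog, map_zsmul, mul_smul_comm, sgn_smul_sgn_smul]
        change sgn ((a.deg + b.deg) * _ + (a.deg + b.deg) * _) •
          (GSym.ofA 𝒜 ℒ (a.val * b.val) * _) = _
        rw [map_mul, mul_assoc]
        congr 2
        ring

theorem symbolMulL_smul_fst (a : Homog 𝒜) (x : Homog ℒ)
    {P : (List (Homog ℒ) → GSym 𝒜 ℒ) × (List (Homog ℒ) → A →ₗ[K] GSym 𝒜 ℒ)}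
    (h : IsSymbol P.1 P.2) (w : List (Homog ℒ)) :
    (symbolMulL (a.smul x) P).1 w = (symbolMulA a (symbolMulL x P)).1 w := by
  have hd : (a.smul x).deg = a.deg + x.deg := rfl
  have hv : (a.smul x).val = a.val • x.val := rfl
  simp only [symbolMulA_fst, symbolMulL_fst, symbolMulL_snd, h.smul_left, GSym.ofL_smul, mul_assoc,
    signTwist_homog, hd, hv]
  by_cases ha : Even a.deg <;> by_cases hb : Even x.deg <;>
    by_cases hw : Even (wordDeg Homog.deg w) <;>
    simp only [sgn_eq_ite, Int.even_add, Int.even_mul, ha, hb, hw, if_true, if_false,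
      one_smul, neg_smul, true_or, or_true, or_false, iff_true, Int.not_even_one, false_iff,
      iff_false, not_true, not_false_iff, mul_add, mul_neg, smul_neg, map_neg] <;> abel

theorem symbolMulL_smul_snd (a : Homog 𝒜) (x : Homog ℒ)
    {P : (List (Homog ℒ) → GSym 𝒜 ℒ) × (List (Homog ℒ) → A →ₗ[K] GSym 𝒜 ℒ)}
    (h : IsSymbol P.1 P.2) (w : List (Homog ℒ)) (c : Homog 𝒜) :
    (symbolMulL (a.smul x) P).2 w c.val = (symbolMulA a (symbolMulL x P)).2 w c.val := by
  have hd : (a.smul x).deg = a.deg + x.deg := rfl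
  have hv : (a.smul x).val = a.val • x.val := rfl
  simp only [symbolMulA_snd, symbolMulL_snd, h.smul_right, GSym.ofL_smul, mul_assoc,
    signTwist_homog, hd, hv, map_zsmul]
  by_cases ha : Even a.deg <;> by_cases hb : Even x.deg <;> by_cases hc : Even c.deg <;>
    by_cases hw : Even (wordDeg Homog.deg w) <;>
    simp only [sgn_eq_ite, Int.even_add, Int.even_mul, ha, hb, hc, hw, if_true, if_false,
      one_smul, neg_smul, true_or, or_true, or_false, iff_true, Int.not_even_one, false_iff,
      iff_false, not_true, not_false_iff, mul_add, mul_neg, smul_neg, map_neg] <;> abel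

theorem symbolLinL_smul (hA : GradedCommutative 𝒜) (a : A) (ξ : L) :
    symbolLinL 𝒜 ℒ (a • ξ) = symbolLinA hA a * symbolLinL 𝒜 ℒ ξ := by
  induction a using DirectSum.Decomposition.inductionOn 𝒜 with
  | zero => simp
  | add a a' ha ha' => rw [add_smul, map_add, map_add, ha, ha', add_mul]
  | homogeneous a =>
    induction ξ using DirectSum.Decomposition.inductionOn ℒ with
    | zero => simp
    | add b b' hb hb' => rw [smul_add, map_add, map_add, hb, hb', mul_add]
    | homogeneous ξ =>
      have h := symbolLinL_apply (𝒜 := 𝒜) ((Homog.of a).smul (Homog.of ξ))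
      refine h.trans (Eq.trans ?_ (congrArg₂ (· * ·) (symbolLinA_apply hA (.of a))
        (symbolLinL_apply (.of ξ))).symm)
      exact LinearMap.ext fun P => symbol_ext (fun w => symbolMulL_smul_fst _ _ P.2 w)
        (fun w c => symbolMulL_smul_snd _ _ P.2 w c)

theorem symbolMulA_symbolMulL_fst (a : Homog 𝒜) (x : Homog ℒ)
    (P : (List (Homog ℒ) → GSym 𝒜 ℒ) × (List (Homog ℒ) → A →ₗ[K] GSym 𝒜 ℒ))
    (w : List (Homog ℒ)) :
    (symbolMulA a (symbolMulL x P)).1 w =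
      sgn (a.deg * x.deg) • (symbolMulL x (symbolMulA a P)).1 w := by
  simp only [symbolMulA_fst, symbolMulL_fst, symbolMulL_snd, signTwist_homog, wordDeg_cons]
  have e1 := ofA_mul_ofL_mul a x (P.1 w)
  by_cases ha : Even a.deg <;> by_cases hb : Even x.deg <;>
    by_cases hw : Even (wordDeg Homog.deg w) <;>
    simp only [sgn_eq_ite, Int.even_add, Int.even_mul, ha, hb, hw, if_true, if_false,
      one_smul, neg_smul, true_or, or_true, or_false, iff_true, Int.not_even_one, false_iff,
      iff_false, not_true, not_false_iff, mul_add, mul_neg, smul_neg, map_neg] at e1 ⊢ <;>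
    simp only [e1, neg_neg, neg_add_rev] <;> abel

theorem symbolMulA_symbolMulL_snd (a : Homog 𝒜) (x : Homog ℒ)
    (P : (List (Homog ℒ) → GSym 𝒜 ℒ) × (List (Homog ℒ) → A →ₗ[K] GSym 𝒜 ℒ))
    (w : List (Homog ℒ)) (c : Homog 𝒜) :
    (symbolMulA a (symbolMulL x P)).2 w c.val =
      sgn (a.deg * x.deg) • (symbolMulL x (symbolMulA a P)).2 w c.val := by
  simp only [symbolMulA_snd, symbolMulL_snd, signTwist_homog, wordDeg_cons, map_zsmul]
  have e1 := ofA_mul_ofL_mul a x (P.2 w c.val)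
  by_cases ha : Even a.deg <;> by_cases hb : Even x.deg <;> by_cases hc : Even c.deg <;>
    by_cases hw : Even (wordDeg Homog.deg w) <;>
    simp only [sgn_eq_ite, Int.even_add, Int.even_mul, ha, hb, hc, hw, if_true, if_false,
      one_smul, neg_smul, true_or, or_true, or_false, iff_true, Int.not_even_one, false_iff,
      iff_false, not_true, not_false_iff, mul_add, mul_neg, smul_neg, map_neg] at e1 ⊢ <;>
    simp only [e1, neg_neg, neg_add_rev] <;> abel

theorem symbolMulL_symbolMulL_fst (x y : Homog ℒ)
    {P : (List (Homog ℒ) → GSym 𝒜 ℒ) × (List (Homog ℒ) → A →ₗ[K] GSym 𝒜 ℒ)}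
    (h : IsSymbol P.1 P.2) (w : List (Homog ℒ)) :
    (symbolMulL x (symbolMulL y P)).1 w =
      sgn (x.deg * y.deg) • (symbolMulL y (symbolMulL x P)).1 w := by
  simp only [symbolMulL_fst, wordDeg_cons, h.symm_left.swap y x]
  have e1 := ofL_mul_ofL_mul x y (P.1 w)
  by_cases ha : Even x.deg <;> by_cases hb : Even y.deg <;>
    by_cases hw : Even (wordDeg Homog.deg w) <;>
    simp only [sgn_eq_ite, Int.even_add, Int.even_mul, ha, hb, hw, if_true, if_false,
      one_smul, neg_smul, true_or, or_true, or_false, iff_true, Int.not_even_one, false_iff,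
      iff_false, not_true, not_false_iff, mul_add, mul_neg, smul_neg, map_neg] at e1 ⊢ <;>
    simp only [e1, neg_neg, neg_add_rev] <;> abel

theorem symbolMulL_symbolMulL_snd (x y : Homog ℒ)
    {P : (List (Homog ℒ) → GSym 𝒜 ℒ) × (List (Homog ℒ) → A →ₗ[K] GSym 𝒜 ℒ)}
    (h : IsSymbol P.1 P.2) (w : List (Homog ℒ)) (c : Homog 𝒜) :
    (symbolMulL x (symbolMulL y P)).2 w c.val =
      sgn (x.deg * y.deg) • (symbolMulL y (symbolMulL x P)).2 w c.val := by
  simp only [symbolMulL_snd, signTwist_homog, wordDeg_cons, map_zsmul,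
    h.symm_right.swap y x, LinearMap.smul_apply]
  have e1 := ofL_mul_ofL_mul x y (P.2 w c.val)
  by_cases ha : Even x.deg <;> by_cases hb : Even y.deg <;> by_cases hc : Even c.deg <;>
    by_cases hw : Even (wordDeg Homog.deg w) <;>
    simp only [sgn_eq_ite, Int.even_add, Int.even_mul, ha, hb, hc, hw, if_true, if_false,
      one_smul, neg_smul, true_or, or_true, or_false, iff_true, Int.not_even_one, false_iff,
      iff_false, not_true, not_false_iff, mul_add, mul_neg, smul_neg, map_neg] at e1 ⊢ <;>
    simp only [e1, neg_neg, neg_add_rev] <;> abel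

/-- The action of the tensor algebra on symbols. -/
def symbolTensor (hA : GradedCommutative 𝒜) :
    TensorAlgebra K (A × L) →ₐ[K] Module.End K (symbolSpace 𝒜 ℒ) :=
  TensorAlgebra.lift K ((symbolLinA (ℒ := ℒ) hA).coprod (symbolLinL 𝒜 ℒ))

theorem symbolTensor_left (hA : GradedCommutative 𝒜) (a : A) :
    symbolTensor (ℒ := ℒ) hA (TensorAlgebra.ι K (a, 0)) = symbolLinA hA a := by
  rw [symbolTensor, TensorAlgebra.lift_ι_apply, LinearMap.coprod_apply,
    LinearMap.map_zero (symbolLinL 𝒜 ℒ), add_zero]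

theorem symbolTensor_right (hA : GradedCommutative 𝒜) (ξ : L) :
    symbolTensor (ℒ := ℒ) hA (TensorAlgebra.ι K (0, ξ)) = symbolLinL 𝒜 ℒ ξ := by
  rw [symbolTensor, TensorAlgebra.lift_ι_apply, LinearMap.coprod_apply,
    LinearMap.map_zero (symbolLinA hA), zero_add]

theorem symbolTensor_mul (hA : GradedCommutative 𝒜) (x y : TensorAlgebra K (A × L)) :
    symbolTensor (ℒ := ℒ) hA (x * y) = symbolTensor hA x * symbolTensor hA y :=
  (symbolTensor (ℒ := ℒ) hA).map_mul' x y

theorem symbolTensor_smul (hA : GradedCommutative 𝒜) (c : K) (x : TensorAlgebra K (A × L)) :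
    symbolTensor (ℒ := ℒ) hA (c • x) = c • symbolTensor hA x :=
  (symbolTensor (ℒ := ℒ) hA).toLinearMap.map_smul c x

/-- Each relation is matched by an identity of symbols: the unit by vanishing of `g` at `1`,
products in `A` by the Leibniz rule, scalars on `L` by the two rules for `aξ`, and commutation in
`L` by graded symmetry. Commutation of `A` with `L` is built into the formulas for the action. -/
theorem symbolTensor_rel (hA : GradedCommutative 𝒜) {x y : TensorAlgebra K (A × L)}
    (h : GSymRel 𝒜 ℒ x y) : symbolTensor (ℒ := ℒ) hA x = symbolTensor hA y := by
  induction h with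
  | one => rw [symbolTensor_left, symbolLinA_one]; exact (map_one (symbolTensor hA)).symm
  | mul a b =>
    rw [symbolTensor_mul, symbolTensor_left, symbolTensor_left, symbolTensor_left, symbolLinA_mul]
  | smul a ξ =>
    rw [symbolTensor_mul, symbolTensor_left, symbolTensor_right, symbolTensor_right, symbolLinL_smul hA]
  | comm_left i j a ξ ha hξ =>
    rw [symbolTensor_mul, symbolTensor_smul, symbolTensor_mul, symbolTensor_left, symbolTensor_right, symbolLinA_apply hA ⟨i, a, ha⟩,
      symbolLinL_apply ⟨j, ξ, hξ⟩]
    refine LinearMap.ext fun P => symbol_ext (fun w => ?_) (fun w c => ?_)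
    · exact (symbolMulA_symbolMulL_fst _ _ _ _).trans (Int.cast_smul_eq_zsmul K _ _).symm
    · exact (symbolMulA_symbolMulL_snd _ _ _ _ _).trans (Int.cast_smul_eq_zsmul K _ _).symm
  | comm i j ξ η hξ hη =>
    rw [symbolTensor_mul, symbolTensor_smul, symbolTensor_mul, symbolTensor_right, symbolTensor_right, symbolLinL_apply ⟨i, ξ, hξ⟩,
      symbolLinL_apply ⟨j, η, hη⟩]
    refine LinearMap.ext fun P => symbol_ext (fun w => ?_) (fun w c => ?_)
    · exact (symbolMulL_symbolMulL_fst _ _ P.2 _).trans (Int.cast_smul_eq_zsmul K _ _).symm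
    · exact (symbolMulL_symbolMulL_snd _ _ P.2 _ _).trans (Int.cast_smul_eq_zsmul K _ _).symm

/-- The action of `S_A^• L` on symbols. -/
def symbolAct (hA : GradedCommutative 𝒜) : GSym 𝒜 ℒ →ₐ[K] Module.End K (symbolSpace 𝒜 ℒ) :=
  RingQuot.liftAlgHom K ⟨symbolTensor hA, fun _ _ h => symbolTensor_rel hA h⟩

theorem symbolAct_ofA (hA : GradedCommutative 𝒜) (a : Homog 𝒜) :
    symbolAct hA (GSym.ofA 𝒜 ℒ a.val) = symbolActA hA a :=
  (RingQuot.liftAlgHom_mkAlgHom_apply K _ _ _).trans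
    ((symbolTensor_left hA a.val).trans (symbolLinA_apply hA a))

theorem symbolAct_ofL (hA : GradedCommutative 𝒜) (x : Homog ℒ) :
    symbolAct hA (GSym.ofL 𝒜 ℒ x.val) = symbolActL x :=
  (RingQuot.liftAlgHom_mkAlgHom_apply K _ _ _).trans
    ((symbolTensor_right hA x.val).trans (symbolLinL_apply x))

end SymbolAction

/-! ### Linearity and symmetry of evaluation on words -/

section EvalMulti

variable {K M N : Type*} [Field K] [AddCommGroup M] [Module K M] [AddCommGroup N] [Module K N]
  {ℳ : ℤ → Submodule K M}

theorem evalMulti_lin (X : ∀ k : ℕ, MultilinearMap K (fun _ : Fin k => M) N) {d : ℤ} (c : K)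
    (x y : ℳ d) (w : List (Homog ℳ)) :
    evalMulti X (.of (c • x + y) :: w) =
      c • evalMulti X (.of x :: w) + evalMulti X (.of y :: w) := by
  have h : ∀ z : Homog ℳ, evalMulti X (z :: w) =
      (X (w.length + 1)).curryRight (fun i => (letters w i).val) z.val := fun z =>
    evalMulti_cons X z w
  rw [h, h, h, ← map_smul, ← map_add]
  rfl

theorem wordSymmetric_ite {α N : Type*} [AddCommGroup N] {deg : α → ℤ} {f : List α → N}
    (hf : WordSymmetric deg f) (P : ℕ → Prop) [DecidablePred P] :
    WordSymmetric deg (fun w => if P w.length then f w else 0) := by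
  intro p x y w
  have h : (p ++ x :: y :: w).length = (p ++ y :: x :: w).length := by simp
  simp only [h]
  split_ifs
  · exact hf p x y w
  · rw [smul_zero]

theorem shuffleSum_apply {α : Type*} (deg : α → ℤ) (w : List α)
    (F : List α → List α → M →ₗ[K] N) (m : M) :
    shuffleSum deg w F m = shuffleSum deg w (fun p q => F p q m) :=
  map_shuffleSum deg (LinearMap.applyₗ (R := K) m : (M →ₗ[K] N) →ₗ[K] N) w F

theorem WordSymmetric.map {α N N' F : Type*} [AddCommGroup N] [AddCommGroup N'] [FunLike F N N']
    [AddMonoidHomClass F N N'] {deg : α → ℤ} {f : List α → N} (hf : WordSymmetric deg f) (φ : F) :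
    WordSymmetric deg (fun w => φ (f w)) := fun p x y w => by
  simp only [hf p x y w, map_zsmul]

end EvalMulti

/-! ### The axioms of brackets, anchors and connection on words -/

section Axioms

variable {K A L : Type*} [Field K] [Ring A] [Algebra K A]
  [AddCommGroup L] [Module K L] [Module A L]
  {𝒜 : ℤ → Submodule K A} {ℒ : ℤ → Submodule K L} [SetLike.GradedSMul 𝒜 ℒ]
  (X : LRInfinity 𝒜 ℒ)

theorem LRInfinity.evalMulti_bracket_smul (a : Homog 𝒜) (x : Homog ℒ) (w : List (Homog ℒ)) :
    evalMulti X.bracket (a.smul x :: w) = evalMulti X.anchor w a.val • x.val +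
      sgn ((1 + wordDeg Homog.deg w) * a.deg) • (a.val • evalMulti X.bracket (x :: w)) := by
  have h := X.bracket_smul w.length _ _ (fun i => (letters w i).mem) a.deg a.val a.mem x.val
  rw [sum_letters] at h
  rw [evalMulti_cons, evalMulti_cons]
  exact h

theorem update_snoc_last {M : Type*} {n : ℕ} (u : Fin n → M) (x y : M) :
    Function.update (Fin.snoc u x : Fin (n + 1) → M) (Fin.last n) y = Fin.snoc u y :=
  Fin.update_snoc_last (α := fun _ => M) x u y

theorem Ici_fin_last (n : ℕ) : Finset.Ici (Fin.last n) = {Fin.last n} := by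
  ext i; simp [Fin.last_le_iff]

theorem snoc_mem {M : Type*} [AddCommGroup M] [Module K M] {ℳ : ℤ → Submodule K M} {n : ℕ}
    (v : Fin n → Homog ℳ) (x : Homog ℳ) (i : Fin (n + 1)) :
    (Fin.snoc (fun i => (v i).val) x.val : Fin (n + 1) → M) i ∈
      ℳ ((Fin.snoc (fun i => (v i).deg) x.deg : Fin (n + 1) → ℤ) i) := by
  refine Fin.lastCases ?_ (fun j => ?_) i
  · rw [Fin.snoc_last, Fin.snoc_last]; exact x.mem
  · rw [Fin.snoc_castSucc, Fin.snoc_castSucc]; exact (v j).mem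

theorem LRInfinity.evalMulti_anchor_smul (a : Homog 𝒜) (x : Homog ℒ) (w : List (Homog ℒ)) (b : A) :
    evalMulti X.anchor (a.smul x :: w) b =
      sgn ((1 + wordDeg Homog.deg w) * a.deg) • (a.val * evalMulti X.anchor (x :: w) b) := by
  have h := X.anchor_smul (w.length + 1) _ _ (snoc_mem (letters w) x) (Fin.last _) a.deg a.val
    a.mem b
  rw [update_snoc_last, Fin.snoc_last, Fin.Iio_last_eq_map, Finset.sum_map] at h
  simp only [Fin.coe_castSuccEmb, Fin.snoc_castSucc] at h
  rw [sum_letters] at h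
  rw [evalMulti_cons, evalMulti_cons]
  exact h

theorem LRInfinity.evalMulti_anchor_mul (w : List (Homog ℒ)) (a : Homog 𝒜) (b : A) :
    evalMulti X.anchor w (a.val * b) = evalMulti X.anchor w a.val * b +
      sgn ((1 + wordDeg Homog.deg w) * a.deg) • (a.val * evalMulti X.anchor w b) := by
  have h := X.anchor_mul w.length _ _ (fun i => (letters w i).mem) a.deg a.val a.mem b
  rw [sum_letters] at h
  exact h

theorem LRInfinity.evalMulti_anchor_mem (w : List (Homog ℒ)) (a : Homog 𝒜) :
    evalMulti X.anchor w a.val ∈ 𝒜 (1 + wordDeg Homog.deg w + a.deg) := by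
  have h := X.anchor_mem w.length _ _ (fun i => (letters w i).mem) a.deg a.val a.mem
  rw [sum_letters] at h
  exact h

variable {X} (Δ : RightConnection X 𝒜)

theorem RightConnection.evalMulti_form_mem (w : List (Homog ℒ)) (a : Homog 𝒜) :
    evalMulti Δ.form w a.val ∈ 𝒜 (1 + wordDeg Homog.deg w + a.deg) := by
  have h := Δ.form_mem w.length _ _ (fun i => (letters w i).mem) a.deg a.val a.mem
  rw [sum_letters] at h
  exact h

theorem RightConnection.evalMulti_form_leibniz (w : List (Homog ℒ)) (a : Homog 𝒜) (q : A) :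
    evalMulti Δ.form w (a.val * q) =
      sgn ((1 + wordDeg Homog.deg w) * a.deg) • (a.val * evalMulti Δ.form w q) -
        evalMulti X.anchor w a.val * q := by
  have h := Δ.form_leibniz w.length _ _ (fun i => (letters w i).mem) a.deg a.val a.mem q
  rw [sum_letters] at h
  exact h

theorem RightConnection.evalMulti_form_smul (a : Homog 𝒜) (x : Homog ℒ) (w : List (Homog ℒ))
    (q : A) :
    evalMulti Δ.form (a.smul x :: w) q =
      sgn (a.deg * x.deg) • evalMulti Δ.form (x :: w) (a.val * q) := by
  have h := Δ.form_smul (w.length + 1) _ _ (snoc_mem (letters w) x) (Fin.last _) a.deg a.val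
    a.mem q
  rw [update_snoc_last, Fin.snoc_last, Ici_fin_last, Finset.sum_singleton,
    Fin.snoc_last] at h
  rw [evalMulti_cons, evalMulti_cons]
  exact h

theorem LRInfinity.shuffleSum_bracket (w : List (Homog ℒ)) :
    shuffleSum Homog.deg w (fun p q => sgn (wordDeg Homog.deg p) •
      evalMulti X.bracket (bracketWord X.bracket X.bracket_mem q :: p)) = 0 := by
  have h := sum_cons_eq_shuffleSum X.bracket_mem X.bracket_symm (letters w)
  rw [word_letters] at h
  rw [← h]
  exact X.bracket_jacobi _ _ _ (fun i => (letters w i).mem)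

theorem LRInfinity.shuffleSum_anchor (w : List (Homog ℒ)) (a : A) :
    shuffleSum Homog.deg w (fun p q => sgn (wordDeg Homog.deg p) •
      (evalMulti X.anchor p (evalMulti X.anchor q a) +
        evalMulti X.anchor (bracketWord X.bracket X.bracket_mem q :: p) a)) = 0 := by
  have h := sum_cons_eq_shuffleSum X.bracket_mem X.anchor_symm (letters w)
  have h' := sum_sgn_eq_shuffleSum (letters w)
    (fun p q => evalMulti X.anchor p (evalMulti X.anchor q a))
  have h2 := X.anchor_jacobi w.length _ _ (fun i => (letters w i).mem) a
  rw [word_letters] at h h'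
  simp only [smul_add, shuffleSum_add]
  rw [← h', ← h2]
  congr 1
  · refine Finset.sum_congr rfl fun s _ => ?_
    rw [evalMulti_word, evalMulti_word]
    rfl
  · have h3 := congrArg (fun φ : A →ₗ[K] A => φ a) h
    simp only [LinearMap.sum_apply, LinearMap.smul_apply] at h3
    refine Eq.trans ?_ h3.symm
    rw [shuffleSum_apply]
    rfl

theorem RightConnection.IsFlat.shuffleSum_form (hΔ : Δ.IsFlat) (w : List (Homog ℒ)) (a : A) :
    shuffleSum Homog.deg w (fun p q => sgn (wordDeg Homog.deg p) •
      (evalMulti Δ.form (bracketWord X.bracket X.bracket_mem q :: p) a -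
        evalMulti Δ.form p (evalMulti Δ.form q a))) = 0 := by
  have h := sum_cons_eq_shuffleSum X.bracket_mem Δ.form_symm (letters w)
  have h' := sum_sgn_eq_shuffleSum (letters w)
    (fun p q => evalMulti Δ.form p (evalMulti Δ.form q a))
  have h2 := hΔ w.length _ _ (fun i => (letters w i).mem) a
  rw [word_letters] at h h'
  simp only [smul_sub, shuffleSum_sub]
  rw [← h', ← h2]
  congr 1
  · have h3 := congrArg (fun φ : A →ₗ[K] A => φ a) h
    simp only [LinearMap.sum_apply, LinearMap.smul_apply] at h3
    refine Eq.trans ?_ h3.symm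
    rw [shuffleSum_apply]
    rfl
  · refine Finset.sum_congr rfl fun s _ => ?_
    rw [evalMulti_word, evalMulti_word]
    rfl

end Axioms

/-! ### Operators with a prescribed symbol, their degree and order -/

section SymbolOperators

variable {K A L : Type*} [Field K] [Ring A] [Algebra K A]
  [AddCommGroup L] [Module K L] [Module A L]
  {𝒜 : ℤ → Submodule K A} {ℒ : ℤ → Submodule K L} [SetLike.GradedSMul 𝒜 ℒ] [GradedAlgebra 𝒜]
  [DirectSum.Decomposition ℒ]

/-- The operator with a given symbol at `1`. -/
def symbolOp (hA : GradedCommutative 𝒜) (S : symbolSpace 𝒜 ℒ) : GSym 𝒜 ℒ →ₗ[K] GSym 𝒜 ℒ :=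
  (LinearMap.proj [] ∘ₗ LinearMap.fst K _ _ ∘ₗ (symbolSpace 𝒜 ℒ).subtype) ∘ₗ
    (LinearMap.applyₗ S) ∘ₗ (symbolAct hA).toLinearMap

theorem symbolAct_one (hA : GradedCommutative 𝒜) (S : symbolSpace 𝒜 ℒ) :
    symbolAct hA 1 S = S :=
  LinearMap.congr_fun (map_one (symbolAct hA)) S

theorem symbolAct_ofA_mul (hA : GradedCommutative 𝒜) (S : symbolSpace 𝒜 ℒ) (a : Homog 𝒜)
    (v : GSym 𝒜 ℒ) : symbolAct hA (GSym.ofA 𝒜 ℒ a.val * v) S =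
      symbolActA hA a (symbolAct hA v S) := by
  rw [← symbolAct_ofA hA a]
  exact LinearMap.congr_fun ((symbolAct hA).map_mul' _ v) S

theorem symbolAct_ofL_mul (hA : GradedCommutative 𝒜) (S : symbolSpace 𝒜 ℒ) (x : Homog ℒ)
    (v : GSym 𝒜 ℒ) : symbolAct hA (GSym.ofL 𝒜 ℒ x.val * v) S =
      symbolActL x (symbolAct hA v S) := by
  rw [← symbolAct_ofL hA x]
  exact LinearMap.congr_fun ((symbolAct hA).map_mul' _ v) S

/-- The action of `ξ` on symbols was designed as `F (ξ v) = ± ξ F v + [F, ξ] v`, so forming a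
commutator removes the first term and leaves the entry of the longer word. The formal symbol at `v`
is thus the true symbol of the operator. -/
theorem wordComm_symbolOp (hA : GradedCommutative 𝒜) (S : symbolSpace 𝒜 ℒ) (w : List (Homog ℒ))
    (v : GSym 𝒜 ℒ) :
    wordComm 1 (symbolOp hA S) (wordToGSym 𝒜 w) v = (symbolAct hA v S).1.1 w := by
  induction w generalizing v with
  | nil => rfl
  | cons x w ih =>
    change wordComm 1 (symbolOp hA S) (x.toGSymL 𝒜 :: wordToGSym 𝒜 w) v = _
    rw [wordComm_cons_apply, ih, ih, wordDeg_wordToGSym]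
    have h := congrArg (fun P : symbolSpace 𝒜 ℒ => P.1.1 w) (symbolAct_ofL_mul hA S x v)
    refine (congrArg (· - _) h).trans ?_
    change (symbolMulL x (symbolAct hA v S).1).1 w - _ = _
    rw [symbolMulL_fst, mul_comm x.deg]
    exact add_sub_cancel_left _ _

theorem wordComm_symbolOp_cons (hA : GradedCommutative 𝒜) (S : symbolSpace 𝒜 ℒ) (a : Homog 𝒜)
    (w : List (Homog ℒ)) (v : GSym 𝒜 ℒ) :
    wordComm 1 (symbolOp hA S) (a.toGSymA ℒ :: wordToGSym 𝒜 w) v =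
      (symbolAct hA v S).1.2 w a.val := by
  rw [wordComm_cons_apply, wordComm_symbolOp, wordComm_symbolOp, wordDeg_wordToGSym]
  have h := congrArg (fun P : symbolSpace 𝒜 ℒ => P.1.1 w) (symbolAct_ofA_mul hA S a v)
  refine (congrArg (· - _) h).trans ?_
  change (symbolMulA a (symbolAct hA v S).1).1 w - _ = _
  rw [symbolMulA_fst, mul_comm a.deg]
  exact add_sub_cancel_left _ _

/-- Multiplying `v` by `b` merely multiplies the second entry of the symbol by `b`, up to sign; the
commutator with `b` subtracts exactly this. -/
theorem wordComm_symbolOp_cons_cons (hA : GradedCommutative 𝒜) (S : symbolSpace 𝒜 ℒ)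
    (a b : Homog 𝒜) (w : List (Homog ℒ)) :
    wordComm 1 (symbolOp hA S) (b.toGSymA ℒ :: a.toGSymA ℒ :: wordToGSym 𝒜 w) = 0 := by
  ext v
  rw [wordComm_cons_apply, wordComm_symbolOp_cons, wordComm_symbolOp_cons, LinearMap.zero_apply,
    sub_eq_zero]
  have h := congrArg (fun P : symbolSpace 𝒜 ℒ => P.1.2 w a.val) (symbolAct_ofA_mul hA S b v)
  refine h.trans ?_
  change (symbolMulA b (symbolAct hA v S).1).2 w a.val = _
  rw [symbolMulA_snd, signTwist_homog, map_zsmul, mul_smul_comm, sgn_smul_sgn_smul,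
    wordDeg_cons, wordDeg_wordToGSym]
  congr 2
  change _ = (1 + (a.deg + _)) * b.deg
  ring

/-- A symbol of an operator of degree `1`. -/
def IsSymbolOfDegree (d : ℤ) (P : symbolSpace 𝒜 ℒ) : Prop :=
  (∀ w, P.1.1 w ∈ GSym.grading 𝒜 ℒ (1 + wordDeg Homog.deg w + d)) ∧
    ∀ w (a : Homog 𝒜), P.1.2 w a.val ∈ GSym.grading 𝒜 ℒ (1 + wordDeg Homog.deg w + a.deg + d)

theorem symbolAct_degree (hA : GradedCommutative 𝒜) {S : symbolSpace 𝒜 ℒ}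
    (hS : IsSymbolOfDegree 0 S) {d : ℤ} {v : GSym 𝒜 ℒ} (hv : GSym.IsWord 𝒜 ℒ d v) :
    IsSymbolOfDegree d (symbolAct hA v S) := by
  induction hv with
  | one => rwa [symbolAct_one]
  | @mulA i d a v ha hv ih =>
    rw [symbolAct_ofA_mul hA S ⟨i, a, ha⟩]
    refine ⟨fun w => ?_, fun w b => ?_⟩
    · change (symbolMulA _ _).1 w ∈ _
      rw [symbolMulA_fst]
      refine add_mem (zsmul_mem ?_ _) ?_
      · have := SetLike.mul_mem_graded (GSym.ofA_mem (ℒ := ℒ) ha) (ih.1 w)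
        rwa [show i + (1 + wordDeg Homog.deg w + d) = 1 + wordDeg Homog.deg w + (i + d) by ring]
          at this
      · have := ih.2 w ⟨i, a, ha⟩
        rwa [add_assoc] at this
    · change (symbolMulA _ _).2 w b.val ∈ _
      rw [symbolMulA_snd, signTwist_homog, map_zsmul]
      refine zsmul_mem ?_ _
      rw [mul_smul_comm]
      refine zsmul_mem ?_ _
      have := SetLike.mul_mem_graded (GSym.ofA_mem (ℒ := ℒ) ha) (ih.2 w b)
      rwa [show i + (1 + wordDeg Homog.deg w + b.deg + d) =
        1 + wordDeg Homog.deg w + b.deg + (i + d) by ring] at this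
  | @mulL i d ξ v hξ hv ih =>
    rw [symbolAct_ofL_mul hA S ⟨i, ξ, hξ⟩]
    refine ⟨fun w => ?_, fun w b => ?_⟩
    · change (symbolMulL _ _).1 w ∈ _
      rw [symbolMulL_fst]
      refine add_mem (zsmul_mem ?_ _) ?_
      · have := SetLike.mul_mem_graded (GSym.ofL_mem (𝒜 := 𝒜) hξ) (ih.1 w)
        rwa [show i + (1 + wordDeg Homog.deg w + d) = 1 + wordDeg Homog.deg w + (i + d) by ring]
          at this
      · have := ih.1 (⟨i, ξ, hξ⟩ :: w)
        rw [wordDeg_cons] at this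
        rwa [show 1 + (i + wordDeg Homog.deg w) + d = 1 + wordDeg Homog.deg w + (i + d) by ring]
          at this
    · change (symbolMulL _ _).2 w b.val ∈ _
      rw [symbolMulL_snd, signTwist_homog, map_zsmul, map_zsmul, mul_smul_comm]
      refine add_mem (zsmul_mem (zsmul_mem ?_ _) _) (zsmul_mem ?_ _)
      · have := SetLike.mul_mem_graded (GSym.ofL_mem (𝒜 := 𝒜) hξ) (ih.2 w b)
        rwa [show i + (1 + wordDeg Homog.deg w + b.deg + d) =
          1 + wordDeg Homog.deg w + b.deg + (i + d) by ring] at this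
      · have := ih.2 (⟨i, ξ, hξ⟩ :: w) b
        rw [wordDeg_cons] at this
        rwa [show 1 + (i + wordDeg Homog.deg w) + b.deg + d =
          1 + wordDeg Homog.deg w + b.deg + (i + d) by ring] at this

theorem symbolOp_hasDegree (hA : GradedCommutative 𝒜) {S : symbolSpace 𝒜 ℒ}
    (hS : IsSymbolOfDegree 0 S) : HasDegree (GSym.grading 𝒜 ℒ) 1 (symbolOp hA S) := by
  intro d v hv
  induction hv using Submodule.span_induction with
  | zero => rw [map_zero]; exact zero_mem _
  | add u v _ _ hu hv => rw [map_add]; exact add_mem hu hv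
  | smul c u _ hu => rw [map_smul]; exact Submodule.smul_mem _ c hu
  | mem v hv =>
    have h := (symbolAct_degree hA hS hv).1 []
    rwa [wordDeg_nil, add_zero] at h

/-- The order of a symbol. -/
def IsSymbolOfOrder (k : ℕ) (P : symbolSpace 𝒜 ℒ) : Prop :=
  (∀ w, k < w.length → P.1.1 w = 0) ∧ ∀ w, k ≤ w.length → P.1.2 w = 0

/-- A generator changes the entries at a word only through entries at the same word or with one
commutator more. An element of `A` counts as one commutator, whence the two different bounds on the
length. -/
theorem symbolAct_order (hA : GradedCommutative 𝒜) {k : ℕ} {S : symbolSpace 𝒜 ℒ}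
    (hS : IsSymbolOfOrder k S) {d : ℤ} {v : GSym 𝒜 ℒ} (hv : GSym.IsWord 𝒜 ℒ d v) :
    IsSymbolOfOrder k (symbolAct hA v S) := by
  induction hv with
  | one => rwa [symbolAct_one]
  | @mulA i d a v ha hv ih =>
    rw [symbolAct_ofA_mul hA S ⟨i, a, ha⟩]
    refine ⟨fun w hw => ?_, fun w hw => ?_⟩
    · change (symbolMulA _ _).1 w = 0
      rw [symbolMulA_fst, ih.1 w hw, ih.2 w hw.le]; simp
    · ext b
      change (symbolMulA _ _).2 w b = 0
      rw [symbolMulA_snd, ih.2 w hw]; simp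
  | @mulL i d ξ v hξ hv ih =>
    rw [symbolAct_ofL_mul hA S ⟨i, ξ, hξ⟩]
    refine ⟨fun w hw => ?_, fun w hw => ?_⟩
    · change (symbolMulL _ _).1 w = 0
      rw [symbolMulL_fst, ih.1 w hw, ih.1 (_ :: w) (by rw [List.length_cons]; omega)]; simp
    · ext b
      change (symbolMulL _ _).2 w b = 0
      rw [symbolMulL_snd, ih.2 w hw, ih.2 (_ :: w) (by rw [List.length_cons]; omega)]; simp

theorem gsym_linearMap_ext {N : Type*} [AddCommGroup N] [Module K N] {f g : GSym 𝒜 ℒ →ₗ[K] N}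
    (h : ∀ d v, GSym.IsWord 𝒜 ℒ d v → f v = g v) : f = g := by
  refine linearMap_ext_of_homogeneous (GSym.grading 𝒜 ℒ) fun d v hv => ?_
  induction hv using Submodule.span_induction with
  | zero => rw [map_zero, map_zero]
  | add u v _ _ hu hv => rw [map_add, map_add, hu, hv]
  | smul c u _ hu => rw [map_smul, map_smul, hu]
  | mem v hv => exact h d v hv

/-- The order of an operator may be tested on generators. -/
theorem OrderLT.of_generators (hA : GradedCommutative 𝒜) {n : ℕ} {p : ℤ}
    {F : GSym 𝒜 ℒ →ₗ[K] GSym 𝒜 ℒ}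
    (h1 : ∀ a : Homog 𝒜, OrderLT (GSym.grading 𝒜 ℒ) n (p + a.deg)
      (gradedComm p a.deg F (LinearMap.mulLeft K (GSym.ofA 𝒜 ℒ a.val))))
    (h2 : ∀ x : Homog ℒ, OrderLT (GSym.grading 𝒜 ℒ) n (p + x.deg)
      (gradedComm p x.deg F (LinearMap.mulLeft K (GSym.ofL 𝒜 ℒ x.val)))) :
    OrderLT (GSym.grading 𝒜 ℒ) (n + 1) p F := by
  rintro ⟨d, v, hv⟩
  simp only
  induction hv using Submodule.span_induction with
  | zero => convert OrderLT.zero n _; ext u; rw [gradedComm_mulLeft_apply]; simp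
  | add u v _ _ hu hv =>
    convert hu.add hv using 1; ext w
    simp only [gradedComm_mulLeft_apply, LinearMap.add_apply, add_mul, map_add, smul_add]
    abel
  | smul c u _ hu =>
    convert hu.smul c using 1; ext w
    simp only [gradedComm_mulLeft_apply, LinearMap.smul_apply, smul_mul_assoc, map_smul, smul_sub]
    rw [smul_comm c]
  | mem v hv =>
    induction hv with
    | one => convert OrderLT.zero n _; ext u; rw [gradedComm_mulLeft_apply]; simp [sgn_zero]
    | mulA ha hv ih =>
      exact OrderLT.gradedComm_mul (GSym.grading_comm hA) (x := ⟨_, _, GSym.ofA_mem ha⟩)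
        (y := ⟨_, _, Submodule.subset_span hv⟩) (h1 ⟨_, _, ha⟩) ih
    | mulL hξ hv ih =>
      exact OrderLT.gradedComm_mul (GSym.grading_comm hA) (x := ⟨_, _, GSym.ofL_mem hξ⟩)
        (y := ⟨_, _, Submodule.subset_span hv⟩) (h2 ⟨_, _, hξ⟩) ih

theorem symbolOp_orderLT (hA : GradedCommutative 𝒜) {k : ℕ} {S : symbolSpace 𝒜 ℒ}
    (hS : IsSymbolOfOrder k S) : OrderLT (GSym.grading 𝒜 ℒ) (k + 1) 1 (symbolOp hA S) := by
  -- Here one commutator with `A` has been taken already and `n` are still to come. A second one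
  -- with `A` gives zero, so only letters from `L` prolong the word.
  have hG : ∀ (n : ℕ) (w : List (Homog ℒ)) (a : Homog 𝒜), k ≤ w.length + n →
      OrderLT (GSym.grading 𝒜 ℒ) n (1 + wordDeg Homog.deg (a.toGSymA ℒ :: wordToGSym 𝒜 w))
        (wordComm 1 (symbolOp hA S) (a.toGSymA ℒ :: wordToGSym 𝒜 w)) := by
    intro n
    induction n with
    | zero =>
      intro w a hw
      refine gsym_linearMap_ext fun d v hv => ?_
      rw [wordComm_symbolOp_cons, (symbolAct_order hA hS hv).2 w hw]; rfl
    | succ n ih =>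
      intro w a hw
      refine OrderLT.of_generators hA (fun b => ?_) (fun x => ?_)
      · have h := wordComm_symbolOp_cons_cons hA S a b w
        rw [wordComm_cons] at h
        exact h ▸ OrderLT.zero n _
      · have h := ((wordComm_symm (GSym.grading_comm hA) 1 (symbolOp hA S)).swap (x.toGSymL 𝒜)
          (a.toGSymA ℒ) (wordToGSym 𝒜 w))
        have h1 := (ih (x :: w) a (by rw [List.length_cons]; omega)).zsmul
          (sgn (x.deg * a.deg))
        change OrderLT _ n _ (sgn ((x.toGSymL 𝒜).deg * (a.toGSymA ℒ).deg) •
          wordComm 1 (symbolOp hA S) (a.toGSymA ℒ :: x.toGSymL 𝒜 :: wordToGSym 𝒜 w)) at h1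
        rw [← h] at h1
        convert h1 using 1
        · simp only [wordDeg_cons, wordToGSym, List.map_cons, Homog.toGSymL]
          ring
        · rfl
  -- Before any commutator with `A`: a letter from `A` leads to `hG`, a letter from `L` to a longer
  -- word.
  have hF : ∀ (n : ℕ) (w : List (Homog ℒ)), k + 1 ≤ w.length + n →
      OrderLT (GSym.grading 𝒜 ℒ) n (1 + wordDeg Homog.deg (wordToGSym 𝒜 w))
        (wordComm 1 (symbolOp hA S) (wordToGSym 𝒜 w)) := by
    intro n
    induction n with
    | zero =>
      intro w hw
      refine gsym_linearMap_ext fun d v hv => ?_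
      rw [wordComm_symbolOp, (symbolAct_order hA hS hv).1 w hw]; rfl
    | succ n ih =>
      intro w hw
      refine OrderLT.of_generators hA (fun b => ?_) (fun x => ?_)
      · convert hG n w b (by omega) using 1
        · rw [wordDeg_cons]
          change _ + b.deg = _ + (b.deg + _)
          ring
        · rfl
      · convert ih (x :: w) (by rw [List.length_cons]; omega) using 1
        · simp only [wordDeg_cons, wordToGSym, List.map_cons, Homog.toGSymL]
          ring
        · rfl
  exact hF (k + 1) [] (by simp)

end SymbolOperators

/-! ### The symbol of the Rinehart operator -/

section RinehartSymbol

variable {K A L : Type*} [Field K] [Ring A] [Algebra K A]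
  [AddCommGroup L] [Module K L] [Module A L]
  {𝒜 : ℤ → Submodule K A} {ℒ : ℤ → Submodule K L} [SetLike.GradedSMul 𝒜 ℒ] [GradedAlgebra 𝒜]
  [DirectSum.Decomposition ℒ] {X : LRInfinity 𝒜 ℒ}

/-- The iterated commutators at `1` of the `k`-th component of the Rinehart operator with elements
of `L`. -/
def rinehartLeft (Δ : RightConnection X 𝒜) (k : ℕ) (w : List (Homog ℒ)) : GSym 𝒜 ℒ :=
  (if w.length = k then GSym.ofL 𝒜 ℒ (evalMulti X.bracket w) else 0) -
    if w.length + 1 = k then GSym.ofA 𝒜 ℒ (evalMulti Δ.form w 1) else 0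

variable (X) in
/-- The iterated commutators at `1` of the `k`-th component of the Rinehart operator with elements
of `L` and an element of `A`. -/
def rinehartRight (k : ℕ) (w : List (Homog ℒ)) : A →ₗ[K] GSym 𝒜 ℒ :=
  if w.length + 1 = k then (GSym.ofA 𝒜 ℒ).toLinearMap ∘ₗ evalMulti X.anchor w else 0

theorem rinehartRight_apply (k : ℕ) (w : List (Homog ℒ)) (a : A) :
    rinehartRight X k w a =
      if w.length + 1 = k then GSym.ofA 𝒜 ℒ (evalMulti X.anchor w a) else 0 := by
  unfold rinehartRight; split_ifs <;> rfl

/-- Only two lengths of `w` matter. For `|w| + 1 = k` this is the Leibniz rule of the bracket. For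
`|w| + 2 = k` the scalar is moved from `ξ` into the argument of the connection, whose Leibniz rule
then produces the anchor term. -/
theorem rinehart_smul_left (Δ : RightConnection X 𝒜) (k : ℕ) (a : Homog 𝒜) (x : Homog ℒ)
    (w : List (Homog ℒ)) :
    rinehartLeft Δ k (a.smul x :: w) =
      sgn (a.deg * (1 + wordDeg Homog.deg w)) •
        (GSym.ofA 𝒜 ℒ a.val * rinehartLeft Δ k (x :: w)) +
      sgn (x.deg * (1 + wordDeg Homog.deg w + a.deg)) •
        (GSym.ofL 𝒜 ℒ x.val * rinehartRight X k w a.val) +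
      sgn (a.deg * x.deg) • rinehartRight X k (x :: w) a.val := by
  simp only [rinehartLeft, rinehartRight_apply, List.length_cons]
  by_cases h1 : w.length + 1 = k
  · have h2 : ¬ w.length + 1 + 1 = k := by omega
    rw [if_pos h1, if_neg h2, if_pos h1, if_neg h2, if_pos h1, if_neg h2, sub_zero, smul_zero,
      add_zero, sub_zero, X.evalMulti_bracket_smul, map_add, GSym.ofL_smul, map_zsmul,
      GSym.ofL_smul, GSym.ofA_mul_ofL 𝒜 ℒ (X.evalMulti_anchor_mem w a) x.mem, mul_comm a.deg,
      mul_comm x.deg, add_comm]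
  · rw [if_neg h1, if_neg h1]
    by_cases h2 : w.length + 1 + 1 = k
    · rw [if_pos h2, if_pos h2, if_pos h2, if_neg h1, Δ.evalMulti_form_smul,
        Δ.evalMulti_form_leibniz, mul_one]
      simp only [zero_sub, mul_zero, smul_zero, add_zero, map_zsmul, map_sub, map_mul, mul_neg,
        smul_neg, smul_sub, sgn_smul_sgn_smul]
      rw [neg_sub, sub_eq_neg_add]
      congr 3
      apply sgn_congr
      rw [wordDeg_cons]
      push_cast
      generalize (wordDeg Homog.deg w : ZMod 2) = b
      generalize (x.deg : ZMod 2) = c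
      generalize (a.deg : ZMod 2) = d
      decide +revert
    · simp [h1, h2]

theorem rinehart_isSymbol (Δ : RightConnection X 𝒜) (hA : GradedCommutative 𝒜) (k : ℕ) :
    IsSymbol (rinehartLeft Δ k) (rinehartRight X k) where
  symm_left := by
    have h1 := wordSymmetric_ite ((evalMulti_symm X.bracket_symm).map (GSym.ofL 𝒜 ℒ)) (· = k)
    have h2 := wordSymmetric_ite ((evalMulti_symm Δ.form_symm).map
      ((GSym.ofA 𝒜 ℒ).toLinearMap ∘ₗ (LinearMap.applyₗ (R := K) (1 : A)))) (· + 1 = k)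
    intro p x y w
    refine (congrArg₂ (· - ·) (h1 p x y w) (h2 p x y w)).trans ?_
    rw [← smul_sub]
    rfl
  symm_right := by
    have h := wordSymmetric_ite ((evalMulti_symm X.anchor_symm).map
      (LinearMap.compRight K (M := A) (GSym.ofA 𝒜 ℒ).toLinearMap)) (· + 1 = k)
    exact h
  lin_left d c x y w := by
    simp only [rinehartLeft, List.length_cons]
    split_ifs <;>
      simp only [evalMulti_lin, map_add, map_smul, LinearMap.add_apply, LinearMap.smul_apply,
        smul_sub, smul_zero, sub_zero, zero_sub, smul_neg, neg_add, add_zero]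
    abel
  lin_right d c x y w := by
    simp only [rinehartRight, List.length_cons]
    split_ifs
    · rw [evalMulti_lin, LinearMap.comp_add, LinearMap.comp_smul]
    · simp
  smul_left := rinehart_smul_left Δ k
  smul_right a x w b := by
    simp only [rinehartRight_apply, List.length_cons]
    split_ifs
    · rw [X.evalMulti_anchor_smul, map_zsmul, map_mul, mul_comm a.deg]
    · simp
  mul_right a b w := by
    simp only [rinehartRight_apply]
    split_ifs
    · rw [X.evalMulti_anchor_mul, map_add, map_zsmul, map_mul, map_mul, mul_comm a.deg,
        ← map_mul, hA _ _ _ _ (X.evalMulti_anchor_mem w a) b.mem, map_zsmul, map_mul,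
        mul_comm b.deg]
    · simp

/-- The symbol at `1` of the `k`-th component of the Rinehart operator. -/
def rinehartSymbol (hA : GradedCommutative 𝒜) (Δ : RightConnection X 𝒜) (k : ℕ) :
    symbolSpace 𝒜 ℒ :=
  ⟨(rinehartLeft Δ k, rinehartRight X k), rinehart_isSymbol Δ hA k⟩

theorem rinehartSymbol_degree (hA : GradedCommutative 𝒜) (Δ : RightConnection X 𝒜) (k : ℕ) :
    IsSymbolOfDegree 0 (rinehartSymbol hA Δ k) := by
  refine ⟨fun w => ?_, fun w a => ?_⟩
  · change rinehartLeft Δ k w ∈ _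
    rw [add_zero]
    refine sub_mem ?_ ?_
    · split_ifs
      · exact GSym.ofL_mem (evalMulti_mem X.bracket_mem w)
      · exact zero_mem _
    · split_ifs
      · have h := Δ.evalMulti_form_mem w ⟨0, 1, SetLike.GradedOne.one_mem⟩
        rw [add_zero] at h
        exact GSym.ofA_mem h
      · exact zero_mem _
  · change rinehartRight X k w a.val ∈ _
    rw [add_zero, rinehartRight_apply]
    split_ifs
    · exact GSym.ofA_mem (X.evalMulti_anchor_mem w a)
    · exact zero_mem _

theorem rinehartSymbol_order (hA : GradedCommutative 𝒜) (Δ : RightConnection X 𝒜) (k : ℕ) :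
    IsSymbolOfOrder k (rinehartSymbol hA Δ k) := by
  refine ⟨fun w hw => ?_, fun w hw => ?_⟩
  · change rinehartLeft Δ k w = 0
    rw [rinehartLeft, if_neg (by omega), if_neg (by omega), sub_zero]
  · change rinehartRight X k w = 0
    rw [rinehartRight, if_neg (by omega)]

/-- The components of the Rinehart operator. -/
def rinehartOp (hA : GradedCommutative 𝒜) (Δ : RightConnection X 𝒜) (k : ℕ) :
    GSym 𝒜 ℒ →ₗ[K] GSym 𝒜 ℒ :=
  symbolOp hA (rinehartSymbol hA Δ k)

theorem rinehartOp_hasDegree (hA : GradedCommutative 𝒜) (Δ : RightConnection X 𝒜) (k : ℕ) :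
    HasDegree (GSym.grading 𝒜 ℒ) 1 (rinehartOp hA Δ k) :=
  symbolOp_hasDegree hA (rinehartSymbol_degree hA Δ k)

theorem rinehartOp_order (hA : GradedCommutative 𝒜) (Δ : RightConnection X 𝒜) (k : ℕ)
    (w : List (Homog (GSym.grading 𝒜 ℒ))) (hw : k < w.length) :
    wordComm 1 (rinehartOp hA Δ k) w = 0 :=
  (symbolOp_orderLT hA (rinehartSymbol_order hA Δ k)).wordComm_eq_zero hw

theorem wordComm_rinehartOp (hA : GradedCommutative 𝒜) (Δ : RightConnection X 𝒜) (k : ℕ)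
    (w : List (Homog ℒ)) :
    wordComm 1 (rinehartOp hA Δ k) (wordToGSym 𝒜 w) 1 = rinehartLeft Δ k w := by
  rw [rinehartOp, wordComm_symbolOp, symbolAct_one]; rfl

theorem wordComm_rinehartOp_cons (hA : GradedCommutative 𝒜) (Δ : RightConnection X 𝒜) (k : ℕ)
    (a : Homog 𝒜) (w : List (Homog ℒ)) :
    wordComm 1 (rinehartOp hA Δ k) (a.toGSymA ℒ :: wordToGSym 𝒜 w) 1 =
      rinehartRight X k w a.val := by
  rw [rinehartOp, wordComm_symbolOp_cons, symbolAct_one]; rfl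

/-- The value at `a` is the commutator with `a` at `1` plus `± a` times the value at `1`. The
Leibniz rule of the connection fuses `σ(w|a)` and `a Δ(w|1)` into `-Δ(w|a)`, so prescribing `Δ` at
`1` alone was enough. -/
theorem wordComm_rinehartOp_ofA (hA : GradedCommutative 𝒜) (Δ : RightConnection X 𝒜) (k : ℕ)
    (w : List (Homog ℒ)) (a : A) :
    wordComm 1 (rinehartOp hA Δ k) (wordToGSym 𝒜 w) (GSym.ofA 𝒜 ℒ a) =
      (if w.length = k then GSym.ofL 𝒜 ℒ (evalMulti X.bracket w) * GSym.ofA 𝒜 ℒ a else 0) -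
        if w.length + 1 = k then GSym.ofA 𝒜 ℒ (evalMulti Δ.form w a) else 0 := by
  let φ : A →ₗ[K] GSym 𝒜 ℒ :=
    (if w.length = k then LinearMap.mulLeft K (GSym.ofL 𝒜 ℒ (evalMulti X.bracket w)) ∘ₗ
        (GSym.ofA 𝒜 ℒ).toLinearMap else 0) -
      if w.length + 1 = k then (GSym.ofA 𝒜 ℒ).toLinearMap ∘ₗ evalMulti Δ.form w else 0
  have hφ : ∀ a, φ a = (if w.length = k then GSym.ofL 𝒜 ℒ (evalMulti X.bracket w) *
      GSym.ofA 𝒜 ℒ a else 0) -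
        if w.length + 1 = k then GSym.ofA 𝒜 ℒ (evalMulti Δ.form w a) else 0 := by
    intro a
    rw [LinearMap.sub_apply]
    split_ifs <;> rfl
  rw [← hφ]
  refine LinearMap.congr_fun (f := wordComm 1 (rinehartOp hA Δ k) (wordToGSym 𝒜 w) ∘ₗ
    (GSym.ofA 𝒜 ℒ).toLinearMap) (linearMap_ext_of_homogeneous 𝒜 fun i a ha => ?_) a
  rw [hφ]
  change wordComm 1 (rinehartOp hA Δ k) (wordToGSym 𝒜 w) (GSym.ofA 𝒜 ℒ a) = _
  have h := wordComm_rinehartOp_cons hA Δ k ⟨i, a, ha⟩ w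
  rw [wordComm_cons_apply, wordComm_rinehartOp, wordDeg_wordToGSym] at h
  change wordComm 1 _ _ (GSym.ofA 𝒜 ℒ a * 1) - sgn (_ * i) • (GSym.ofA 𝒜 ℒ a * _) =
    rinehartRight X k w a at h
  rw [mul_one, sub_eq_iff_eq_add] at h
  rw [h, rinehartRight_apply, rinehartLeft]
  by_cases h1 : w.length = k
  · have h2 : ¬ w.length + 1 = k := by omega
    rw [if_pos h1, if_pos h1, if_neg h2, if_neg h2, if_neg h2, zero_add, sub_zero,
      GSym.ofA_mul_ofL 𝒜 ℒ ha (evalMulti_mem X.bracket_mem w), mul_comm i, sgn_smul_self, sub_zero]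
  · by_cases h2 : w.length + 1 = k
    · rw [if_pos h2, if_neg h1, if_pos h2, if_neg h1, if_pos h2]
      have h3 := Δ.evalMulti_form_leibniz w ⟨i, a, ha⟩ 1
      rw [mul_one, mul_one] at h3
      rw [h3, map_sub, map_zsmul, map_mul, zero_sub, zero_sub, mul_neg, smul_neg, neg_sub,
        sub_eq_add_neg]
    · simp [h1, h2]

end RinehartSymbol

/-! ### Operators on products, expanded in commutators -/

section WordProducts

variable {K B : Type*} [Field K] [Ring B] [Algebra K B] {ℬ : ℤ → Submodule K B}

/-- The product of the letters of a word, the last letter coming first. -/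
def wordProd (w : List (Homog ℬ)) : B := ((w.map Homog.val).reverse).prod

theorem wordProd_nil : wordProd ([] : List (Homog ℬ)) = 1 := rfl

theorem wordProd_cons (x : Homog ℬ) (w : List (Homog ℬ)) :
    wordProd (x :: w) = wordProd w * x.val := by
  simp [wordProd]

theorem wordProd_append_singleton (x : Homog ℬ) (w : List (Homog ℬ)) :
    wordProd (w ++ [x]) = x.val * wordProd w := by
  simp [wordProd]

theorem wordProd_mem [SetLike.GradedMonoid ℬ] (w : List (Homog ℬ)) :
    wordProd w ∈ ℬ (wordDeg Homog.deg w) := by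
  induction w with
  | nil => exact SetLike.GradedOne.one_mem
  | cons x w ih =>
    rw [wordProd_cons, wordDeg_cons, add_comm]
    exact SetLike.mul_mem_graded ih x.mem

/-- The values of an operator on a product, in terms of iterated commutators. -/
theorem apply_wordProd_mul (c : ℤ) (F : B →ₗ[K] B) (w : List (Homog ℬ)) (v : B) :
    F (wordProd w * v) = shuffleSum Homog.deg w (fun p q =>
      sgn (wordDeg Homog.deg q * (c + wordDeg Homog.deg p)) •
        (wordProd q * wordComm c F p v)) := by
  induction w generalizing v with
  | nil => simp [shuffleSum_nil, wordProd_nil, wordDeg_nil, sgn_zero, wordComm_nil]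
  | cons x w ih =>
    rw [wordProd_cons, mul_assoc, ih, shuffleSum_cons]
    congr 1
    ext p q
    have h : wordComm c F p (x.val * v) = wordComm c F (x :: p) v +
        sgn ((c + wordDeg Homog.deg p) * x.deg) • (x.val * wordComm c F p v) := by
      rw [wordComm_cons_apply]; abel
    rw [h, mul_add (wordProd q), smul_add, mul_smul_comm, sgn_smul_sgn_smul, sgn_smul_sgn_smul, wordProd_cons,
      mul_assoc, wordDeg_cons, wordDeg_cons]
    congr 2
    · apply sgn_congr
      push_cast
      generalize (c : ZMod 2) = a
      generalize (wordDeg Homog.deg p : ZMod 2) = b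
      generalize (wordDeg Homog.deg q : ZMod 2) = d
      generalize (x.deg : ZMod 2) = e
      decide +revert
    · congr 1
      ring

end WordProducts

theorem shuffleSum_map {α β N : Type*} [AddCommGroup N] (deg : β → ℤ) (f : α → β) (w : List α)
    (F : List β → List β → N) :
    shuffleSum deg (w.map f) F =
      shuffleSum (fun x => deg (f x)) w (fun p q => F (p.map f) (q.map f)) := by
  induction w generalizing F with
  | nil => rfl
  | cons x w ih =>
    rw [List.map_cons, shuffleSum_cons, shuffleSum_cons, ih]
    congr 1
    ext p q
    rw [List.map_cons, List.map_cons]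
    congr 3
    simp [wordDeg, Function.comp_def]

/-! ### The Rinehart formula and its uniqueness -/

section RinehartFormula

variable {K A L : Type*} [Field K] [Ring A] [Algebra K A]
  [AddCommGroup L] [Module K L] [Module A L]
  {𝒜 : ℤ → Submodule K A} {ℒ : ℤ → Submodule K L} [SetLike.GradedSMul 𝒜 ℒ] [GradedAlgebra 𝒜]
  [DirectSum.Decomposition ℒ] {X : LRInfinity 𝒜 ℒ}

theorem shuffleSum_wordToGSym {N : Type*} [AddCommGroup N] (w : List (Homog ℒ))
    (F : List (Homog (GSym.grading 𝒜 ℒ)) → List (Homog (GSym.grading 𝒜 ℒ)) → N) :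
    shuffleSum Homog.deg (wordToGSym 𝒜 w) F =
      shuffleSum Homog.deg w (fun p q => F (wordToGSym 𝒜 p) (wordToGSym 𝒜 q)) :=
  shuffleSum_map Homog.deg (Homog.toGSymL 𝒜) w F

theorem wordProd_word {n : ℕ} (v : Fin n → Homog ℒ) :
    wordProd (wordToGSym 𝒜 (word v)) = GSym.prodL 𝒜 ℒ (fun i => (v i).val) := by
  simp only [wordProd, wordToGSym, word, GSym.prodL, List.map_reverse, List.map_map,
    List.reverse_reverse, List.map_ofFn]
  rfl

/-- A linear map is determined by its values on products of elements of `L` with an element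
of `A`. -/
theorem gsym_linearMap_ext_of_words (hA : GradedCommutative 𝒜) {N : Type*} [AddCommGroup N]
    [Module K N] {f g : GSym 𝒜 ℒ →ₗ[K] N}
    (h : ∀ (w : List (Homog ℒ)) (a : Homog 𝒜),
      f (wordProd (wordToGSym 𝒜 w) * GSym.ofA 𝒜 ℒ a.val) =
        g (wordProd (wordToGSym 𝒜 w) * GSym.ofA 𝒜 ℒ a.val)) : f = g := by
  -- Every factor from `A` can be moved to the right end and merged with the scalar there; the
  -- integer `m` absorbs the signs.
  have key : ∀ d v, GSym.IsWord 𝒜 ℒ d v → ∃ (m : ℤ) (w : List (Homog ℒ)) (a : Homog 𝒜),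
      v = m • (wordProd (wordToGSym 𝒜 w) * GSym.ofA 𝒜 ℒ a.val) := by
    intro d v hv
    induction hv with
    | one =>
      refine ⟨1, [], ⟨0, 1, SetLike.GradedOne.one_mem⟩, ?_⟩
      simp [wordToGSym, wordProd_nil]
    | @mulA i d b v hb hv ih =>
      obtain ⟨m, w, a, rfl⟩ := ih
      refine ⟨m * sgn (i * wordDeg Homog.deg (wordToGSym 𝒜 w)), w,
        Homog.mul ⟨i, b, hb⟩ a, ?_⟩
      rw [mul_smul_comm, ← mul_assoc, GSym.grading_comm hA _ _ _ _ (GSym.ofA_mem hb)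
        (wordProd_mem _), smul_mul_assoc, mul_assoc, ← map_mul, smul_smul]
      rfl
    | @mulL i d ξ v hξ hv ih =>
      obtain ⟨m, w, a, rfl⟩ := ih
      refine ⟨m, w ++ [⟨i, ξ, hξ⟩], a, ?_⟩
      rw [mul_smul_comm, ← mul_assoc, wordToGSym, wordToGSym, List.map_append]
      congr 2
      exact (wordProd_append_singleton (Homog.toGSymL 𝒜 ⟨i, ξ, hξ⟩) _).symm
  refine gsym_linearMap_ext fun d v hv => ?_
  obtain ⟨m, w, a, rfl⟩ := key d v hv
  rw [map_zsmul, map_zsmul, h]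

theorem IsRinehartOperator.unique (hA : GradedCommutative 𝒜) {Δ : RightConnection X 𝒜}
    {D D' : ℕ → GSym 𝒜 ℒ →ₗ[K] GSym 𝒜 ℒ} (hD : IsRinehartOperator Δ D)
    (hD' : IsRinehartOperator Δ D') : D' = D := by
  funext k
  refine gsym_linearMap_ext_of_words hA fun w a => ?_
  have h := (hD' k w.length _ _ (fun i => (letters w i).mem) a.val).trans
    (hD k w.length _ _ (fun i => (letters w i).mem) a.val).symm
  rwa [← wordProd_word, word_letters] at h

/-- The expansion of an operator in commutators leaves two kinds of terms, with `k` and with `k - 1`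
letters in the commutator. They are the two sums of the formula. -/
theorem rinehartOp_isRinehartOperator (hA : GradedCommutative 𝒜) (Δ : RightConnection X 𝒜) :
    IsRinehartOperator Δ (rinehartOp hA Δ) := by
  intro k n d ξ hξ a
  let v : Fin n → Homog ℒ := fun i => ⟨d i, ξ i, hξ i⟩
  have hr : ∀ s : Finset (Fin n), GSym.prodL 𝒜 ℒ (restr s ξ) =
      wordProd (wordToGSym 𝒜 (word (restr s v))) := fun s => (wordProd_word (restr s v)).symm
  have hX : ∀ s : Finset (Fin n), X.bracket s.card (restr s ξ) =
      evalMulti X.bracket (word (restr s v)) := fun s => (evalMulti_word _ (restr s v)).symm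
  have hF : ∀ s : Finset (Fin n), Δ.form s.card (restr s ξ) =
      evalMulti Δ.form (word (restr s v)) := fun s => (evalMulti_word _ (restr s v)).symm
  have e1 := sum_unshuffleSign_smul Homog.deg v (fun p q => if p.length = k then
    GSym.ofL 𝒜 ℒ (evalMulti X.bracket p) * wordProd (wordToGSym 𝒜 q) * GSym.ofA 𝒜 ℒ a else 0)
  have e2 := sum_sgn_eq_shuffleSum v (fun p q => if q.length + 1 = k then
    wordProd (wordToGSym 𝒜 p) * GSym.ofA 𝒜 ℒ (evalMulti Δ.form q a) else 0)
  have e3 : ∀ s : Finset (Fin n), (word (restr s v)).length = s.card := fun s => length_word _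
  simp only [e3, smul_ite, smul_zero] at e1 e2
  rw [← Finset.sum_filter] at e1 e2
  have e4 : GSym.prodL 𝒜 ℒ ξ = wordProd (wordToGSym 𝒜 (word v)) := (wordProd_word v).symm
  simp only [hr, hX, hF, e4]
  refine Eq.trans ?_ (congrArg₂ (· - ·) e1 e2).symm
  rw [apply_wordProd_mul 1, shuffleSum_wordToGSym]
  simp only [wordDeg_wordToGSym, wordComm_rinehartOp_ofA, mul_sub, smul_sub]
  rw [shuffleSum_sub]
  congr 1
  · refine shuffleSum_congr _ fun p q _ => ?_
    split_ifs
    · rw [← mul_assoc, GSym.grading_comm hA _ _ _ _ (wordProd_mem _)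
        (GSym.ofL_mem (evalMulti_mem X.bracket_mem p)), smul_mul_assoc, wordDeg_wordToGSym,
        sgn_smul_self]
    · rw [mul_zero, smul_zero]
  -- In the second sum the connection takes the right-hand part of the unshuffle, so the halves are
  -- exchanged.
  · rw [shuffleSum_swap]
    refine shuffleSum_congr _ fun p q _ => ?_
    rw [sgn_smul_sgn_smul]
    split_ifs
    · congr 1
      apply sgn_congr
      push_cast
      generalize (wordDeg Homog.deg p : ZMod 2) = b
      generalize (wordDeg Homog.deg q : ZMod 2) = d
      decide +revert
    · rw [mul_zero, smul_zero]

end RinehartFormula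

/-! ### The square of the Rinehart operator -/

section RinehartSquare

theorem sum_antidiagonal_ite {N : Type*} [AddCommMonoid N] (m a b : ℕ) (z : N) :
    ∑ ij ∈ Finset.HasAntidiagonal.antidiagonal m, (if b = ij.2 then if a = ij.1 then z else 0 else 0) =
      if a + b = m then z else 0 := by
  by_cases h : a + b = m
  · rw [if_pos h, Finset.sum_eq_single (a, b)]
    · simp
    · rintro ⟨i, j⟩ _ hij
      by_cases h1 : b = j
      · rw [if_pos h1, if_neg fun h2 => hij (Prod.ext h2.symm h1.symm)]
      · rw [if_neg h1]
    · intro h1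
      exact absurd (Finset.HasAntidiagonal.mem_antidiagonal.2 h) h1
  · rw [if_neg h]
    refine Finset.sum_eq_zero fun ij hij => ?_
    rw [Finset.HasAntidiagonal.mem_antidiagonal] at hij
    split_ifs with h1 h2
    · exact absurd (by omega) h
    · rfl
    · rfl

/-- A commutator is linear in its last letter. This lets a commutator value, which is a difference
of an element of `L` and one of `A`, be split before it enters the outer operator. -/
theorem wordComm_cons_val {K B : Type*} [Field K] [Ring B] [Algebra K B] {ℬ : ℤ → Submodule K B}
    (p : ℤ) (F : B →ₗ[K] B) (w : List (Homog ℬ)) {x y z : Homog ℬ} (hy : y.deg = x.deg)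
    (hz : z.deg = x.deg) {P Q : Prop} [Decidable P] [Decidable Q]
    (h : x.val = (if P then y.val else 0) - if Q then z.val else 0) (v : B) :
    wordComm p F (x :: w) v = (if P then wordComm p F (y :: w) v else 0) -
      if Q then wordComm p F (z :: w) v else 0 := by
  simp only [wordComm_cons_apply, h, hy, hz]
  split_ifs <;> simp [sub_mul, smul_sub] <;> abel

variable {K A L : Type*} [Field K] [Ring A] [Algebra K A]
  [AddCommGroup L] [Module K L] [Module A L]
  {𝒜 : ℤ → Submodule K A} {ℒ : ℤ → Submodule K L} [SetLike.GradedSMul 𝒜 ℒ] [GradedAlgebra 𝒜]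
  [DirectSum.Decomposition ℒ] {X : LRInfinity 𝒜 ℒ}

/-- The value at `1` of a right connection on a word, as a homogeneous element. -/
def formWord (Δ : RightConnection X 𝒜) (w : List (Homog ℒ)) : Homog 𝒜 :=
  ⟨1 + wordDeg Homog.deg w, evalMulti Δ.form w 1, by
    simpa using Δ.evalMulti_form_mem w ⟨0, 1, SetLike.GradedOne.one_mem⟩⟩

/-- The value of an anchor on a word, as a homogeneous element. -/
def anchorWord (X : LRInfinity 𝒜 ℒ) (w : List (Homog ℒ)) (a : Homog 𝒜) : Homog 𝒜 :=
  ⟨1 + wordDeg Homog.deg w + a.deg, evalMulti X.anchor w a.val, X.evalMulti_anchor_mem w a⟩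

/-- The square of the Rinehart operator. -/
def rinehartSquare (hA : GradedCommutative 𝒜) (Δ : RightConnection X 𝒜) (m : ℕ) :
    GSym 𝒜 ℒ →ₗ[K] GSym 𝒜 ℒ :=
  ∑ ij ∈ Finset.HasAntidiagonal.antidiagonal m, rinehartOp hA Δ ij.1 ∘ₗ rinehartOp hA Δ ij.2

theorem wordComm_commVal_cons (hA : GradedCommutative 𝒜) (Δ : RightConnection X 𝒜) (k : ℕ)
    (F : GSym 𝒜 ℒ →ₗ[K] GSym 𝒜 ℒ) (p : List (Homog (GSym.grading 𝒜 ℒ))) (q : List (Homog ℒ))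
    (v : GSym 𝒜 ℒ) :
    wordComm 1 F (commVal (rinehartOp_hasDegree hA Δ k) (wordToGSym 𝒜 q) :: p) v =
      (if q.length = k then
        wordComm 1 F ((bracketWord X.bracket X.bracket_mem q).toGSymL 𝒜 :: p) v else 0) -
      if q.length + 1 = k then wordComm 1 F ((formWord Δ q).toGSymA ℒ :: p) v else 0 := by
  refine wordComm_cons_val 1 F p ?_ ?_ ?_ v
  · change 1 + _ = 1 + _
    rw [wordDeg_wordToGSym]
  · change 1 + _ = 1 + _
    rw [wordDeg_wordToGSym]
  · exact wordComm_rinehartOp hA Δ k q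

theorem wordComm_commVal_cons_cons (hA : GradedCommutative 𝒜) (Δ : RightConnection X 𝒜) (k : ℕ)
    (F : GSym 𝒜 ℒ →ₗ[K] GSym 𝒜 ℒ) (p : List (Homog (GSym.grading 𝒜 ℒ))) (q : List (Homog ℒ))
    (a : Homog 𝒜) (v : GSym 𝒜 ℒ) :
    wordComm 1 F (commVal (rinehartOp_hasDegree hA Δ k) (a.toGSymA ℒ :: wordToGSym 𝒜 q) :: p) v =
      if q.length + 1 = k then wordComm 1 F ((anchorWord X q a).toGSymA ℒ :: p) v else 0 := by
  refine (wordComm_cons_val 1 F p (P := q.length + 1 = k) (Q := False)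
    (y := (anchorWord X q a).toGSymA ℒ) ?_ rfl ?_ v).trans ?_
  · change 1 + wordDeg Homog.deg q + a.deg = 1 + wordDeg Homog.deg (a.toGSymA ℒ :: _)
    rw [wordDeg_cons, wordDeg_wordToGSym]
    change _ = 1 + (a.deg + _)
    ring
  · rw [if_neg not_false, sub_zero]
    exact (wordComm_rinehartOp_cons hA Δ k a q).trans (rinehartRight_apply k q a.val)
  · rw [if_neg not_false, sub_zero]

/-- The length of `w` selects the content: `|w| + 1 = m` leaves the Jacobi identity of the brackets,
with values in `L`, and `|w| + 2 = m` leaves the curvature of `Δ` at `1`, with values in `A`. -/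
theorem wordComm_rinehartSquare [CharZero K] (hA : GradedCommutative 𝒜) {Δ : RightConnection X 𝒜}
    (hΔ : Δ.IsFlat) (m : ℕ) (w : List (Homog ℒ)) :
    wordComm 2 (rinehartSquare hA Δ m) (wordToGSym 𝒜 w) 1 = 0 := by
  have := isAddTorsionFree_of_charZero K A
  rw [rinehartSquare, wordComm_square (GSym.grading_comm hA) (rinehartOp_hasDegree hA Δ),
    shuffleSum_wordToGSym]
  have h : ∀ p q : List (Homog ℒ), p.length + q.length = w.length →
      sgn (wordDeg Homog.deg (wordToGSym 𝒜 p)) • ∑ ij ∈ Finset.HasAntidiagonal.antidiagonal m,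
        wordComm 1 (rinehartOp hA Δ ij.1)
          (commVal (rinehartOp_hasDegree hA Δ ij.2) (wordToGSym 𝒜 q) :: wordToGSym 𝒜 p) 1 =
      (if w.length + 1 = m then GSym.ofL 𝒜 ℒ (sgn (wordDeg Homog.deg p) •
        evalMulti X.bracket (bracketWord X.bracket X.bracket_mem q :: p)) else 0) -
      (if w.length + 2 = m then GSym.ofA 𝒜 ℒ ((sgn (wordDeg Homog.deg p) •
        (evalMulti Δ.form (bracketWord X.bracket X.bracket_mem q :: p) 1 -
          evalMulti Δ.form p (evalMulti Δ.form q 1))) +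
        sgn (wordDeg Homog.deg p + (1 + wordDeg Homog.deg p) * (1 + wordDeg Homog.deg q)) •
          (evalMulti Δ.form q 1 * evalMulti Δ.form p 1)) else 0) := by
    intro p q hpq
    have h1 : ∀ i, wordComm 1 (rinehartOp hA Δ i)
        ((bracketWord X.bracket X.bracket_mem q).toGSymL 𝒜 :: wordToGSym 𝒜 p) 1 = _ := fun i =>
      wordComm_rinehartOp hA Δ i (bracketWord X.bracket X.bracket_mem q :: p)
    -- The commutators produce an anchor applied to `Δ(q|1)`. The Leibniz rule of the connection
    -- trades it for the composite in the curvature and a product of two values of `Δ`.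
    have h2 : evalMulti X.anchor p (evalMulti Δ.form q 1) =
        sgn ((1 + wordDeg Homog.deg p) * (1 + wordDeg Homog.deg q)) •
          (evalMulti Δ.form q 1 * evalMulti Δ.form p 1) -
            evalMulti Δ.form p (evalMulti Δ.form q 1) := by
      have h3 := Δ.evalMulti_form_leibniz p (formWord Δ q) 1
      change evalMulti Δ.form p (evalMulti Δ.form q 1 * 1) = sgn ((1 + _) * (1 + _)) •
        (evalMulti Δ.form q 1 * _) - evalMulti X.anchor p (evalMulti Δ.form q 1) * 1 at h3
      rw [mul_one, mul_one] at h3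
      rw [h3, sub_sub_cancel]
    have h3 : ∀ i, wordComm 1 (rinehartOp hA Δ i)
        ((formWord Δ q).toGSymA ℒ :: wordToGSym 𝒜 p) 1 = _ := fun i =>
      (wordComm_rinehartOp_cons hA Δ i (formWord Δ q) p).trans (rinehartRight_apply i p _)
    have h4 : ∀ (P : Prop) [Decidable P] (x y : GSym 𝒜 ℒ),
        (if P then x - y else 0) = (if P then x else 0) - if P then y else 0 := by
      intro P _ x y; split_ifs <;> simp
    simp only [wordComm_commVal_cons, h1, h3, rinehartLeft, List.length_cons, h4,
      Finset.sum_sub_distrib, sum_antidiagonal_ite, wordDeg_wordToGSym]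
    rw [show p.length + 1 + q.length = w.length + 1 by omega,
      show p.length + 1 + 1 + q.length = w.length + 2 by omega,
      show p.length + 1 + (q.length + 1) = w.length + 2 by omega]
    change _ • (_ - _ - if _ then GSym.ofA 𝒜 ℒ (evalMulti X.anchor p (evalMulti Δ.form q 1))
      else 0) = _
    rw [h2, smul_sub, smul_sub, sub_sub]
    congr 1
    · split_ifs <;> simp only [map_zsmul, smul_zero]
    · split_ifs
      · simp only [map_add, map_sub, map_zsmul, smul_add, smul_sub, sgn_smul_sgn_smul]
        abel
      · simp
  rw [shuffleSum_congr _ h, shuffleSum_sub]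
  have e1 : shuffleSum Homog.deg w (fun p q => if w.length + 1 = m then GSym.ofL 𝒜 ℒ
      (sgn (wordDeg Homog.deg p) •
        evalMulti X.bracket (bracketWord X.bracket X.bracket_mem q :: p)) else 0) = 0 := by
    by_cases hm : w.length + 1 = m
    · simp only [if_pos hm]
      rw [← map_shuffleSum, X.shuffleSum_bracket, map_zero]
    · simp only [if_neg hm]
      exact shuffleSum_zero _ _
  -- The products of two values of `Δ` are antisymmetric under exchange of `p` and `q`, again by the
  -- extra degree `1` of each factor.
  have e2 : shuffleSum Homog.deg w (fun p q =>
        sgn (wordDeg Homog.deg p + (1 + wordDeg Homog.deg p) * (1 + wordDeg Homog.deg q)) •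
          (evalMulti Δ.form q 1 * evalMulti Δ.form p 1)) = 0 := by
    refine shuffleSum_eq_zero_of_antisymm _ fun p q => ?_
    have h5 : evalMulti Δ.form p 1 * evalMulti Δ.form q 1 = _ :=
      hA _ _ _ _ (formWord Δ p).mem (formWord Δ q).mem
    rw [h5, sgn_smul_sgn_smul, sgn_smul_sgn_smul]
    change _ = -(_ • ((formWord Δ q).val * (formWord Δ p).val))
    rw [← neg_smul, ← sgn_add_one]
    congr 1
    apply sgn_congr
    change ((_ + (1 + _) * (1 + _) : ℤ) : ZMod 2) = _
    push_cast
    generalize (wordDeg Homog.deg p : ZMod 2) = b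
    generalize (wordDeg Homog.deg q : ZMod 2) = c
    decide +revert
  rw [e1, zero_sub, neg_eq_zero]
  by_cases hm : w.length + 2 = m
  · simp only [if_pos hm]
    rw [← map_shuffleSum, shuffleSum_add, e2, add_zero, hΔ.shuffleSum_form, map_zero]
  · simp only [if_neg hm]
    exact shuffleSum_zero _ _

/-- The letter `a` falls into one half of each unshuffle. In the outer half it gives `σ(X(q), p |
a)`, the connection term being a double commutator with `A`. In the inner half it gives `σ(p | σ(q |
a))`. Their sum is the anchor identity, so flatness plays no role. -/
theorem wordComm_rinehartSquare_cons [CharZero K] (hA : GradedCommutative 𝒜)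
    (Δ : RightConnection X 𝒜) (m : ℕ) (a : Homog 𝒜) (w : List (Homog ℒ)) :
    wordComm 2 (rinehartSquare hA Δ m) (a.toGSymA ℒ :: wordToGSym 𝒜 w) 1 = 0 := by
  rw [rinehartSquare, wordComm_square (GSym.grading_comm hA) (rinehartOp_hasDegree hA Δ),
    shuffleSum_cons, shuffleSum_wordToGSym]
  have h : ∀ p q : List (Homog ℒ), p.length + q.length = w.length →
      sgn ((a.toGSymA ℒ).deg * wordDeg Homog.deg (wordToGSym 𝒜 q)) •
        sgn (wordDeg Homog.deg (a.toGSymA ℒ :: wordToGSym 𝒜 p)) •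
          ∑ ij ∈ Finset.HasAntidiagonal.antidiagonal m,
            wordComm 1 (rinehartOp hA Δ ij.1)
              (commVal (rinehartOp_hasDegree hA Δ ij.2) (wordToGSym 𝒜 q) ::
                a.toGSymA ℒ :: wordToGSym 𝒜 p) 1 +
      sgn (wordDeg Homog.deg (wordToGSym 𝒜 p)) •
        ∑ ij ∈ Finset.HasAntidiagonal.antidiagonal m,
          wordComm 1 (rinehartOp hA Δ ij.1)
            (commVal (rinehartOp_hasDegree hA Δ ij.2) (a.toGSymA ℒ :: wordToGSym 𝒜 q) ::
              wordToGSym 𝒜 p) 1 =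
      if w.length + 2 = m then GSym.ofA 𝒜 ℒ (sgn (wordDeg Homog.deg p) •
        (evalMulti X.anchor p (evalMulti X.anchor q a.val) +
          evalMulti X.anchor (bracketWord X.bracket X.bracket_mem q :: p) a.val)) else 0 := by
    intro p q hpq
    have h1 : ∀ i, wordComm 1 (rinehartOp hA Δ i)
        ((bracketWord X.bracket X.bracket_mem q).toGSymL 𝒜 :: a.toGSymA ℒ :: wordToGSym 𝒜 p) 1 =
        if p.length + 1 + 1 = i then sgn ((1 + wordDeg Homog.deg q) * a.deg) • GSym.ofA 𝒜 ℒ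
          (evalMulti X.anchor (bracketWord X.bracket X.bracket_mem q :: p) a.val) else 0 := by
      intro i
      rw [(wordComm_symm (GSym.grading_comm hA) 1 (rinehartOp hA Δ i)).swap, LinearMap.smul_apply]
      have h := (wordComm_rinehartOp_cons hA Δ i a
        (bracketWord X.bracket X.bracket_mem q :: p)).trans (rinehartRight_apply i _ _)
      refine (congrArg (_ • ·) h).trans ?_
      rw [List.length_cons]
      split_ifs
      · rfl
      · exact smul_zero _
    have h2 : ∀ i, wordComm 1 (rinehartOp hA Δ i)
        ((formWord Δ q).toGSymA ℒ :: a.toGSymA ℒ :: wordToGSym 𝒜 p) 1 = 0 := fun i =>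
      LinearMap.congr_fun (wordComm_symbolOp_cons_cons hA _ a (formWord Δ q) p) 1
    have h3 : ∀ i, wordComm 1 (rinehartOp hA Δ i)
        ((anchorWord X q a).toGSymA ℒ :: wordToGSym 𝒜 p) 1 = _ := fun i =>
      (wordComm_rinehartOp_cons hA Δ i (anchorWord X q a) p).trans (rinehartRight_apply i p _)
    simp only [wordComm_commVal_cons, wordComm_commVal_cons_cons, h1, h2, h3, ite_self, sub_zero,
      sum_antidiagonal_ite]
    rw [show p.length + 1 + 1 + q.length = w.length + 2 by omega,
      show p.length + 1 + (q.length + 1) = w.length + 2 by omega, wordDeg_cons,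
      wordDeg_wordToGSym, wordDeg_wordToGSym]
    split_ifs
    · rw [sgn_smul_sgn_smul, sgn_smul_sgn_smul, map_zsmul, map_add, smul_add, add_comm]
      congr 2
      apply sgn_congr
      change ((a.deg * _ + (a.deg + _) + _ : ℤ) : ZMod 2) = _
      push_cast
      generalize (wordDeg Homog.deg p : ZMod 2) = b
      generalize (wordDeg Homog.deg q : ZMod 2) = c
      generalize (a.deg : ZMod 2) = e
      decide +revert
    · simp
  rw [shuffleSum_congr _ h]
  by_cases hm : w.length + 2 = m
  · simp only [if_pos hm]
    rw [← map_shuffleSum, X.shuffleSum_anchor, map_zero]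
  · simp only [if_neg hm]
    exact shuffleSum_zero _ _

/-- An operator is determined by its commutators with words in `L`, evaluated on `A`. These are
commutators with one further element of `A` at `1`, up to a multiple of the commutators at `1`, and
both vanish. -/
theorem rinehartSquare_eq_zero [CharZero K] (hA : GradedCommutative 𝒜) {Δ : RightConnection X 𝒜}
    (hΔ : Δ.IsFlat) (m : ℕ) : rinehartSquare hA Δ m = 0 := by
  refine gsym_linearMap_ext_of_words hA fun w a => ?_
  rw [LinearMap.zero_apply, apply_wordProd_mul 2, shuffleSum_wordToGSym]
  refine (shuffleSum_congr (G := fun _ _ => 0) _ fun p q _ => ?_).trans (shuffleSum_zero _ _)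
  have h := wordComm_rinehartSquare_cons hA Δ m a p
  rw [wordComm_cons_apply, wordComm_rinehartSquare hA hΔ, mul_zero, smul_zero, sub_zero] at h
  change wordComm 2 _ _ (GSym.ofA 𝒜 ℒ a.val * 1) = 0 at h
  rw [mul_one] at h
  rw [h, mul_zero, smul_zero]

/-- In degree `1` the graded commutator is the anticommutator, so the symmetric sum is twice the
square. -/
theorem sum_gradedComm_rinehartOp [CharZero K] (hA : GradedCommutative 𝒜)
    {Δ : RightConnection X 𝒜} (hΔ : Δ.IsFlat) (m : ℕ) :
    ∑ ij ∈ Finset.HasAntidiagonal.antidiagonal m,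
      gradedComm 1 1 (rinehartOp hA Δ ij.1) (rinehartOp hA Δ ij.2) = 0 := by
  have h : ∀ f g : GSym 𝒜 ℒ →ₗ[K] GSym 𝒜 ℒ, gradedComm 1 1 f g = f ∘ₗ g + g ∘ₗ f := by
    intro f g
    rw [gradedComm, show sgn (1 * 1) = -1 by simp [sgn], neg_smul, one_smul, sub_neg_eq_add]
  have h1 := rinehartSquare_eq_zero hA hΔ m
  rw [rinehartSquare] at h1
  simp only [h]
  rw [Finset.sum_add_distrib, h1, zero_add, ← h1, ← Finset.Nat.sum_antidiagonal_swap]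
  rfl

end RinehartSquare

theorem word_map {α β : Type*} (f : α → β) {n : ℕ} (v : Fin n → α) :
    word (fun i => f (v i)) = (word v).map f := by
  simp only [word, List.map_reverse, List.map_ofFn]
  rfl

/-! ### Multilinear maps on homogeneous elements -/

section MultilinearExt

variable {K M N : Type*} [Field K] [AddCommGroup M] [Module K M] [AddCommGroup N] [Module K N]

/-- A multilinear map is determined by its values on homogeneous elements. -/
theorem multilinearMap_ext_of_homogeneous (ℳ : ℤ → Submodule K M) [DirectSum.Decomposition ℳ]
    {n : ℕ} {f g : MultilinearMap K (fun _ : Fin n => M) N}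
    (h : ∀ v : Fin n → Homog ℳ, f (fun i => (v i).val) = g (fun i => (v i).val)) : f = g := by
  induction n with
  | zero =>
    ext u
    have h1 := h Fin.elim0
    rwa [Subsingleton.elim (fun i => (Fin.elim0 i : Homog ℳ).val) u] at h1
  | succ n ih =>
    have key : f.curryLeft = g.curryLeft := by
      refine linearMap_ext_of_homogeneous ℳ fun i x hx => ih fun v => ?_
      have h1 := h (Fin.cons ⟨i, x, hx⟩ v)
      have h2 : (fun j => (Fin.cons (⟨i, x, hx⟩ : Homog ℳ) v : Fin (n + 1) → Homog ℳ) j |>.val) =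
          Fin.cons x (fun j => (v j).val) :=
        Fin.comp_cons (fun y : Homog ℳ => y.val) _ v
      rw [h2] at h1
      exact h1
    rw [← MultilinearMap.uncurry_curryLeft f, key, MultilinearMap.uncurry_curryLeft]

end MultilinearExt

/-! ### Derived brackets of the Rinehart operator on generators -/

section BracketExtension

variable {K A L : Type*} [Field K] [Ring A] [Algebra K A]
  [AddCommGroup L] [Module K L] [Module A L]
  {𝒜 : ℤ → Submodule K A} {ℒ : ℤ → Submodule K L} [SetLike.GradedSMul 𝒜 ℒ] [GradedAlgebra 𝒜]
  [DirectSum.Decomposition ℒ] {X : LRInfinity 𝒜 ℒ}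

/-- By symmetry the two elements of `A` may be made the innermost commutators, where the result is
already zero. The other letters are then arbitrary and need not come from `L`. -/
theorem wordComm_rinehartOp_cons_cons (hA : GradedCommutative 𝒜) (Δ : RightConnection X 𝒜) (k : ℕ)
    (a b : Homog 𝒜) (w : List (Homog (GSym.grading 𝒜 ℒ))) :
    wordComm 1 (rinehartOp hA Δ k) (b.toGSymA ℒ :: a.toGSymA ℒ :: w) = 0 := by
  have hs := wordComm_symm (GSym.grading_comm (ℒ := ℒ) hA) 1 (rinehartOp hA Δ k)
  have h0 : wordComm 1 (rinehartOp hA Δ k) (w ++ [b.toGSymA ℒ, a.toGSymA ℒ]) = 0 :=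
    wordComm_eq_zero_of_suffix (wordComm_symbolOp_cons_cons hA _ a b []) w
  have h1 := (hs.cons (b.toGSymA ℒ)).move w (a.toGSymA ℒ) []
  rw [hs.move] at h0
  rw [h1, sgn_smul_sgn_smul, List.append_nil] at h0
  have h2 := congrArg (sgn ((b.toGSymA ℒ).deg * wordDeg Homog.deg w +
    (a.toGSymA ℒ).deg * wordDeg Homog.deg w) • ·) h0
  simpa only [sgn_smul_self, smul_zero] using h2

/-- For `k = 0` the connection cannot contribute, and the only bracket left is `X_0 = 0`. -/
theorem rinehartOp_zero (hA : GradedCommutative 𝒜) (Δ : RightConnection X 𝒜) :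
    rinehartOp hA Δ 0 = 0 := by
  refine gsym_linearMap_ext_of_words hA fun w a => ?_
  rw [LinearMap.zero_apply, apply_wordProd_mul 1, shuffleSum_wordToGSym]
  refine (shuffleSum_congr (G := fun _ _ => 0) _ fun p q _ => ?_).trans (shuffleSum_zero _ _)
  rw [wordComm_rinehartOp_ofA, if_neg (Nat.succ_ne_zero _), sub_zero]
  split_ifs with h
  · obtain rfl := List.length_eq_zero_iff.1 h
    have h0 : evalMulti X.bracket ([] : List (Homog ℒ)) = 0 := by
      change X.bracket 0 _ = 0
      rw [X.bracket_zero]; rfl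
    rw [h0, map_zero, zero_mul, mul_zero, smul_zero]
  · rw [mul_zero, smul_zero]

/-- The derived brackets of the Rinehart operator extend the brackets and the anchors. -/
theorem derivedBracket_isBracketExtension (hA : GradedCommutative 𝒜) (Δ : RightConnection X 𝒜) :
    IsBracketExtension X (derivedBracket (GSym.grading 𝒜 ℒ) (rinehartOp hA Δ)) where
  multiderivation := derivedBracket_isMultiderivation (GSym.grading_comm hA)
    (rinehartOp_hasDegree hA Δ) (rinehartOp_zero hA Δ) (rinehartOp_order hA Δ)
  bracket k ξ := by
    refine DFunLike.congr_fun (f := (derivedBracket (GSym.grading 𝒜 ℒ)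
      (rinehartOp hA Δ) k).compLinearMap (fun _ => GSym.ofL 𝒜 ℒ))
      (g := (GSym.ofL 𝒜 ℒ).compMultilinearMap (X.bracket k))
      (multilinearMap_ext_of_homogeneous ℒ fun v => ?_) ξ
    have h := derivedBracket_apply (rinehartOp_hasDegree hA Δ) (fun i => (v i).toGSymL 𝒜)
    refine h.trans ?_
    rw [word_map]
    refine (wordComm_rinehartOp hA Δ k (word v)).trans ?_
    rw [rinehartLeft, length_word, if_pos rfl, if_neg (Nat.succ_ne_self k), sub_zero,
      evalMulti_word]
    rfl
  anchor k ξ a := by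
    have key : (LinearMap.lcomp K (GSym 𝒜 ℒ) (GSym.ofA 𝒜 ℒ).toLinearMap).compMultilinearMap
        ((derivedBracket (GSym.grading 𝒜 ℒ) (rinehartOp hA Δ) (k + 1)).curryRight.compLinearMap
          (fun _ => GSym.ofL 𝒜 ℒ)) =
        (LinearMap.compRight K (GSym.ofA 𝒜 ℒ).toLinearMap).compMultilinearMap (X.anchor k) := by
      refine multilinearMap_ext_of_homogeneous ℒ fun v =>
        linearMap_ext_of_homogeneous 𝒜 fun i a ha => ?_
      have h := derivedBracket_snoc (rinehartOp_hasDegree hA Δ) (fun i => (v i).toGSymL 𝒜)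
        (Homog.toGSymA ℒ ⟨i, a, ha⟩)
      refine h.trans ?_
      rw [word_map]
      refine (wordComm_rinehartOp_cons hA Δ (k + 1) ⟨i, a, ha⟩ (word v)).trans ?_
      rw [rinehartRight_apply, length_word, if_pos rfl, evalMulti_word]
      rfl
    exact LinearMap.congr_fun (DFunLike.congr_fun key ξ) a
  scalar k u a b := by
    -- Currying the last two arguments allows each variable to be reduced to homogeneous elements
    -- separately.
    let H := (derivedBracket (GSym.grading 𝒜 ℒ) (rinehartOp hA Δ) (k + 2)).curryRight.curryRight
    have h1 : ∀ (v : Fin k → Homog (GSym.grading 𝒜 ℒ)) (a b : A),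
        H (fun i => (v i).val) (GSym.ofA 𝒜 ℒ a) (GSym.ofA 𝒜 ℒ b) = 0 := by
      intro v a b
      refine LinearMap.congr_fun (f := (H (fun i => (v i).val)).flip (GSym.ofA 𝒜 ℒ b) ∘ₗ
        (GSym.ofA 𝒜 ℒ).toLinearMap) (g := 0) (linearMap_ext_of_homogeneous 𝒜 fun i a ha => ?_) a
      refine LinearMap.congr_fun (f := (H (fun i => (v i).val)) (GSym.ofA 𝒜 ℒ a) ∘ₗ
        (GSym.ofA 𝒜 ℒ).toLinearMap) (g := 0) (linearMap_ext_of_homogeneous 𝒜 fun j b hb => ?_) b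
      have h := derivedBracket_snoc (rinehartOp_hasDegree hA Δ)
        (Fin.snoc v (Homog.toGSymA ℒ ⟨i, a, ha⟩) : Fin (k + 1) → _)
        (Homog.toGSymA ℒ ⟨j, b, hb⟩)
      rw [word_snoc, wordComm_rinehartOp_cons_cons] at h
      refine Eq.trans ?_ h
      change derivedBracket _ _ (k + 2) _ = derivedBracket _ _ (k + 2) _
      congr 1
      refine congrArg (fun z => (Fin.snoc z _ : Fin (k + 2) → GSym 𝒜 ℒ)) ?_
      exact (Fin.comp_snoc (fun y : Homog (GSym.grading 𝒜 ℒ) => y.val) v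
        (Homog.toGSymA ℒ ⟨i, a, ha⟩)).symm
    exact DFunLike.congr_fun (f := ((LinearMap.applyₗ (R := K) (GSym.ofA 𝒜 ℒ b) :
      (GSym 𝒜 ℒ →ₗ[K] GSym 𝒜 ℒ) →ₗ[K] GSym 𝒜 ℒ) ∘ₗ (LinearMap.applyₗ (R := K)
        (GSym.ofA 𝒜 ℒ a) : _ →ₗ[K] (GSym 𝒜 ℒ →ₗ[K] GSym 𝒜 ℒ))).compMultilinearMap H)
      (g := 0) (multilinearMap_ext_of_homogeneous (GSym.grading 𝒜 ℒ) fun v => h1 v a b) u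

end BracketExtension

/-! ### Uniqueness of the bracket extension -/

section BracketExtensionUnique

variable {K A L : Type*} [Field K] [Ring A] [Algebra K A]
  [AddCommGroup L] [Module K L] [Module A L]
  {𝒜 : ℤ → Submodule K A} {ℒ : ℤ → Submodule K L} [SetLike.GradedSMul 𝒜 ℒ] [GradedAlgebra 𝒜]
  [DirectSum.Decomposition ℒ] {X : LRInfinity 𝒜 ℒ}

/-- A graded symmetric function of words in `S_A^• L` that is a derivation in the head of the word
vanishes if it vanishes on words of generators. -/
theorem wordSymmetric_derivation_eq_zero
    {f : List (Homog (GSym.grading 𝒜 ℒ)) → GSym 𝒜 ℒ} (hf : WordSymmetric Homog.deg f)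
    (hd : ∀ w, ∃ φ : GSym 𝒜 ℒ →ₗ[K] GSym 𝒜 ℒ, (∀ x, f (x :: w) = φ x.val) ∧
      ∀ (x : Homog (GSym.grading 𝒜 ℒ)) (y : GSym 𝒜 ℒ), φ (x.val * y) =
        sgn ((1 + wordDeg Homog.deg w) * x.deg) • (x.val * φ y) + φ x.val * y)
    (hL : ∀ w : List (Homog ℒ), f (wordToGSym 𝒜 w) = 0)
    (hA : ∀ (a : Homog 𝒜) (w : List (Homog ℒ)), f (a.toGSymA ℒ :: wordToGSym 𝒜 w) = 0)
    (hAA : ∀ (a b : Homog 𝒜) (w : List (Homog (GSym.grading 𝒜 ℒ))),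
      f (b.toGSymA ℒ :: a.toGSymA ℒ :: w) = 0) (w : List (Homog (GSym.grading 𝒜 ℒ))) :
    f w = 0 := by
  have hmove : ∀ {g : List (Homog (GSym.grading 𝒜 ℒ)) → GSym 𝒜 ℒ}, WordSymmetric Homog.deg g →
      ∀ p x w, g (p ++ x :: w) = 0 → g (x :: (p ++ w)) = 0 := by
    intro g hg p x w h
    rw [hg.move] at h
    have h2 := congrArg (sgn (x.deg * wordDeg Homog.deg p) • ·) h
    simpa only [sgn_smul_self, smul_zero] using h2
  let G : Homog (GSym.grading 𝒜 ℒ) → Prop := fun x =>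
    (∃ a : Homog 𝒜, x = a.toGSymA ℒ) ∨ ∃ y : Homog ℒ, x = y.toGSymL 𝒜
  -- Letters from `L` are collected at the end of the word; a second letter from `A` ends the
  -- argument at once.
  have h1 : ∀ (p : List (Homog (GSym.grading 𝒜 ℒ))) (a : Homog 𝒜) (w : List (Homog ℒ)),
      (∀ x ∈ p, G x) → f (a.toGSymA ℒ :: (p ++ wordToGSym 𝒜 w)) = 0 := by
    intro p
    induction p with
    | nil => exact fun a w _ => hA a w
    | cons x p ih =>
      intro a w hp
      have hp' : ∀ y ∈ p, G y := fun y hy => hp y (List.mem_cons_of_mem _ hy)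
      rcases hp x List.mem_cons_self with ⟨b, rfl⟩ | ⟨y, rfl⟩
      · exact hAA _ _ _
      · exact hmove (hf.cons _) p _ _ (ih a (y :: w) hp')
  have h2 : ∀ (p : List (Homog (GSym.grading 𝒜 ℒ))) (w : List (Homog ℒ)),
      (∀ x ∈ p, G x) → f (p ++ wordToGSym 𝒜 w) = 0 := by
    intro p
    induction p with
    | nil => exact fun w _ => hL w
    | cons x p ih =>
      intro w hp
      have hp' : ∀ y ∈ p, G y := fun y hy => hp y (List.mem_cons_of_mem _ hy)
      rcases hp x List.mem_cons_self with ⟨b, rfl⟩ | ⟨y, rfl⟩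
      · exact h1 p b w hp'
      · exact hmove hf p _ _ (ih (y :: w) hp')
  -- Generators are replaced by arbitrary letters one at a time, the unrestricted ones forming the
  -- prefix `p`.
  have h3 : ∀ p w : List (Homog (GSym.grading 𝒜 ℒ)), (∀ x ∈ w, G x) → f (p ++ w) = 0 := by
    intro p
    induction p with
    | nil =>
      intro w hw
      simpa [wordToGSym] using h2 w [] hw
    | cons x p ih =>
      intro w hw
      obtain ⟨φ, hφ, hφ'⟩ := hd (p ++ w)
      have hG : ∀ y, G y → φ y.val = 0 := fun y hy => by
        rw [← hφ]
        refine hmove hf p y w (ih (y :: w) ?_)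
        rintro z hz
        rcases List.mem_cons.1 hz with rfl | hz
        · exact hy
        · exact hw z hz
      -- A derivation that vanishes on generators is zero; the unit is covered as the image of `1`
      -- in `A`.
      have hφ0 : φ = 0 := by
        refine gsym_linearMap_ext fun d v hv => ?_
        rw [LinearMap.zero_apply]
        induction hv with
        | one =>
          have h := hG _ (Or.inl ⟨⟨0, 1, SetLike.GradedOne.one_mem⟩, rfl⟩)
          change φ (GSym.ofA 𝒜 ℒ 1) = 0 at h
          rwa [map_one] at h
        | @mulA i d a v ha hv ih =>
          have h := hφ' (Homog.toGSymA ℒ ⟨i, a, ha⟩) v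
          rw [hG _ (Or.inl ⟨_, rfl⟩), ih, mul_zero, smul_zero, zero_mul, add_zero] at h
          exact h
        | @mulL i d ξ v hξ hv ih =>
          have h := hφ' (Homog.toGSymL 𝒜 ⟨i, ξ, hξ⟩) v
          rw [hG _ (Or.inr ⟨_, rfl⟩), ih, mul_zero, smul_zero, zero_mul, add_zero] at h
          exact h
      rw [List.cons_append, hφ, hφ0, LinearMap.zero_apply]
  simpa using h3 w [] (by simp)

theorem IsMultiderivation.evalMulti_cons_derivation {B : Type*} [Ring B] [Algebra K B]
    {ℬ : ℤ → Submodule K B} {Λ : ∀ k : ℕ, MultilinearMap K (fun _ : Fin k => B) B}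
    (hΛ : IsMultiderivation ℬ Λ) (w : List (Homog ℬ)) :
    ∃ φ : B →ₗ[K] B, (∀ x, evalMulti Λ (x :: w) = φ x.val) ∧
      ∀ (x : Homog ℬ) (y : B), φ (x.val * y) =
        sgn ((1 + wordDeg Homog.deg w) * x.deg) • (x.val * φ y) + φ x.val * y := by
  refine ⟨(Λ (w.length + 1)).curryRight (fun i => (letters w i).val),
    fun x => evalMulti_cons Λ x w, fun x y => ?_⟩
  have h := hΛ.leibniz w.length _ _ (fun i => (letters w i).mem) x.deg x.val x.mem y
  rw [sum_letters] at h
  exact h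

namespace IsBracketExtension

variable {Λ Λ' : ∀ k : ℕ, MultilinearMap K (fun _ : Fin k => GSym 𝒜 ℒ) (GSym 𝒜 ℒ)}

theorem evalMulti_wordToGSym (hΛ : IsBracketExtension X Λ) (w : List (Homog ℒ)) :
    evalMulti Λ (wordToGSym 𝒜 w) = GSym.ofL 𝒜 ℒ (evalMulti X.bracket w) := by
  have h : wordToGSym 𝒜 w = word (fun i => (letters w i).toGSymL 𝒜) := by
    rw [word_map, word_letters]; rfl
  rw [h, evalMulti_word]
  exact hΛ.bracket _ _

theorem evalMulti_cons_wordToGSym (hΛ : IsBracketExtension X Λ) (a : Homog 𝒜)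
    (w : List (Homog ℒ)) :
    evalMulti Λ (a.toGSymA ℒ :: wordToGSym 𝒜 w) = GSym.ofA 𝒜 ℒ (evalMulti X.anchor w a.val) := by
  have h : wordToGSym 𝒜 w = word (fun i => (letters w i).toGSymL 𝒜) := by
    rw [word_map, word_letters]; rfl
  rw [h, ← word_snoc, evalMulti_word]
  refine Eq.trans ?_ (hΛ.anchor _ (fun i => (letters w i).val) a.val)
  congr 1
  exact Fin.comp_snoc (fun y : Homog (GSym.grading 𝒜 ℒ) => y.val) _ _

theorem evalMulti_cons_cons (hΛ : IsBracketExtension X Λ) (a b : Homog 𝒜)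
    (w : List (Homog (GSym.grading 𝒜 ℒ))) :
    evalMulti Λ (b.toGSymA ℒ :: a.toGSymA ℒ :: w) = 0 := by
  rw [← word_letters w, ← word_snoc, ← word_snoc, evalMulti_word]
  refine Eq.trans ?_ (hΛ.scalar _ (fun i => (letters w i).val) a.val b.val)
  congr 1
  refine (Fin.comp_snoc (fun y : Homog (GSym.grading 𝒜 ℒ) => y.val) _ _).trans ?_
  refine congrArg (fun z => (Fin.snoc z _ : Fin (w.length + 2) → GSym 𝒜 ℒ)) ?_
  exact Fin.comp_snoc (fun y : Homog (GSym.grading 𝒜 ℒ) => y.val) _ _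

/-- The difference of two extensions is again symmetric and a derivation in the head letter, and it
vanishes on words of generators. -/
theorem unique (hΛ : IsBracketExtension X Λ) (hΛ' : IsBracketExtension X Λ') : Λ' = Λ := by
  funext k
  refine multilinearMap_ext_of_homogeneous (GSym.grading 𝒜 ℒ) fun v => ?_
  rw [← evalMulti_word, ← evalMulti_word, ← sub_eq_zero]
  refine wordSymmetric_derivation_eq_zero (𝒜 := 𝒜) (ℒ := ℒ)
    (f := fun w => evalMulti Λ' w - evalMulti Λ w) (fun p x y w => ?_) (fun w => ?_)
    (fun w => ?_) (fun a w => ?_) (fun a b w => ?_) (word v)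
  · simp only
    rw [evalMulti_symm hΛ'.multiderivation.symm, evalMulti_symm hΛ.multiderivation.symm, smul_sub]
  · obtain ⟨φ, h1, h2⟩ := hΛ.multiderivation.evalMulti_cons_derivation w
    obtain ⟨φ', h1', h2'⟩ := hΛ'.multiderivation.evalMulti_cons_derivation w
    refine ⟨φ' - φ, fun x => by rw [h1, h1', LinearMap.sub_apply], fun x y => ?_⟩
    simp only [LinearMap.sub_apply, h2, h2', mul_sub, sub_mul, smul_sub]
    abel
  · simp only [hΛ.evalMulti_wordToGSym, hΛ'.evalMulti_wordToGSym, sub_self]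
  · simp only [hΛ.evalMulti_cons_wordToGSym, hΛ'.evalMulti_cons_wordToGSym, sub_self]
  · simp only [hΛ.evalMulti_cons_cons, hΛ'.evalMulti_cons_cons, sub_self]

end IsBracketExtension

end BracketExtensionUnique

/-! ### The proposition -/

theorem mainTheorem1 {K A L : Type*} [Field K] [CharZero K]
    [Ring A] [Algebra K A] (𝒜 : ℤ → Submodule K A) [GradedAlgebra 𝒜]
    (hA : GradedCommutative 𝒜)
    [AddCommGroup L] [Module K L] [Module A L] [IsScalarTower K A L]
    (ℒ : ℤ → Submodule K L) [DirectSum.Decomposition ℒ] [SetLike.GradedSMul 𝒜 ℒ]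
    (X : LRInfinity 𝒜 ℒ) (Δ : RightConnection X 𝒜) (hΔ : Δ.IsFlat) :
    ∃ (D : ℕ → GSym 𝒜 ℒ →ₗ[K] GSym 𝒜 ℒ)
      (Λ : ∀ k : ℕ, MultilinearMap K (fun _ : Fin k => GSym 𝒜 ℒ) (GSym 𝒜 ℒ)),
      -- `D` is the Rinehart operator of `Δ`
      (IsRinehartOperator Δ D ∧ ∀ D', IsRinehartOperator Δ D' → D' = D) ∧
      -- `Λ` is the `P_∞[1]` structure of `S_A^• L` determined by the brackets and anchors
      (IsPInfinity (GSym.grading 𝒜 ℒ) Λ ∧ IsBracketExtension X Λ ∧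
        ∀ Λ', IsBracketExtension X Λ' → Λ' = Λ) ∧
      -- the operators `D_k`
      (∀ (k : ℕ) (d : ℤ) (u : GSym 𝒜 ℒ), u ∈ GSym.grading 𝒜 ℒ d →
        D k u ∈ GSym.grading 𝒜 ℒ (d + 1)) ∧
      (∀ k : ℕ, IsDiffOp (GSym.grading 𝒜 ℒ) 1 k (D k)) ∧
      (∀ k : ℕ, ∑ p ∈ Finset.HasAntidiagonal.antidiagonal k, gradedComm 1 1 (D p.1) (D p.2) = 0) ∧
      (∀ k : ℕ, k ≠ 1 → D k 1 = 0) ∧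
      D 1 1 = -GSym.ofA 𝒜 ℒ (Δ.form 0 ![] 1) ∧
      (IsBVInfinity (GSym.grading 𝒜 ℒ) D ↔ Δ.form 0 ![] 1 = 0) ∧
      -- the higher derived bracket formula
      (∀ (k : ℕ) (d : Fin k → ℤ) (u : Fin k → GSym 𝒜 ℒ),
        (∀ i, u i ∈ GSym.grading 𝒜 ℒ (d i)) →
          Λ k u = iterComm 1 (D k) k d u 1) := by
  have hB := GSym.grading_comm (ℒ := ℒ) hA
  have hdeg := rinehartOp_hasDegree hA Δ
  have hR := rinehartOp_isRinehartOperator hA Δ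
  have hE := derivedBracket_isBracketExtension hA Δ
  have hsq := sum_gradedComm_rinehartOp hA hΔ
  have hmem : ∀ (k : ℕ) (d : ℤ) (u : GSym 𝒜 ℒ), u ∈ GSym.grading 𝒜 ℒ d →
      rinehartOp hA Δ k u ∈ GSym.grading 𝒜 ℒ (d + 1) := fun k d u hu => by
    rw [add_comm]; exact hdeg k d u hu
  have hord : ∀ k : ℕ, IsDiffOp (GSym.grading 𝒜 ℒ) 1 k (rinehartOp hA Δ k) := fun k d u hu => by
    have h := iterComm_eq_wordComm 1 (rinehartOp hA Δ k)
      (fun i => (⟨d i, u i, hu i⟩ : Homog (GSym.grading 𝒜 ℒ)))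
    exact h.trans (rinehartOp_order hA Δ k _ (by rw [length_word]; exact Nat.lt_succ_self k))
  -- At the empty word the connection enters only for `k = 1`, and the bracket only for `k = 0`,
  -- where it is zero.
  have hone : ∀ k : ℕ, k ≠ 1 → rinehartOp hA Δ k 1 = 0 := fun k hk => by
    have h := wordComm_rinehartOp_ofA hA Δ k [] 1
    change rinehartOp hA Δ k _ = _ at h
    rw [map_one, if_neg (show ¬ ([] : List (Homog ℒ)).length + 1 = k from fun h => hk h.symm)] at h
    rw [h, sub_zero]
    split_ifs with h0
    · have h0 : evalMulti X.bracket ([] : List (Homog ℒ)) = 0 := by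
        change X.bracket 0 _ = 0
        rw [X.bracket_zero]; rfl
      rw [h0, map_zero, zero_mul]
    · rfl
  have hone' : rinehartOp hA Δ 1 1 = -GSym.ofA 𝒜 ℒ (Δ.form 0 ![] 1) := by
    have h := wordComm_rinehartOp_ofA hA Δ 1 [] 1
    change rinehartOp hA Δ 1 _ = _ at h
    rw [map_one, if_neg (by simp), if_pos (by simp), zero_sub] at h
    rw [h]
    change -GSym.ofA 𝒜 ℒ (Δ.form 0 _ 1) = _
    congr 5
    exact Subsingleton.elim _ _
  refine ⟨rinehartOp hA Δ, derivedBracket (GSym.grading 𝒜 ℒ) (rinehartOp hA Δ),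
    ⟨hR, fun D' hD' => hR.unique hA hD'⟩,
    ⟨⟨hB, hE.multiderivation, derivedBracket_jacobi hB hdeg (rinehartOp_order hA Δ)
      (rinehartSquare_eq_zero hA hΔ)⟩, hE, fun Λ' hΛ' => hE.unique hΛ'⟩,
    hmem, hord, hsq, hone, hone', ⟨fun h => ?_, fun h => ?_⟩, fun k d u hu => ?_⟩
  · have h1 := h.one 1
    rw [hone', neg_eq_zero] at h1
    -- The obstruction is found in the symmetric algebra and descends to `A` because `A` embeds.
    exact GSym.ofA_injective 𝒜 ℒ (h1.trans (map_zero _).symm)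
  · refine ⟨hB, rinehartOp_zero hA Δ, hmem, hord, fun k => ?_, hsq⟩
    by_cases hk : k = 1
    · rw [hk, hone', h, map_zero, neg_zero]
    · exact hone k hk
  · have h := derivedBracket_apply hdeg
      (fun i => (⟨d i, u i, hu i⟩ : Homog (GSym.grading 𝒜 ℒ)))
    rw [← iterComm_eq_wordComm] at h
    exact h
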